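/- Let $M$ be a smooth manifold (Hausdorff, second countable, without boundary, of dimension $d$), equipped with a smooth volume measure $\mu$ (in every chart, $\mu$ has a smooth strictly positive density with respect to Lebesgue measure). Let $\mathcal{E}=C^\infty(M,\mathbb{R})$ with its Fréchet topology of uniform convergence of all derivatives on compact sets, and let $\mathcal{D}(N)$ be the space of smooth compactly supported functions $N\to\mathbb{C}$ on a manifold $N$. For $F:\mathcal{E}\to\mathbb{C}$ let $F^{(n)}(\varphi)\{h_1,\dots,h_n\}$ denote its $n$-fold iterated directional derivative. $F$ is *smooth* (in the sense of Bastiani) if for every $n$ all $n$-fold directional derivatives exist and $(\varphi,h_1,\dots,h_n)\mapsto F^{(n)}(\varphi)\{h_1,\dots,h_n\}$ is jointly continuous on $\mathcal{E}\times\mathcal{E}^n$. The spacetime support of $F$ is the complement of the set of those $x\in M$ that have an open neighbourhood $U$ such that $F(\varphi)=F(\psi)$ whenever $\varphi=\psi$ on $M\setminus U$. $F$ is *regular* if it is smooth, has compact spacetime support, and $F^{(n)}(\varphi)\in\mathcal{D}(M^n)$ for all $n$ and $\varphi$, i.e. $F^{(n)}(\varphi)\{h_1,\dots,h_n\}=\int_{M^n}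 f\cdot(h_1\otimes\dots\otimes h_n)\,d\mu^{n}$ for some $f\in\mathcal{D}(M^n)$. For $W\in\mathcal{D}'(M\times M)$ (a distribution on $M\times M$, with wavefront set $\mathrm{WF}(W)\subset T^*(M\times M)\setminus 0$) and regular $F,G$ define $$\{F,G\}_W(\varphi)=W\big(F^{(1)}(\varphi)\otimes G^{(1)}(\varphi)\big).$$ **Theorem.** 1. $\{F,G\}_W$ is a smooth functional for all regular functionals $F$ and $G$ if and only if $\mathrm{WF}(W)=\emptyset$. 2. If $\mathrm{WF}(W)\neq\emptyset$, then there are regular functionals $F$ and $G$ such that $\{F,G\}_W$ is not even continuous. For every set $\mathcal{V}$ of covectors of $M$, these $F$ and $G$ are microcausal with respect to $\mathcal{V}$, while $\{F,G\}_W$ is not. Here $F$ is *microcausal* with respect to $\mathcal{V}$ if it is smooth and $\mathrm{WF}(F^{(n)}(\varphi))\cap\Gamma_n=\emptyset$ for all $n$ and $\varphi$, where $\Gamma_n=\mathcal{V}^{\dot\times n}\cup(-\mathcal{V})^{\dot\times n}$ and $\mathcal{V}^{\dot\times n}\subset T^*(M^n)$ is the set of nonzero covectors each of whose $n$ components is zero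 or in $\mathcal{V}$; the distribution $F^{(n)}(\varphi)$ on $M^n$ is given by $h_1\otimes\dots\otimes h_n\mapsto F^{(n)}(\varphi)\{h_1,\dots,h_n\}$. (For $W=\Delta$ the commutator function, $\{\cdot,\cdot\}_W$ is the Poisson bracket; for $W=\Delta^+$ a two-point function, $\{F,G\}_W$ is the coefficient of $\hbar$ in the star product $F\star G=\sum_n\frac{\hbar^n}{n!}\langle F^{(n)},(\Delta^+)^{\otimes n}G^{(n)}\rangle$. So microcausal functionals are closed under neither operation when $\Delta$, resp. $\Delta^+$, has nonempty wavefront set.) -/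

import Mathlib

open Set Filter Topology MeasureTheory
open scoped Manifold ContDiff

noncomputable section

namespace PAQFT

/-! ### Smooth functions, test functions and distributions on a manifold without boundary -/

section Distributions

variable {E : Type*} [NormedAddCommGroup E] [NormedSpace ℝ E]
  {H : Type*} [TopologicalSpace H] (I : ModelWithCorners ℝ E H)
  (N : Type*) [TopologicalSpace N] [ChartedSpace H N]

/-- The topology of uniform convergence of all derivatives, in charts, on compact subsets of the
charts. (Only its restriction to smooth functions is used.) -/
@[reducible] def smoothTopology (V : Type*) [NormedAddCommGroup V] [NormedSpace ℝ V] :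
    TopologicalSpace (N → V) :=
  ⨅ (c : N) (n : ℕ), TopologicalSpace.induced
    (fun f : N → V =>
      UniformOnFun.ofFun {K : Set E | IsCompact K ∧ K ⊆ (extChartAt I c).target}
        (iteratedFDeriv ℝ n (f ∘ (extChartAt I c).symm)))
    inferInstance

/-- The space `𝓔(N) = C^∞(N, ℝ)` carries its usual Fréchet topology. -/
instance smoothFunctionsTopology : TopologicalSpace C^∞⟮I, N; 𝓘(ℝ, ℝ), ℝ⟯ :=
  TopologicalSpace.induced (fun f => (f : N → ℝ)) (smoothTopology I N ℝ)

/-- `𝓓(N)`: the smooth compactly supported functions `N → ℂ`. -/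
def TestFun : Submodule ℂ (N → ℂ) where
  carrier := {f | ContMDiff I 𝓘(ℝ, ℂ) ∞ f ∧ HasCompactSupport f}
  add_mem' hf hg := ⟨hf.1.add hg.1, hf.2.add hg.2⟩
  zero_mem' := ⟨contMDiff_const, HasCompactSupport.zero⟩
  smul_mem' c _ hf :=
    ⟨(contDiff_const_smul c).contMDiff.comp hf.1, hf.2.comp_left (g := fun z => c • z) (smul_zero c)⟩

/-- `𝓓'(N)`: the linear functionals on `𝓓(N)` whose restriction to each of the spaces
`𝓓_K(N) = {f ∈ 𝓓(N) | supp f ⊆ K}`, `K ⊆ N` compact, is continuous for the topology of uniform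
convergence of all derivatives, i.e. the continuous linear functionals on the LF-space `𝓓(N)`. -/
structure Distr where
  toLinearMap : TestFun I N →ₗ[ℂ] ℂ
  continuousOn' : ∀ K : Set N, IsCompact K →
    @ContinuousOn (TestFun I N) ℂ
      (TopologicalSpace.induced (fun f => (f : N → ℂ)) (smoothTopology I N ℂ)) inferInstance
      toLinearMap {f | tsupport (f : N → ℂ) ⊆ K}

instance : CoeFun (Distr I N) (fun _ => TestFun I N → ℂ) := ⟨fun u => u.toLinearMap⟩

variable {I N}

/-- If `χ` is a test function supported in the domain of the preferred chart `κ` around `x` and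
`η` is a covector, this is the test function `y ↦ χ(y) exp(-i ⟨η, κ(y)⟩)`. -/
def modulate [IsManifold I ∞ N] (x : N) (χ : TestFun I N)
    (hχ : tsupport (χ : N → ℂ) ⊆ (chartAt H x).source) (η : E →L[ℝ] ℝ) : TestFun I N :=
  ⟨fun y => χ.1 y * Complex.exp (-(Complex.I * (η (extChartAt I x y) : ℂ))), by
    refine ⟨?_, χ.2.2.mul_right⟩
    refine contMDiff_of_tsupport (fun y hy => ?_)
    have hy' : y ∈ (chartAt H x).source :=
      hχ (closure_mono (Function.support_mul_subset_left _ _) hy)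
    have h1 : ContMDiffAt I 𝓘(ℝ, E) ∞ (extChartAt I x) y := contMDiffAt_extChartAt' hy'
    have h2 : ContDiff ℝ ∞ (fun e : E => Complex.exp (-(Complex.I * (η e : ℂ)))) := by
      have : ContDiff ℝ ∞ (fun e : E => (η e : ℂ)) :=
        Complex.ofRealCLM.contDiff.comp η.contDiff
      fun_prop
    exact (contDiff_mul (𝕜 := ℝ) (𝔸 := ℂ)).contMDiff.contMDiffAt.comp y
      (χ.2.1.contMDiffAt.prodMk_space (h2.contMDiff.contMDiffAt.comp y h1))⟩

/-- `(x, ξ)` is a regular directed point of `u`: after multiplication with some test function `χ`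
with `χ(x) ≠ 0` and support in the chart around `x`, the Fourier transform of `u` in that chart
decays rapidly on an open conic neighbourhood of `ξ`. Covectors at `x` are read in the preferred
chart around `x`, which is also the chart through which `TangentSpace I x` is identified
with `E`. -/
def IsRegularDirected [IsManifold I ∞ N] (u : Distr I N) (x : N) (ξ : E →L[ℝ] ℝ) : Prop :=
  ∃ V : Set (E →L[ℝ] ℝ), IsOpen V ∧ ξ ∈ V ∧ 0 ∉ V ∧ (∀ η ∈ V, ∀ t : ℝ, 0 < t → t • η ∈ V) ∧
    ∃ (χ : TestFun I N) (hχ : tsupport (χ : N → ℂ) ⊆ (chartAt H x).source), χ.1 x ≠ 0 ∧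
      ∀ k : ℕ, ∃ C : ℝ, ∀ η ∈ V, (1 + ‖η‖) ^ k * ‖u (modulate x χ hχ η)‖ ≤ C

variable (I N) in
/-- The set of points `(x, ξ)` of the cotangent bundle of `N`. -/
abbrev Covectors : Type _ := Σ x : N, (TangentSpace I x →L[ℝ] ℝ)

/-- The wavefront set: the complement, in the cotangent bundle without its zero section, of the
set of regular directed points. -/
def WF [IsManifold I ∞ N] (u : Distr I N) : Set (Covectors I N) :=
  {p | p.2 ≠ 0 ∧ ¬ IsRegularDirected u p.1 (show E →L[ℝ] ℝ from p.2)}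

end Distributions

/-- A finite product of manifolds is a manifold. -/
instance isManifold_pi {ι : Type*} [Fintype ι] {E : Type*} [NormedAddCommGroup E]
    [NormedSpace ℝ E] {H : Type*} [TopologicalSpace H] (I : ModelWithCorners ℝ E H)
    (N : Type*) [TopologicalSpace N] [ChartedSpace H N] [IsManifold I ∞ N] :
    IsManifold (ModelWithCorners.pi fun _ : ι => I) ∞ (ι → N) := by
  apply isManifold_of_contDiffOn
  rintro _ _ ⟨e, he, rfl⟩ ⟨e', he', rfl⟩
  rw [contDiffOn_pi]
  intro i
  have h := (contDiffGroupoid ∞ I).compatible (he i (mem_univ i)) (he' i (mem_univ i))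
  rw [contDiffGroupoid, mem_groupoid_of_pregroupoid] at h
  refine ContDiffOn.comp (g := I ∘ (e i).symm ≫ₕ e' i ∘ I.symm) (f := fun x : ι → E => x i)
    h.1 (contDiff_apply ℝ E i).contDiffOn ?_
  rintro _ ⟨hx, y, rfl⟩
  refine ⟨?_, mem_range_self (y i)⟩
  have h1 := hx.1 i (mem_univ i)
  have h2 := hx.2 i (mem_univ i)
  exact ⟨h1, h2⟩

theorem contMDiff_piConst {E H N : Type*} [NormedAddCommGroup E]
    [NormedSpace ℝ E] [TopologicalSpace H] (I : ModelWithCorners ℝ E H)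
    [TopologicalSpace N] [ChartedSpace H N] {ι : Type*} [Fintype ι] :
    ContMDiff I (ModelWithCorners.pi fun _ : ι => I) ∞ (fun (x : N) (_ : ι) => x) := by
  intro x
  refine contMDiffAt_iff.2 ⟨by fun_prop, contDiffWithinAt_pi.2 fun i => ?_⟩
  exact (contMDiffAt_iff.1 (contMDiffAt_id (I := I) (n := ∞) (x := x))).2

/-! ### Smooth functionals -/

section Functionals

/-- The iterated directional derivative `F^(n)(φ){v₀, …, vₙ₋₁}` of a functional `F : A → ℂ`. -/
def dirDeriv {A : Type*} [AddCommGroup A] [Module ℝ A] (F : A → ℂ) :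
    (n : ℕ) → A → (Fin n → A) → ℂ
  | 0, φ, _ => F φ
  | n + 1, φ, v => lineDeriv ℝ (fun χ => dirDeriv F n χ (Fin.init v)) φ (v (Fin.last n))

/-- Bastiani smoothness: for every `n`, the `n`-fold directional derivatives exist (at all points,
in all directions) and define a jointly continuous map `A × Aⁿ → ℂ`. -/
def IsBastianiSmooth {A : Type*} [AddCommGroup A] [Module ℝ A] [TopologicalSpace A]
    (F : A → ℂ) : Prop :=
  ∀ n : ℕ, (∀ (φ : A) (v : Fin n → A) (ψ : A),
      LineDifferentiableAt ℝ (fun χ => dirDeriv F n χ v) φ ψ) ∧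
    Continuous fun p : A × (Fin n → A) => dirDeriv F n p.1 p.2

variable {d : ℕ} (M : Type*) [TopologicalSpace M] [ChartedSpace (EuclideanSpace ℝ (Fin d)) M]

/-- The configuration space `𝓔(M) = C^∞(M, ℝ)`. -/
abbrev Config : Type _ := C^∞⟮𝓡 d, M; 𝓘(ℝ, ℝ), ℝ⟯

/-- Test functions `𝓓(Mⁿ)`. -/
abbrev TestFunPow (n : ℕ) : Submodule ℂ ((Fin n → M) → ℂ) :=
  TestFun (ModelWithCorners.pi fun _ : Fin n => 𝓡 d) (Fin n → M)

/-- Distributions `𝓓'(Mⁿ)`. -/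
abbrev DistrPow (n : ℕ) : Type _ :=
  Distr (ModelWithCorners.pi fun _ : Fin n => 𝓡 d) (Fin n → M)

/-- Covectors of `Mⁿ`. -/
abbrev CovectorsPow (n : ℕ) : Type _ :=
  Covectors (ModelWithCorners.pi fun _ : Fin n => 𝓡 d) (Fin n → M)

/-- Bidistributions `𝓓'(M × M)`. -/
abbrev Bidistr : Type _ := Distr ((𝓡 d).prod (𝓡 d)) (M × M)

variable {M}

/-- The spacetime support of a functional. -/
def spacetimeSupport (F : Config (d := d) M → ℂ) : Set M :=
  {x | ∃ U : Set M, IsOpen U ∧ x ∈ U ∧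
    ∀ φ ψ : Config (d := d) M, (∀ y ∈ Uᶜ, φ y = ψ y) → F φ = F ψ}ᶜ

/-- The tensor product `(f ⊗ g)(x, y) = f(x) g(y)` of test functions. -/
def tensor [T2Space M] (f g : TestFun (𝓡 d) M) : TestFun ((𝓡 d).prod (𝓡 d)) (M × M) :=
  ⟨fun p => f.1 p.1 * g.1 p.2, by
    refine ⟨(contDiff_mul (𝕜 := ℝ) (𝔸 := ℂ)).contMDiff.comp
      ((f.2.1.comp contMDiff_fst).prodMk_space (g.2.1.comp contMDiff_snd)), ?_⟩
    refine HasCompactSupport.of_support_subset_isCompact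
      (f.2.2.isCompact.prod g.2.2.isCompact) fun p hp => ?_
    exact ⟨subset_tsupport _ (left_ne_zero_of_mul hp), subset_tsupport _ (right_ne_zero_of_mul hp)⟩⟩

/-- The dotted power `𝒱 ×̇ ⋯ ×̇ 𝒱` (`n` factors): nonzero covectors of `Mⁿ` each of whose components
is zero or belongs to `𝒱`. -/
def dottedPow (𝒱 : Set (Covectors (𝓡 d) M)) (n : ℕ) : Set (CovectorsPow (d := d) M n) :=
  {p | p.2 ≠ 0 ∧ ∀ i : Fin n,
    let ξ : TangentSpace (𝓡 d) (p.1 i) →L[ℝ] ℝ :=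
      (show (Fin n → EuclideanSpace ℝ (Fin d)) →L[ℝ] ℝ from p.2).comp
        (ContinuousLinearMap.single ℝ (fun _ : Fin n => EuclideanSpace ℝ (Fin d)) i)
    ξ = 0 ∨ (⟨p.1 i, ξ⟩ : Covectors (𝓡 d) M) ∈ 𝒱}

/-- The cone `Γₙ = 𝒱^{×̇ n} ∪ (-𝒱)^{×̇ n}`. -/
def microcausalCone (𝒱 : Set (Covectors (𝓡 d) M)) (n : ℕ) : Set (CovectorsPow (d := d) M n) :=
  dottedPow 𝒱 n ∪ dottedPow {p | (⟨p.1, -p.2⟩ : Covectors (𝓡 d) M) ∈ 𝒱} n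

/-- A functional is microcausal with respect to `𝒱` if it is smooth and, for all `n` and `φ`, the
wavefront set of `F^(n)(φ)` does not meet `Γₙ`. Here `F^(n)(φ)` is viewed as the distribution `u`
on `Mⁿ` with `u(h₁ ⊗ ⋯ ⊗ hₙ) = F^(n)(φ){h₁, …, hₙ}`. -/
def IsMicrocausal [IsManifold (𝓡 d) ∞ M] (𝒱 : Set (Covectors (𝓡 d) M))
    (F : Config (d := d) M → ℂ) : Prop :=
  IsBastianiSmooth F ∧ ∀ (n : ℕ) (φ : Config (d := d) M), ∃ u : DistrPow (d := d) M n,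
    (∀ (h : Fin n → Config (d := d) M) (w : TestFunPow (d := d) M n),
      (∀ x, w.1 x = ∏ i, (h i (x i) : ℂ)) → u w = dirDeriv F n φ h) ∧
    WF u ∩ microcausalCone 𝒱 n = ∅

variable [MeasurableSpace M]

/-- `μ` is a smooth volume measure: in each chart it has a smooth, strictly positive density with
respect to Lebesgue measure. -/
def IsSmoothVolume (d : ℕ) {M : Type*} [TopologicalSpace M]
    [ChartedSpace (EuclideanSpace ℝ (Fin d)) M] [MeasurableSpace M] (μ : Measure M) : Prop :=
  ∀ c : M, ∃ ρ : EuclideanSpace ℝ (Fin d) → ℝ,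
    ContDiffOn ℝ ∞ ρ (extChartAt (𝓡 d) c).target ∧ (∀ y ∈ (extChartAt (𝓡 d) c).target, 0 < ρ y) ∧
    (μ.restrict (extChartAt (𝓡 d) c).source).map (extChartAt (𝓡 d) c) =
      (volume.restrict (extChartAt (𝓡 d) c).target).withDensity (fun y => ENNReal.ofReal (ρ y))

/-- A regular functional: smooth, compactly supported, and such that every derivative
`F^(n)(φ)` is (integration against) an element of `𝓓(Mⁿ)`. -/
structure IsRegularFunctional (μ : Measure M) (F : Config (d := d) M → ℂ) : Prop where
  smooth : IsBastianiSmooth F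
  compact_support : IsCompact (spacetimeSupport F)
  kernel : ∀ (n : ℕ) (φ : Config (d := d) M), ∃ f : TestFunPow (d := d) M n,
    ∀ h : Fin n → Config (d := d) M,
      dirDeriv F n φ h = ∫ x, f.1 x * ∏ i, (h i (x i) : ℂ) ∂(Measure.pi fun _ => μ)

/-- `f` is the smooth density of `F^(1)(φ)`. -/
def IsGradient (μ : Measure M) (F : Config (d := d) M → ℂ) (φ : Config (d := d) M)
    (f : TestFun (𝓡 d) M) : Prop :=
  ∀ h : Config (d := d) M, dirDeriv F 1 φ (fun _ => h) = ∫ x, f.1 x * (h x : ℂ) ∂μ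

open Classical in
/-- The derivative `F^(1)(φ)` of a regular functional as an element of `𝓓(M)`
(see `IsRegularFunctional.isGradient_gradient`). -/
def gradient (μ : Measure M) (F : Config (d := d) M → ℂ) (φ : Config (d := d) M) :
    TestFun (𝓡 d) M :=
  if h : ∃ f, IsGradient μ F φ f then h.choose else 0

/-- For a regular functional, `gradient μ F φ` is the smooth density of `F^(1)(φ)`. -/
theorem IsRegularFunctional.isGradient_gradient {μ : Measure M} [SigmaFinite μ]
    {F : Config (d := d) M → ℂ} (hF : IsRegularFunctional μ F) (φ : Config (d := d) M) :
    IsGradient μ F φ (gradient μ F φ) := by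
  have key : ∃ f, IsGradient μ F φ f := by
    obtain ⟨f, hf⟩ := hF.kernel 1 φ
    refine ⟨⟨fun x => f.1 fun _ => x, f.2.1.comp (contMDiff_piConst _), ?_⟩, fun h => ?_⟩
    · exact f.2.2.comp_homeomorph (Homeomorph.funUnique (Fin 1) M).symm
    · have e := (measurePreserving_funUnique μ (Fin 1)).integral_comp'
        (fun x => f.1 (fun _ => x) * (h x : ℂ))
      refine (hf _).trans (Eq.trans ?_ e)
      refine integral_congr_ae (ae_of_all _ fun x => ?_)
      have hx : (fun _ : Fin 1 => x 0) = x := funext fun i => by rw [Subsingleton.elim i 0]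
      change f.1 x * ∏ i : Fin 1, (h (x i) : ℂ) = f.1 (fun _ => x 0) * (h (x 0) : ℂ)
      rw [hx, Fin.prod_univ_one]
  rw [gradient, dif_pos key]
  exact key.choose_spec

/-- `{F, G}_W(φ) = W(F^(1)(φ) ⊗ G^(1)(φ))`. -/
def bracket [T2Space M] (μ : Measure M) (W : Bidistr (d := d) M) (F G : Config (d := d) M → ℂ) :
    Config (d := d) M → ℂ :=
  fun φ => W (tensor (gradient μ F φ) (gradient μ G φ))

end Functionals

end PAQFT

end

open PAQFT

/-! Suppose first that the wavefront set of W is non-empty at a point p = (p₁, p₂). For a product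
cutoff χ₁ ⊗ χ₂ the localized Fourier transform of W then fails to decay rapidly, although it is
polynomially bounded (`Distr.exists_modulate_bound`). Hence for some k there are frequencies (α_j,
β_j), with one fixed component growing as fast as desired, along which the transform stays above a
constant times the (-k)-th power of that component. Oscillating densities f_j, g_j with these
frequencies and suitable amplitudes satisfy |W(f_j ⊗ g_j)| ≥ 1, while their pairings with h are at
most ε_j for all h in one neighbourhood of zero; the weights ε_j may decrease arbitrarily fast. This
works because the pairing of a plane wave with a smooth function decays faster than any power of the
frequency.

The densities are assembled into F(φ) = ∑ ψ_j(ℓ(φ)) ∫ f_j φ dμ, where ℓ is the pairing with a bump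
function and the ψ_j are bumps around 2⁻ʲ with disjoint supports. The weights ε_j beat the growth of
all derivatives of ψ_j, so F is smooth. At each φ at most one bump is active, so all derivatives are
finite sums of tensor products of test functions: F is regular and all its wavefront sets are empty.
If ℓ(φ₀) = 1, the gradient of F is f_j at 2⁻ʲφ₀ and zero at 0. With G built in the same way from
g_j, the bracket has absolute value at least 1 along 2⁻ʲφ₀ → 0 but vanishes at 0
(`exists_discontinuous_of_sequences`).

Suppose conversely that the wavefront set is empty. Compactness of the sphere of directions,
together with the stability of decay under multiplication by cutoffs (`Distr.DecaysOn.mulChart`),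
yields partitions of unity by cutoffs for which the Fourier transform of W decays rapidly in every
direction. Expanding both densities into Fourier series gives W(f ⊗ g) = ∑ w_j (∫ f a_j)(∫ g b_j)
with rapidly decreasing w_j and polynomially growing a_j, b_j
(`exists_nuclear_expansion_of_WF_eq_empty`). So the bracket is a finite combination of series ∑ w_j
F^(1)(φ){a_j} G^(1)(φ){b_j}. By joint continuity and homogeneity of the derivatives of F and G, such
series may be differentiated term by term to all orders (`IsNuclearFamily.isBastianiSmooth`). No
smooth kernel of W has to be constructed. -/

set_option linter.unusedSectionVars false

namespace PAQFT

/-! ### The smooth topology and finite order of distributions, in charts -/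

section SmoothTopology

variable {E : Type*} [NormedAddCommGroup E] [NormedSpace ℝ E]
  {H : Type*} [TopologicalSpace H] {I : ModelWithCorners ℝ E H}
  {N : Type*} [TopologicalSpace N] [ChartedSpace H N]
  {V : Type*} [NormedAddCommGroup V] [NormedSpace ℝ V]

theorem tendsto_smoothTopology_iff {α : Type*} {l : Filter α} {f : α → N → V} {g : N → V} :
    Tendsto f l (@nhds _ (smoothTopology I N V) g) ↔
      ∀ (c : N) (n : ℕ) (K : Set E), IsCompact K → K ⊆ (extChartAt I c).target →
        TendstoUniformlyOn (fun a => iteratedFDeriv ℝ n (f a ∘ (extChartAt I c).symm))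
          (iteratedFDeriv ℝ n (g ∘ (extChartAt I c).symm)) l K := by
  simp only [nhds_iInf, tendsto_iInf, nhds_induced, tendsto_comap_iff,
    UniformOnFun.tendsto_iff_tendstoUniformlyOn]
  exact forall₂_congr fun c n => ⟨fun h K h1 h2 => h K ⟨h1, h2⟩, fun h K hK => h K hK.1 hK.2⟩

/-- Derivatives of a smooth function in a chart are bounded on compact sets. -/
theorem exists_bound_iteratedFDeriv_of_isCompact {X : Type*} [NormedAddCommGroup X]
    [NormedSpace ℝ X] {g : X → V} {s K : Set X} (hs : IsOpen s) (hg : ContDiffOn ℝ ∞ g s)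
    (hK : IsCompact K) (hKs : K ⊆ s) (n : ℕ) :
    ∃ C : ℝ, 1 ≤ C ∧ ∀ i ≤ n, ∀ y ∈ K, ‖iteratedFDeriv ℝ i g y‖ ≤ C := by
  have h1 : ∀ i : ℕ, ∃ C : ℝ, ∀ y ∈ K, ‖iteratedFDeriv ℝ i g y‖ ≤ C := by
    intro i
    refine hK.exists_bound_of_continuousOn ?_
    refine ContinuousOn.congr (f := iteratedFDerivWithin ℝ i g s) ?_ ?_
    · exact (hg.continuousOn_iteratedFDerivWithin (by exact_mod_cast le_top)
        hs.uniqueDiffOn).mono hKs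
    · exact fun y hy => (iteratedFDerivWithin_of_isOpen i hs (hKs hy)).symm
  choose C hC using h1
  -- The leading 1 keeps the common bound at least one, so that it is dominated by its own positive
  -- powers in composition estimates.
  refine ⟨1 + ∑ i ∈ Finset.range (n + 1), |C i|,
    le_add_of_nonneg_right (Finset.sum_nonneg fun i _ => abs_nonneg _), fun i hi y hy => ?_⟩
  have h2 : |C i| ≤ ∑ i ∈ Finset.range (n + 1), |C i| :=
    Finset.single_le_sum (f := fun i => |C i|) (fun i _ => abs_nonneg _)
      (Finset.mem_range.2 (Nat.lt_succ_of_le hi))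
  linarith [hC i y hy, le_abs_self (C i)]

variable [I.Boundaryless] [IsManifold I ∞ N]

omit [I.Boundaryless] in
theorem contDiffOn_comp_extChartAt_symm {f : N → V} (hf : ContMDiff I 𝓘(ℝ, V) ∞ f) (c : N) :
    ContDiffOn ℝ ∞ (f ∘ (extChartAt I c).symm) (extChartAt I c).target := by
  rw [← contMDiffOn_iff_contDiffOn]
  exact hf.comp_contMDiffOn (contMDiffOn_extChartAt_symm c)

theorem contDiffAt_comp_extChartAt_symm {f : N → V} (hf : ContMDiff I 𝓘(ℝ, V) ∞ f) (c : N) {y : E}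
    (hy : y ∈ (extChartAt I c).target) :
    ContDiffAt ℝ ∞ (f ∘ (extChartAt I c).symm) y :=
  (contDiffOn_comp_extChartAt_symm hf c).contDiffAt ((isOpen_extChartAt_target c).mem_nhds hy)

/-- A sequence of smooth functions supported in a fixed compact subset of a chart domain tends to
zero if all its derivatives in that chart do. -/
theorem tendsto_zero_of_chart [T2Space N] {p : N} {K : Set N} (hK : IsCompact K)
    (hKs : K ⊆ (chartAt H p).source) {α : Type*} {l : Filter α} {f : α → N → V}
    (hf : ∀ a, ContMDiff I 𝓘(ℝ, V) ∞ (f a)) (hfK : ∀ a, ∀ x ∉ K, f a x = 0)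
    (h : ∀ n : ℕ, ∀ ε > 0, ∀ᶠ a in l, ∀ y ∈ extChartAt I p '' K,
      ‖iteratedFDeriv ℝ n (f a ∘ (extChartAt I p).symm) y‖ ≤ ε) :
    Tendsto f l (@nhds _ (smoothTopology I N V) 0) := by
  rw [tendsto_smoothTopology_iff]
  intro c n K' hK' hK's
  set κ := extChartAt I p
  set κ' := extChartAt I c
  have ho : IsOpen κ'.target := isOpen_extChartAt_target c
  have hop : IsOpen κ.target := isOpen_extChartAt_target p
  have hcont : ContinuousOn κ'.symm κ'.target := continuousOn_extChartAt_symm c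
  let s : Set E := κ'.target ∩ κ'.symm ⁻¹' κ.source
  have hsopen : IsOpen s := hcont.isOpen_inter_preimage ho (isOpen_extChartAt_source p)
  -- Only the points of K' lying over K matter, since elsewhere `f a` vanishes locally. On this
  -- compact set the transition map has bounded derivatives, which transfers bounds from the chart
  -- at p to the chart at c.
  let L : Set E := K' ∩ κ'.symm ⁻¹' K
  have hL : IsCompact L := by
    refine hK'.of_isClosed_subset ?_ inter_subset_left
    exact (hcont.mono hK's).preimage_isClosed_of_isClosed hK'.isClosed hK.isClosed
  have hKs' : K ⊆ κ.source := by rwa [extChartAt_source]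
  have hLs : L ⊆ s := fun y hy => ⟨hK's hy.1, hKs' hy.2⟩
  have hτ : ContDiffOn ℝ ∞ (κ ∘ κ'.symm) s := by
    have := contDiffOn_ext_coord_change (I := I) (n := ∞) p c
    rwa [PartialEquiv.trans_source] at this
  obtain ⟨D, hD1, hD⟩ := exists_bound_iteratedFDeriv_of_isCompact hsopen hτ hL hLs n
  rw [Metric.tendstoUniformlyOn_iff]
  intro ε hε
  -- The n-th derivative of a composition is bounded by n! · C · Dⁿ; this value of C turns the bound
  -- into ε / 2.
  have hδ : 0 < ε / 2 / (n.factorial * D ^ n) := by positivity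
  have hev : ∀ᶠ a in l, ∀ i ∈ Finset.range (n + 1), ∀ y ∈ κ '' K,
      ‖iteratedFDeriv ℝ i (f a ∘ κ.symm) y‖ ≤ ε / 2 / (n.factorial * D ^ n) :=
    (Finset.eventually_all _).2 fun i _ => h i _ hδ
  filter_upwards [hev] with a ha y hy
  have h0 : iteratedFDeriv ℝ n ((0 : N → V) ∘ κ'.symm) y = 0 := by
    change iteratedFDeriv ℝ n (fun _ => (0 : V)) y = 0
    rw [iteratedFDeriv_fun_zero]; rfl
  rw [h0, dist_zero_left]
  by_cases hyK : κ'.symm y ∈ K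
  · have hys : y ∈ s := hLs ⟨hy, hyK⟩
    have heq : f a ∘ κ'.symm =ᶠ[𝓝 y] (f a ∘ κ.symm) ∘ (κ ∘ κ'.symm) := by
      filter_upwards [hsopen.mem_nhds hys] with z hz
      simp only [Function.comp_apply]
      rw [κ.left_inv hz.2]
    rw [(heq.iteratedFDeriv ℝ n).eq_of_nhds, ← iteratedFDerivWithin_of_isOpen n hsopen hys]
    refine lt_of_le_of_lt (norm_iteratedFDerivWithin_comp_le (t := κ.target) (N := ∞)
      (contDiffOn_comp_extChartAt_symm (hf a) p) hτ (by exact_mod_cast le_top) hop.uniqueDiffOn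
      hsopen.uniqueDiffOn (fun z hz => κ.map_source hz.2) hys
      (C := ε / 2 / (n.factorial * D ^ n)) (D := D) ?_ ?_) ?_
    · intro i hi
      have e := iteratedFDerivWithin_of_isOpen (𝕜 := ℝ) (f := f a ∘ κ.symm) i hop
        (κ.map_source hys.2)
      refine (congrArg norm e).le.trans ?_
      exact ha i (Finset.mem_range.2 (Nat.lt_succ_of_le hi)) _ (mem_image_of_mem _ hyK)
    · intro i hi hin
      rw [iteratedFDerivWithin_of_isOpen i hsopen hys]
      exact (hD i hin y ⟨hy, hyK⟩).trans (le_self_pow₀ hD1 (by omega))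
    · have : (n.factorial : ℝ) * (ε / 2 / (n.factorial * D ^ n)) * D ^ n = ε / 2 := by
        have : (n.factorial : ℝ) * D ^ n ≠ 0 := by positivity
        field_simp
      linarith
  · have hopen : IsOpen (κ'.target ∩ κ'.symm ⁻¹' Kᶜ) :=
      hcont.isOpen_inter_preimage ho hK.isClosed.isOpen_compl
    have heq : f a ∘ κ'.symm =ᶠ[𝓝 y] fun _ => 0 := by
      filter_upwards [hopen.mem_nhds ⟨hK's hy, hyK⟩] with z hz
      exact hfK a _ hz.2
    rw [(heq.iteratedFDeriv ℝ n).eq_of_nhds, iteratedFDeriv_fun_zero]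
    simpa using hε

/-- Smooth functions supported in a compact subset of a chart domain lie in a given neighbourhood
of zero if finitely many of their derivatives in that chart are small. -/
theorem exists_chart_bound_of_mem_nhds_zero [T2Space N] {p : N} {K : Set N} (hK : IsCompact K)
    (hKs : K ⊆ (chartAt H p).source) {U : Set (N → V)}
    (hU : U ∈ @nhds _ (smoothTopology I N V) 0) :
    ∃ m : ℕ, ∃ ε > 0, ∀ f : N → V, ContMDiff I 𝓘(ℝ, V) ∞ f → (∀ x ∉ K, f x = 0) →
      (∀ j ≤ m, ∀ y ∈ extChartAt I p '' K,
        ‖iteratedFDeriv ℝ j (f ∘ (extChartAt I p).symm) y‖ ≤ ε) → f ∈ U := by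
  -- If no order and no ε sufficed, counterexamples for order m and size 1 / (m + 1) would form a
  -- sequence that tends to zero without ever entering U.
  by_contra! hcon
  choose f hf1 hf2 hf3 hf4 using fun m : ℕ =>
    hcon m ((m : ℝ) + 1)⁻¹ (by positivity)
  have h := tendsto_zero_of_chart (I := I) hK hKs (l := atTop) hf1 hf2 (fun n ε hε => by
    have h1 : ∀ᶠ m : ℕ in atTop, ((m : ℝ) + 1)⁻¹ ≤ ε := by
      have := tendsto_one_div_add_atTop_nhds_zero_nat (𝕜 := ℝ)
      filter_upwards [this.eventually (gt_mem_nhds hε)] with m hm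
      rw [← one_div]; exact hm.le
    filter_upwards [h1, eventually_ge_atTop n] with m hm hn y hy
    exact (hf3 m n hn y hy).trans hm)
  obtain ⟨m, hm⟩ := (h.eventually hU).exists
  exact hf4 m hm

/-- A distribution has finite order on compact subsets of a chart domain. -/
theorem Distr.exists_order_bound [T2Space N] (u : Distr I N) {p : N} {K : Set N}
    (hK : IsCompact K) (hKs : K ⊆ (chartAt H p).source) :
    ∃ m : ℕ, ∃ C > 0, ∀ f : TestFun I N, (∀ x ∉ K, f.1 x = 0) → ∀ B : ℝ, 0 ≤ B →
      (∀ j ≤ m, ∀ y ∈ extChartAt I p '' K,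
        ‖iteratedFDeriv ℝ j (f.1 ∘ (extChartAt I p).symm) y‖ ≤ B) → ‖u f‖ ≤ C * B := by
  let τ : TopologicalSpace (TestFun I N) :=
    TopologicalSpace.induced (fun f => (f : N → ℂ)) (smoothTopology I N ℂ)
  have hc := u.continuousOn' K hK 0 (by simp [tsupport])
  have hev : ∀ᶠ f in @nhdsWithin _ τ 0 {f : TestFun I N | tsupport (f : N → ℂ) ⊆ K}, ‖u f‖ < 1 := by
    have : ∀ᶠ z in 𝓝 (u.toLinearMap 0), ‖z‖ < 1 := by
      rw [map_zero]
      exact (continuous_norm.tendsto' (0 : ℂ) 0 norm_zero).eventually (gt_mem_nhds one_pos)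
    exact hc.eventually this
  rw [eventually_nhdsWithin_iff, @nhds_induced _ _ (smoothTopology I N ℂ)] at hev
  obtain ⟨U, hU, hUs⟩ := hev
  obtain ⟨m, ε, hε, hm⟩ := exists_chart_bound_of_mem_nhds_zero (I := I) hK hKs hU
  have key : ∀ f : TestFun I N, (∀ x ∉ K, f.1 x = 0) → ∀ B : ℝ, 0 < B →
      (∀ j ≤ m, ∀ y ∈ extChartAt I p '' K,
        ‖iteratedFDeriv ℝ j (f.1 ∘ (extChartAt I p).symm) y‖ ≤ B) → ‖u f‖ ≤ ε⁻¹ * B := by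
    intro f hf B hB hfB
    -- Scaling by ε / B moves f into U, where u is less than one in absolute value; linearity undoes
    -- the scaling.
    let a : ℝ := ε / B
    have ha : 0 < a := div_pos hε hB
    have h1 : (((a : ℂ) • f : TestFun I N) : N → ℂ) ∈ U := by
      refine hm _ ((a : ℂ) • f).2.1 (fun x hx => ?_) fun j hj y hy => ?_
      · change (a : ℂ) • f.1 x = 0
        rw [hf x hx, smul_zero]
      · have hyt : y ∈ (extChartAt I p).target := by
          obtain ⟨x, hx, rfl⟩ := hy
          exact (extChartAt I p).map_source (by rw [extChartAt_source]; exact hKs hx)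
        have : ((((a : ℂ) • f : TestFun I N) : N → ℂ) ∘ (extChartAt I p).symm) =
            a • (f.1 ∘ (extChartAt I p).symm) := by
          ext z
          simp
        rw [this, iteratedFDeriv_const_smul_apply
          ((contDiffAt_comp_extChartAt_symm f.2.1 p hyt).of_le (by exact_mod_cast le_top)),
          norm_smul, Real.norm_of_nonneg ha.le]
        calc a * _ ≤ a * B := by gcongr; exact hfB j hj y hy
          _ = ε := div_mul_cancel₀ _ hB.ne'
    have h2 : ‖u ((a : ℂ) • f)‖ < 1 := by
      refine hUs h1 ?_
      refine closure_minimal (fun x hx => ?_) hK.isClosed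
      by_contra hxK
      refine hx ?_
      change (a : ℂ) • f.1 x = 0
      rw [hf x hxK, smul_zero]
    rw [map_smul, norm_smul, Complex.norm_real, Real.norm_of_nonneg ha.le] at h2
    have : a * ‖u f‖ * (B / ε) = ‖u f‖ := by
      simp only [a]; field_simp
    rw [← this, inv_mul_eq_div]
    calc _ ≤ 1 * (B / ε) := by gcongr
      _ = _ := one_mul _
  refine ⟨m, ε⁻¹, by positivity, fun f hf B hB0 hB => ?_⟩
  -- The scaling argument needs a positive bound, so B = 0 is reached by enlarging B to B + ε δ with
  -- arbitrary δ > 0.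
  refine le_of_forall_pos_le_add fun δ hδ => ?_
  refine (key f hf (B + ε * δ) (by positivity) fun j hj y hy => (hB j hj y hy).trans ?_).trans ?_
  · linarith [mul_pos hε hδ]
  · rw [mul_add, inv_mul_cancel_left₀ hε.ne']

end SmoothTopology

/-! ### Configurations as a topological vector space -/

section ConfigTopology

variable {E : Type*} [NormedAddCommGroup E] [NormedSpace ℝ E]
  {H : Type*} [TopologicalSpace H] {I : ModelWithCorners ℝ E H}
  {N : Type*} [TopologicalSpace N] [ChartedSpace H N]
  {V : Type*} [NormedAddCommGroup V] [NormedSpace ℝ V]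

/-- Convergence in the smooth topology implies uniform convergence on compact sets. -/
theorem tendstoUniformlyOn_of_tendsto_smoothTopology [I.Boundaryless] [LocallyCompactSpace N]
    {α : Type*} {l : Filter α} {f : α → N → V} {g : N → V}
    (h : Tendsto f l (@nhds _ (smoothTopology I N V) g)) {K : Set N} (hK : IsCompact K) :
    TendstoUniformlyOn f g l K := by
  rw [← tendstoLocallyUniformlyOn_iff_tendstoUniformlyOn_of_compact hK,
    Metric.tendstoLocallyUniformlyOn_iff]
  intro ε hε x _
  obtain ⟨L, hL, hxL, hLs⟩ := exists_compact_subset (isOpen_extChartAt_source (I := I) x)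
    (mem_extChartAt_source (I := I) x)
  refine ⟨L, mem_nhdsWithin_of_mem_nhds (mem_interior_iff_mem_nhds.1 hxL), ?_⟩
  -- Derivatives of order zero on a compact neighbourhood inside the chart domain already control
  -- the values.
  have h1 := tendsto_smoothTopology_iff.1 h x 0 (extChartAt I x '' L)
    (hL.image_of_continuousOn ((continuousOn_extChartAt x).mono hLs))
    (by rintro _ ⟨z, hz, rfl⟩; exact (extChartAt I x).map_source (hLs hz))
  filter_upwards [Metric.tendstoUniformlyOn_iff.1 h1 ε hε] with a ha y hy
  have h2 := ha _ (mem_image_of_mem _ hy)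
  rw [dist_eq_norm, iteratedFDeriv_zero_eq_comp, iteratedFDeriv_zero_eq_comp] at h2
  simp only [Function.comp_apply, ← map_sub, LinearIsometryEquiv.norm_map] at h2
  rwa [(extChartAt I x).left_inv (hLs hy), ← dist_eq_norm] at h2

variable [IsManifold I ∞ N]

theorem tendsto_config_iff {α : Type*} {l : Filter α} {f : α → C^∞⟮I, N; 𝓘(ℝ, ℝ), ℝ⟯}
    {g : C^∞⟮I, N; 𝓘(ℝ, ℝ), ℝ⟯} :
    Tendsto f l (𝓝 g) ↔
      ∀ (c : N) (n : ℕ) (K : Set E), IsCompact K → K ⊆ (extChartAt I c).target →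
        TendstoUniformlyOn (fun a => iteratedFDeriv ℝ n (f a ∘ (extChartAt I c).symm))
          (iteratedFDeriv ℝ n (g ∘ (extChartAt I c).symm)) l K := by
  rw [@nhds_induced _ _ (smoothTopology I N ℝ), tendsto_comap_iff]
  exact tendsto_smoothTopology_iff

variable [I.Boundaryless]

theorem iteratedFDeriv_config_add (f g : C^∞⟮I, N; 𝓘(ℝ, ℝ), ℝ⟯) (c : N) (n : ℕ) {y : E}
    (hy : y ∈ (extChartAt I c).target) :
    iteratedFDeriv ℝ n ((f + g : C^∞⟮I, N; 𝓘(ℝ, ℝ), ℝ⟯) ∘ (extChartAt I c).symm) y =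
      iteratedFDeriv ℝ n (f ∘ (extChartAt I c).symm) y +
        iteratedFDeriv ℝ n (g ∘ (extChartAt I c).symm) y :=
  iteratedFDeriv_add_apply
    ((contDiffAt_comp_extChartAt_symm f.contMDiff c hy).of_le (by exact_mod_cast le_top))
    ((contDiffAt_comp_extChartAt_symm g.contMDiff c hy).of_le (by exact_mod_cast le_top))

theorem iteratedFDeriv_config_smul (t : ℝ) (f : C^∞⟮I, N; 𝓘(ℝ, ℝ), ℝ⟯) (c : N) (n : ℕ) {y : E}
    (hy : y ∈ (extChartAt I c).target) :
    iteratedFDeriv ℝ n ((t • f : C^∞⟮I, N; 𝓘(ℝ, ℝ), ℝ⟯) ∘ (extChartAt I c).symm) y =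
      t • iteratedFDeriv ℝ n (f ∘ (extChartAt I c).symm) y :=
  iteratedFDeriv_const_smul_apply
    ((contDiffAt_comp_extChartAt_symm f.contMDiff c hy).of_le (by exact_mod_cast le_top))

instance : ContinuousAdd C^∞⟮I, N; 𝓘(ℝ, ℝ), ℝ⟯ := by
  refine ⟨continuous_iff_continuousAt.2 fun p => tendsto_config_iff.2 fun c n K hK hKs => ?_⟩
  have h1 := tendsto_config_iff.1 (continuousAt_fst (p := p)) c n K hK hKs
  have h2 := tendsto_config_iff.1 (continuousAt_snd (p := p)) c n K hK hKs
  refine ((h1.add h2).congr (Eventually.of_forall fun q y hy => ?_)).congr_right fun y hy => ?_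
  · exact (iteratedFDeriv_config_add q.1 q.2 c n (hKs hy)).symm
  · exact (iteratedFDeriv_config_add p.1 p.2 c n (hKs hy)).symm

/-- With A and B the derivatives of the varying and of the fixed function, sA - tB = s(A - B) + (s -
t)B. The first term is small because s stays bounded, the second because B is bounded on the compact
set. -/
instance : ContinuousSMul ℝ C^∞⟮I, N; 𝓘(ℝ, ℝ), ℝ⟯ := by
  refine ⟨continuous_iff_continuousAt.2 fun p => tendsto_config_iff.2 fun c n K hK hKs => ?_⟩
  have h2 := tendsto_config_iff.1 (continuousAt_snd (p := p)) c n K hK hKs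
  obtain ⟨C, hC1, hC⟩ := exists_bound_iteratedFDeriv_of_isCompact (isOpen_extChartAt_target c)
    (contDiffOn_comp_extChartAt_symm p.2.contMDiff c) hK hKs n
  rw [Metric.tendstoUniformlyOn_iff] at h2 ⊢
  intro ε hε
  have hpos : 0 < |p.1| + 1 := by positivity
  have e1 : ∀ᶠ q : ℝ × C^∞⟮I, N; 𝓘(ℝ, ℝ), ℝ⟯ in 𝓝 p, |q.1 - p.1| < min 1 (ε / 2 / C) := by
    have : Continuous fun q : ℝ × C^∞⟮I, N; 𝓘(ℝ, ℝ), ℝ⟯ => |q.1 - p.1| := by fun_prop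
    have h0 : (0 : ℝ) < min 1 (ε / 2 / C) := by positivity
    exact (this.tendsto' p 0 (by simp)).eventually (gt_mem_nhds h0)
  filter_upwards [h2 (ε / 2 / (|p.1| + 1)) (by positivity), e1] with q hq2 hq1 y hy
  have h3 := hq2 y hy
  rw [dist_comm, dist_eq_norm] at h3 ⊢
  rw [iteratedFDeriv_config_smul q.1 q.2 c n (hKs hy),
    iteratedFDeriv_config_smul p.1 p.2 c n (hKs hy)]
  set A := iteratedFDeriv ℝ n (q.2 ∘ (extChartAt I c).symm) y
  set B := iteratedFDeriv ℝ n (p.2 ∘ (extChartAt I c).symm) y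
  have h4 : |q.1| ≤ |p.1| + 1 := by
    have := hq1.le.trans (min_le_left _ _)
    have h5 := abs_sub_abs_le_abs_sub q.1 p.1
    linarith
  have h6 : |q.1 - p.1| * C < ε / 2 := by
    rw [← lt_div_iff₀ (by positivity)]
    exact hq1.trans_le (min_le_right _ _)
  calc ‖q.1 • A - p.1 • B‖ = ‖q.1 • (A - B) + (q.1 - p.1) • B‖ := by
        congr 1; rw [smul_sub, sub_smul]; abel
    _ ≤ |q.1| * ‖A - B‖ + |q.1 - p.1| * ‖B‖ := by
        refine (norm_add_le _ _).trans ?_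
        rw [norm_smul, norm_smul, Real.norm_eq_abs, Real.norm_eq_abs]
    _ ≤ (|p.1| + 1) * ‖A - B‖ + |q.1 - p.1| * C := by
        gcongr
        exact hC n le_rfl y hy
    _ < (|p.1| + 1) * (ε / 2 / (|p.1| + 1)) + ε / 2 :=
        add_lt_add (mul_lt_mul_of_pos_left h3 hpos) h6
    _ = ε := by field_simp; ring

instance : IsTopologicalAddGroup C^∞⟮I, N; 𝓘(ℝ, ℝ), ℝ⟯ where
  continuous_neg := by
    have : Continuous fun f : C^∞⟮I, N; 𝓘(ℝ, ℝ), ℝ⟯ => (-1 : ℝ) • f := by fun_prop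
    simpa using this

/-- These seminorm neighbourhoods of zero are the ones on which pairings with plane waves decay
uniformly. -/
theorem eventually_config_chart_bound {c : N} {K : Set N} (hK : IsCompact K)
    (hKs : K ⊆ (chartAt H c).source) (n : ℕ) :
    ∀ᶠ h : C^∞⟮I, N; 𝓘(ℝ, ℝ), ℝ⟯ in 𝓝 0, ∀ j ≤ n, ∀ y ∈ extChartAt I c '' K,
      ‖iteratedFDeriv ℝ j (h ∘ (extChartAt I c).symm) y‖ ≤ 1 := by
  have hKs' : K ⊆ (extChartAt I c).source := by rwa [extChartAt_source]
  have h1 : ∀ᶠ h : C^∞⟮I, N; 𝓘(ℝ, ℝ), ℝ⟯ in 𝓝 0, ∀ j ∈ Finset.range (n + 1),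
      ∀ y ∈ extChartAt I c '' K, ‖iteratedFDeriv ℝ j (h ∘ (extChartAt I c).symm) y‖ ≤ 1 := by
    refine (Finset.eventually_all _).2 fun j _ => ?_
    have h2 := tendsto_config_iff.1 (tendsto_id (x := 𝓝 (0 : C^∞⟮I, N; 𝓘(ℝ, ℝ), ℝ⟯))) c j
      (extChartAt I c '' K)
      (hK.image_of_continuousOn ((continuousOn_extChartAt c).mono hKs'))
      (by rintro _ ⟨z, hz, rfl⟩; exact (extChartAt I c).map_source (hKs' hz))
    filter_upwards [Metric.tendstoUniformlyOn_iff.1 h2 1 one_pos] with h hh y hy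
    have h3 := hh y hy
    have h0 : iteratedFDeriv ℝ j ((0 : C^∞⟮I, N; 𝓘(ℝ, ℝ), ℝ⟯) ∘ (extChartAt I c).symm) y = 0 := by
      change iteratedFDeriv ℝ j (fun _ => (0 : ℝ)) y = 0
      rw [iteratedFDeriv_fun_zero]; rfl
    rw [h0, dist_zero_left] at h3
    exact h3.le
  filter_upwards [h1] with h hh j hj
  exact hh j (Finset.mem_range.2 (Nat.lt_succ_of_le hj))

theorem eventually_config_bound [LocallyCompactSpace N] {K : Set N} (hK : IsCompact K) :
    ∀ᶠ h : C^∞⟮I, N; 𝓘(ℝ, ℝ), ℝ⟯ in 𝓝 0, ∀ x ∈ K, |h x| ≤ 1 := by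
  have h1 : Tendsto (fun h : C^∞⟮I, N; 𝓘(ℝ, ℝ), ℝ⟯ => (h : N → ℝ)) (𝓝 0)
      (@nhds _ (smoothTopology I N ℝ) (0 : C^∞⟮I, N; 𝓘(ℝ, ℝ), ℝ⟯)) := by
    rw [@nhds_induced _ _ (smoothTopology I N ℝ)]
    exact tendsto_comap
  filter_upwards [Metric.tendstoUniformlyOn_iff.1
    (tendstoUniformlyOn_of_tendsto_smoothTopology h1 hK) 1 one_pos] with h hh x hx
  have := hh x hx
  rw [dist_comm, Real.dist_eq] at this
  simpa using this.le

end ConfigTopology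

/-! ### Functions cut off inside a chart -/

section ChartFunctions

/-- A function that is smooth on an open set and vanishes there off a compact set extends by zero
to a smooth function. -/
theorem contDiff_indicator_of_isCompact {X V : Type*} [NormedAddCommGroup X] [NormedSpace ℝ X]
    [NormedAddCommGroup V] [NormedSpace ℝ V] {s K : Set X} {g : X → V} (hs : IsOpen s)
    (hg : ContDiffOn ℝ ∞ g s) (hK : IsCompact K) (hKs : K ⊆ s) (h0 : ∀ y ∈ s, y ∉ K → g y = 0) :
    ContDiff ℝ ∞ (s.indicator g) := by
  rw [contDiff_iff_contDiffAt]
  intro y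
  by_cases hy : y ∈ K
  · refine (hg.contDiffAt (hs.mem_nhds (hKs hy))).congr_of_eventuallyEq ?_
    filter_upwards [hs.mem_nhds (hKs hy)] with z hz using indicator_of_mem hz g
  · refine (contDiffAt_const (c := (0 : V))).congr_of_eventuallyEq ?_
    filter_upwards [hK.isClosed.isOpen_compl.mem_nhds hy] with z hz
    by_cases hzs : z ∈ s
    · rw [indicator_of_mem hzs, h0 z hzs hz]
    · exact indicator_of_notMem hzs g

variable {E : Type*} [NormedAddCommGroup E] [NormedSpace ℝ E]
  {H : Type*} [TopologicalSpace H] {I : ModelWithCorners ℝ E H}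
  {N : Type*} [TopologicalSpace N] [ChartedSpace H N] [IsManifold I ∞ N]

/-- The product of a test function supported in a chart domain with a smooth function of the
coordinates. -/
noncomputable def mulChart (p : N) (χ : TestFun I N) (hχ : tsupport (χ : N → ℂ) ⊆ (chartAt H p).source)
    {a : E → ℂ} (ha : ContDiff ℝ ∞ a) : TestFun I N :=
  ⟨fun y => χ.1 y * a (extChartAt I p y), by
    refine ⟨?_, χ.2.2.mul_right⟩
    refine contMDiff_of_tsupport (fun y hy => ?_)
    have hy' : y ∈ (chartAt H p).source :=
      hχ (closure_mono (Function.support_mul_subset_left _ _) hy)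
    exact (contDiff_mul (𝕜 := ℝ) (𝔸 := ℂ)).contMDiff.contMDiffAt.comp y
      (χ.2.1.contMDiffAt.prodMk_space (ha.contMDiff.contMDiffAt.comp y
        (contMDiffAt_extChartAt' hy')))⟩

theorem mulChart_apply (p : N) (χ : TestFun I N)
    (hχ : tsupport (χ : N → ℂ) ⊆ (chartAt H p).source) {a : E → ℂ} (ha : ContDiff ℝ ∞ a) (y : N) :
    (mulChart p χ hχ ha).1 y = χ.1 y * a (extChartAt I p y) := rfl

end ChartFunctions

/-! ### Rapid decay of Fourier integrals -/

section FourierDecay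

/-- Integrating by parts along v gains powers of ⟨η, v⟩ only; an almost norming v turns them into
powers of ‖η‖. -/
theorem exists_norm_le_two_mul_abs_apply {X : Type*} [NormedAddCommGroup X] [NormedSpace ℝ X]
    (η : X →L[ℝ] ℝ) : ∃ v : X, ‖v‖ ≤ 1 ∧ ‖η‖ ≤ 2 * |η v| := by
  rcases eq_or_ne η 0 with rfl | h
  · exact ⟨0, by simp, by simp⟩
  · have hpos : 0 < ‖η‖ := norm_pos_iff.2 h
    obtain ⟨v, hv, hv'⟩ := η.exists_lt_apply_of_lt_opNorm (half_lt_self hpos)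
    refine ⟨v, hv.le, ?_⟩
    rw [Real.norm_eq_abs] at hv'
    linarith

theorem iteratedFDeriv_eq_zero_of_notMem {X V : Type*} [NormedAddCommGroup X] [NormedSpace ℝ X]
    [NormedAddCommGroup V] [NormedSpace ℝ V] {K : Set X} (hK : IsClosed K) {g : X → V}
    (hg : ∀ y ∉ K, g y = 0) (j : ℕ) {y : X} (hy : y ∉ K) : iteratedFDeriv ℝ j g y = 0 := by
  have heq : g =ᶠ[𝓝 y] fun _ => 0 := by
    filter_upwards [hK.isOpen_compl.mem_nhds hy] with z hz using hg z hz
  rw [(heq.iteratedFDeriv ℝ j).eq_of_nhds, iteratedFDeriv_fun_zero]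
  rfl

theorem one_add_pow_le {t : ℝ} (ht : 0 ≤ t) (n : ℕ) : (1 + t) ^ n ≤ 2 ^ n * (1 + t ^ n) := by
  have h1 : (1 + t) ≤ 2 * max 1 t := by
    have := le_max_left 1 t
    have := le_max_right 1 t
    linarith
  calc (1 + t) ^ n ≤ (2 * max 1 t) ^ n := by gcongr
    _ = 2 ^ n * (max 1 t) ^ n := mul_pow _ _ _
    _ ≤ _ := by
      gcongr
      rcases le_total 1 t with h | h
      · rw [max_eq_right h]; linarith
      · rw [max_eq_left h, one_pow]; linarith [pow_nonneg ht n]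

/-- Rapid decay of the Fourier transform of smooth functions supported in a fixed compact set,
uniformly in terms of bounds on the derivatives. -/
theorem exists_fourier_decay_bound {X : Type*} [NormedAddCommGroup X] [NormedSpace ℝ X]
    [FiniteDimensional ℝ X] [MeasurableSpace X] [BorelSpace X] (ν : Measure X)
    [ν.IsAddHaarMeasure] {K : Set X} (hK : IsCompact K) (n : ℕ) :
    ∃ C : ℝ, 0 ≤ C ∧ ∀ g : X → ℂ, ContDiff ℝ ∞ g → (∀ y ∉ K, g y = 0) → ∀ B : ℝ, 0 ≤ B →
      (∀ j ≤ n, ∀ y ∈ K, ‖iteratedFDeriv ℝ j g y‖ ≤ B) → ∀ η : X →L[ℝ] ℝ,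
        (1 + ‖η‖) ^ n * ‖∫ y, g y * Complex.exp (-(Complex.I * (η y : ℂ))) ∂ν‖ ≤ C * B := by
  let L : X →L[ℝ] (X →L[ℝ] ℝ) →L[ℝ] ℝ := (ContinuousLinearMap.id ℝ (X →L[ℝ] ℝ)).flip
  let κ : ℝ := ν.real K
  have hκ : 0 ≤ κ := measureReal_nonneg
  refine ⟨2 ^ n * (κ + (4 * Real.pi) ^ n * (2 ^ n * ((n + 1) * κ))), by positivity, ?_⟩
  intro g hg hg0 B hB hgB η
  have hcs : HasCompactSupport g := HasCompactSupport.intro hK hg0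
  have hD0 : ∀ j, ∀ y ∉ K, iteratedFDeriv ℝ j g y = 0 := fun j y hy =>
    iteratedFDeriv_eq_zero_of_notMem hK.isClosed hg0 j hy
  have hDint : ∀ j ≤ n, ∫ y, ‖iteratedFDeriv ℝ j g y‖ ∂ν ≤ κ * B := by
    intro j hj
    rw [← setIntegral_eq_integral_of_forall_compl_eq_zero (s := K)
      (fun y hy => by rw [hD0 j y hy, norm_zero])]
    refine (le_abs_self _).trans ?_
    rw [← Real.norm_eq_abs, mul_comm]
    refine norm_setIntegral_le_of_norm_le_const hK.measure_lt_top fun y hy => ?_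
    rw [norm_norm]; exact hgB j hj y hy
  have hint : ∀ k m : ℕ, (k : ℕ∞) ≤ (0 : ℕ∞) → (m : ℕ∞) ≤ (⊤ : ℕ∞) →
      Integrable (fun v ↦ ‖v‖ ^ k * ‖iteratedFDeriv ℝ m g v‖) ν := by
    intro k m _ _
    refine Continuous.integrable_of_hasCompactSupport ?_ ?_
    · have := hg.continuous_iteratedFDeriv (m := m) (by exact_mod_cast le_top)
      fun_prop
    · refine HasCompactSupport.intro hK fun y hy => ?_
      rw [hD0 m y hy, norm_zero, mul_zero]
  obtain ⟨v, hv1, hv2⟩ := exists_norm_le_two_mul_abs_apply η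
  -- With k = 0 this is n-fold integration by parts along v. The character is exp(2πi ·), hence the
  -- frequency η / 2π.
  have hF := VectorFourier.pow_mul_norm_iteratedFDeriv_fourierIntegral_le (μ := ν) L
    (K := 0) (N := ⊤) (f := g) hg hint (k := 0) (n := n) le_rfl le_top v
    ((2 * Real.pi)⁻¹ • η)
  have hI : VectorFourier.fourierIntegral Real.fourierChar ν L.toLinearMap₁₂ g
      ((2 * Real.pi)⁻¹ • η) = ∫ y, g y * Complex.exp (-(Complex.I * (η y : ℂ))) ∂ν := by
    refine integral_congr_ae (ae_of_all _ fun y => ?_)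
    have : L.toLinearMap₁₂ y ((2 * Real.pi)⁻¹ • η) = (2 * Real.pi)⁻¹ * η y := rfl
    simp only [this]
    rw [Circle.smul_def, Real.fourierChar_apply, smul_eq_mul, mul_comm]
    congr 2
    push_cast
    have : (Real.pi : ℂ) ≠ 0 := by exact_mod_cast Real.pi_ne_zero
    field_simp
  rw [norm_iteratedFDeriv_zero, hI] at hF
  set J := ‖∫ y, g y * Complex.exp (-(Complex.I * (η y : ℂ))) ∂ν‖ with hJ
  have hLv : L v ((2 * Real.pi)⁻¹ • η) = (2 * Real.pi)⁻¹ * η v := rfl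
  rw [hLv] at hF
  simp only [pow_zero, Nat.cast_zero, mul_zero, mul_one, zero_add] at hF
  have hsum : ∑ p ∈ Finset.range 1 ×ˢ Finset.range (n + 1),
      ∫ w, ‖w‖ ^ p.1 * ‖iteratedFDeriv ℝ p.2 g w‖ ∂ν ≤ (n + 1) * κ * B := by
    calc _ ≤ ∑ p ∈ Finset.range 1 ×ˢ Finset.range (n + 1), κ * B := by
          refine Finset.sum_le_sum fun p hp => ?_
          rw [Finset.mem_product, Finset.mem_range, Finset.mem_range] at hp
          have hp1 : p.1 = 0 := by omega
          simp only [hp1, pow_zero, one_mul]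
          exact hDint p.2 (by omega)
      _ = (n + 1) * κ * B := by
          rw [Finset.sum_const, Finset.card_product, Finset.card_range, Finset.card_range,
            nsmul_eq_mul]
          push_cast
          ring
  have h1 : ‖η‖ ^ n * J ≤ (4 * Real.pi) ^ n * (2 ^ n * ((n + 1) * κ * B)) := by
    have e1 : ‖η‖ ^ n ≤ (4 * Real.pi) ^ n * |(2 * Real.pi)⁻¹ * η v| ^ n := by
      rw [← mul_pow]
      gcongr
      rw [abs_mul, abs_of_pos (by positivity)]
      calc ‖η‖ ≤ 2 * |η v| := hv2
        _ = _ := by field_simp; ring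
    have e2 : |(2 * Real.pi)⁻¹ * η v| ^ n * J ≤ 2 ^ n * ((n + 1) * κ * B) := by
      refine hF.trans ?_
      calc _ ≤ 1 * 2 ^ n * ((n + 1) * κ * B) := by
            gcongr
            exact pow_le_one₀ (norm_nonneg _) hv1
        _ = _ := by rw [one_mul]
    calc ‖η‖ ^ n * J ≤ (4 * Real.pi) ^ n * |(2 * Real.pi)⁻¹ * η v| ^ n * J := by gcongr
      _ = (4 * Real.pi) ^ n * (|(2 * Real.pi)⁻¹ * η v| ^ n * J) := mul_assoc _ _ _
      _ ≤ _ := by gcongr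
  -- The trivial bound covers small frequencies, where powers of ‖η‖ alone give nothing.
  have h2 : J ≤ κ * B := by
    refine (norm_integral_le_integral_norm _).trans ?_
    refine le_trans (le_of_eq (integral_congr_ae (ae_of_all _ fun y => ?_))) (hDint 0 n.zero_le)
    simp only [norm_mul, norm_iteratedFDeriv_zero]
    rw [← mul_neg, mul_comm Complex.I, ← Complex.ofReal_neg, Complex.norm_exp_ofReal_mul_I, mul_one]
  calc (1 + ‖η‖) ^ n * J ≤ 2 ^ n * (1 + ‖η‖ ^ n) * J := by
        gcongr; exact one_add_pow_le (norm_nonneg _) n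
    _ = 2 ^ n * (J + ‖η‖ ^ n * J) := by ring
    _ ≤ 2 ^ n * (κ * B + (4 * Real.pi) ^ n * (2 ^ n * ((n + 1) * κ * B))) := by gcongr
    _ = _ := by ring

end FourierDecay

/-! ### Smooth volume measures -/

section Volume

variable {d : ℕ} {M : Type*} [TopologicalSpace M] [ChartedSpace (EuclideanSpace ℝ (Fin d)) M]
  [MeasurableSpace M] [BorelSpace M] {μ : Measure M}

theorem aemeasurable_extChartAt (c : M) :
    AEMeasurable (extChartAt (𝓡 d) c) (μ.restrict (extChartAt (𝓡 d) c).source) :=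
  (continuousOn_extChartAt c).aemeasurable (isOpen_extChartAt_source c).measurableSet

/-- The density of a smooth volume measure in the chart around `c`. -/
noncomputable def IsSmoothVolume.density (hμ : IsSmoothVolume d μ) (c : M) :
    EuclideanSpace ℝ (Fin d) → ℝ := (hμ c).choose

theorem IsSmoothVolume.contDiffOn_density (hμ : IsSmoothVolume d μ) (c : M) :
    ContDiffOn ℝ ∞ (hμ.density c) (extChartAt (𝓡 d) c).target := (hμ c).choose_spec.1

theorem IsSmoothVolume.density_pos (hμ : IsSmoothVolume d μ) (c : M)
    {y : EuclideanSpace ℝ (Fin d)} (hy : y ∈ (extChartAt (𝓡 d) c).target) :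
    0 < hμ.density c y := (hμ c).choose_spec.2.1 y hy

theorem IsSmoothVolume.map_eq (hμ : IsSmoothVolume d μ) (c : M) :
    (μ.restrict (extChartAt (𝓡 d) c).source).map (extChartAt (𝓡 d) c) =
      (volume.restrict (extChartAt (𝓡 d) c).target).withDensity
        (fun y => ENNReal.ofReal (hμ.density c y)) := (hμ c).choose_spec.2.2

theorem IsSmoothVolume.aemeasurable_density (hμ : IsSmoothVolume d μ) (c : M) :
    AEMeasurable (fun y => ENNReal.ofReal (hμ.density c y))
      (volume.restrict (extChartAt (𝓡 d) c).target) :=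
  ((hμ.contDiffOn_density c).continuousOn.aemeasurable
    (isOpen_extChartAt_target c).measurableSet).ennreal_ofReal

/-- The volume of a measurable part of a chart domain. -/
theorem IsSmoothVolume.apply_eq (hμ : IsSmoothVolume d μ) (c : M) {s : Set M}
    (hs : s ⊆ (extChartAt (𝓡 d) c).source)
    (hs' : MeasurableSet (extChartAt (𝓡 d) c '' s)) :
    μ s = (volume.restrict (extChartAt (𝓡 d) c).target).withDensity
        (fun y => ENNReal.ofReal (hμ.density c y)) (extChartAt (𝓡 d) c '' s) := by
  rw [← hμ.map_eq c, Measure.map_apply_of_aemeasurable (aemeasurable_extChartAt c) hs',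
    Measure.restrict_apply' (isOpen_extChartAt_source c).measurableSet]
  congr 1
  ext x
  constructor
  · exact fun hx => ⟨mem_image_of_mem _ hx, hs hx⟩
  · rintro ⟨⟨z, hz, hzx⟩, hx⟩
    rwa [← (extChartAt (𝓡 d) c).injOn (hs hz) hx hzx]

theorem IsSmoothVolume.isLocallyFiniteMeasure [T2Space M] (hμ : IsSmoothVolume d μ) :
    IsLocallyFiniteMeasure μ := by
  have : LocallyCompactSpace M := ChartedSpace.locallyCompactSpace (EuclideanSpace ℝ (Fin d)) M
  refine ⟨fun x => ?_⟩
  obtain ⟨L, hL, hxL, hLs⟩ := exists_compact_subset (isOpen_extChartAt_source (I := 𝓡 d) x)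
    (mem_extChartAt_source (I := 𝓡 d) x)
  refine ⟨L, mem_interior_iff_mem_nhds.1 hxL, ?_⟩
  have hc : IsCompact (extChartAt (𝓡 d) x '' L) :=
    hL.image_of_continuousOn ((continuousOn_extChartAt x).mono hLs)
  have hct : extChartAt (𝓡 d) x '' L ⊆ (extChartAt (𝓡 d) x).target := by
    rintro _ ⟨z, hz, rfl⟩; exact (extChartAt (𝓡 d) x).map_source (hLs hz)
  rw [hμ.apply_eq x hLs hc.measurableSet, withDensity_apply _ hc.measurableSet]
  obtain ⟨C, hC⟩ := hc.exists_bound_of_continuousOn ((hμ.contDiffOn_density x).continuousOn.mono hct)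
  refine setLIntegral_lt_top_of_le_nnreal ?_ ⟨C.toNNReal, ?_⟩
  · exact ((Measure.restrict_apply_le _ _).trans_lt hc.measure_lt_top).ne
  · exact fun y hy => ENNReal.ofReal_le_ofReal ((le_abs_self _).trans (hC y hy))

/-- As the density is positive, Lebesgue measure in the chart is absolutely continuous with respect
to the image of μ; a null open set of M would give a Lebesgue null non-empty open set. -/
theorem IsSmoothVolume.isOpenPosMeasure (hμ : IsSmoothVolume d μ) :
    μ.IsOpenPosMeasure := by
  refine ⟨fun U hU ⟨x, hx⟩ h0 => ?_⟩
  let κ := extChartAt (𝓡 d) x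
  have hs : U ∩ κ.source ⊆ κ.source := inter_subset_right
  have himg : IsOpen (κ '' (U ∩ κ.source)) := by
    have : κ '' (U ∩ κ.source) = κ.target ∩ κ.symm ⁻¹' U := by
      rw [inter_comm, κ.image_source_inter_eq']
    rw [this]
    exact (continuousOn_extChartAt_symm x).isOpen_inter_preimage (isOpen_extChartAt_target x) hU
  have h1 : μ (U ∩ κ.source) = 0 := measure_mono_null inter_subset_left h0
  rw [hμ.apply_eq x hs himg.measurableSet] at h1
  have h2 := withDensity_absolutelyContinuous' (hμ.aemeasurable_density x) (by
    refine (ae_restrict_iff' (isOpen_extChartAt_target x).measurableSet).2 (ae_of_all _ ?_)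
    intro y hy
    exact (ENNReal.ofReal_pos.2 (hμ.density_pos x hy)).ne') h1
  rw [Measure.restrict_apply himg.measurableSet] at h2
  refine (himg.inter (isOpen_extChartAt_target x)).measure_ne_zero volume ?_ h2
  exact ⟨κ x, mem_image_of_mem _ ⟨hx, mem_extChartAt_source x⟩, mem_extChartAt_target x⟩

/-- Integration in a chart against a smooth volume measure. -/
theorem IsSmoothVolume.integral_eq (hμ : IsSmoothVolume d μ) (c : M) {f : M → ℂ}
    (hf : ContinuousOn f (extChartAt (𝓡 d) c).source)
    (h0 : ∀ x ∉ (extChartAt (𝓡 d) c).source, f x = 0) :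
    ∫ x, f x ∂μ = ∫ y in (extChartAt (𝓡 d) c).target,
      (hμ.density c y : ℂ) * f ((extChartAt (𝓡 d) c).symm y) := by
  let κ := extChartAt (𝓡 d) c
  have hms : MeasurableSet κ.source := (isOpen_extChartAt_source c).measurableSet
  have hmt : MeasurableSet κ.target := (isOpen_extChartAt_target c).measurableSet
  have hG : ContinuousOn (f ∘ κ.symm) κ.target :=
    hf.comp (continuousOn_extChartAt_symm c) fun y hy => κ.map_target hy
  have hG' : AEStronglyMeasurable (f ∘ κ.symm) ((volume.restrict κ.target).withDensity
      (fun y => ENNReal.ofReal (hμ.density c y))) :=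
    (hG.aestronglyMeasurable hmt).mono_ac (withDensity_absolutelyContinuous _ _)
  calc ∫ x, f x ∂μ = ∫ x in κ.source, f x ∂μ :=
        (setIntegral_eq_integral_of_forall_compl_eq_zero h0).symm
    _ = ∫ x in κ.source, (f ∘ κ.symm) (κ x) ∂μ := by
        refine setIntegral_congr_fun hms fun x hx => ?_
        simp only [Function.comp_apply, κ.left_inv hx]
    _ = ∫ y, (f ∘ κ.symm) y ∂((μ.restrict κ.source).map κ) := by
        rw [integral_map (aemeasurable_extChartAt c)]
        rw [hμ.map_eq c]; exact hG'
    _ = _ := by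
        rw [hμ.map_eq c, integral_withDensity_eq_integral_toReal_smul₀ (hμ.aemeasurable_density c)
          (ae_of_all _ fun y => ENNReal.ofReal_lt_top)]
        refine setIntegral_congr_fun hmt fun y hy => ?_
        simp only [ENNReal.toReal_ofReal (hμ.density_pos c hy).le, Complex.real_smul,
          Function.comp_apply]
        rfl

end Volume

/-- Leibniz bound for the derivatives of a product at a point of an open set. -/
theorem norm_iteratedFDeriv_smul_le_of_bounds {X V 𝕜 : Type*} [NormedAddCommGroup X]
    [NormedSpace ℝ X] [NormedField 𝕜] [NormedAlgebra ℝ 𝕜] [NormedAddCommGroup V] [NormedSpace ℝ V]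
    [NormedSpace 𝕜 V] [IsScalarTower ℝ 𝕜 V] {s : Set X} (hs : IsOpen s) {f : X → 𝕜} {g : X → V}
    (hf : ContDiffOn ℝ ∞ f s) (hg : ContDiffOn ℝ ∞ g s) {y : X} (hy : y ∈ s) {n : ℕ} {A B : ℝ}
    (hA0 : 0 ≤ A)
    (hA : ∀ j ≤ n, ‖iteratedFDeriv ℝ j f y‖ ≤ A) (hB : ∀ j ≤ n, ‖iteratedFDeriv ℝ j g y‖ ≤ B) :
    ‖iteratedFDeriv ℝ n (fun z => f z • g z) y‖ ≤ 2 ^ n * (A * B) := by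
  rw [← iteratedFDerivWithin_of_isOpen n hs hy]
  refine (norm_iteratedFDerivWithin_smul_le hf hg hs.uniqueDiffOn hy
    (by exact_mod_cast le_top)).trans ?_
  calc _ ≤ ∑ i ∈ Finset.range (n + 1), (n.choose i : ℝ) * (A * B) := by
        refine Finset.sum_le_sum fun i hi => ?_
        have hi' : i ≤ n := Nat.lt_succ_iff.1 (Finset.mem_range.1 hi)
        rw [iteratedFDerivWithin_of_isOpen i hs hy, iteratedFDerivWithin_of_isOpen (n - i) hs hy,
          mul_assoc]
        gcongr
        · exact hA i hi'
        · exact hB _ (Nat.sub_le n i)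
    _ = _ := by
        rw [← Finset.sum_mul]
        congr 1
        exact_mod_cast Nat.sum_range_choose n

/-! ### Pairings of test functions with configurations -/

section Pairing

variable {d : ℕ} {M : Type*} [TopologicalSpace M] [ChartedSpace (EuclideanSpace ℝ (Fin d)) M]
  [MeasurableSpace M] [BorelSpace M] {μ : Measure M}

theorem continuous_testFun {E H N : Type*} [NormedAddCommGroup E] [NormedSpace ℝ E]
    [TopologicalSpace H] {I : ModelWithCorners ℝ E H} [TopologicalSpace N] [ChartedSpace H N]
    (f : TestFun I N) : Continuous f.1 := f.2.1.continuous

theorem Config.continuous (h : Config (d := d) M) : Continuous h := h.contMDiff.continuous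

theorem integrable_testFun_mul [IsLocallyFiniteMeasure μ] (f : TestFun (𝓡 d) M)
    {h : M → ℂ} (hh : Continuous h) : Integrable (fun x => f.1 x * h x) μ :=
  ((continuous_testFun f).mul hh).integrable_of_hasCompactSupport f.2.2.mul_right

/-- The pairing `h ↦ ∫ f h dμ` of a test function with a smooth function. -/
noncomputable def pairing (μ : Measure M) [IsLocallyFiniteMeasure μ] (f : TestFun (𝓡 d) M) :
    Config (d := d) M →ₗ[ℝ] ℂ where
  toFun h := ∫ x, f.1 x * (h x : ℂ) ∂μ
  map_add' g h := by
    rw [← integral_add]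
    · refine integral_congr_ae (ae_of_all _ fun x => ?_)
      simp [mul_add]
    · exact integrable_testFun_mul f (Complex.continuous_ofReal.comp (Config.continuous g))
    · exact integrable_testFun_mul f (Complex.continuous_ofReal.comp (Config.continuous h))
  map_smul' t h := by
    rw [RingHom.id_apply, Complex.real_smul, ← integral_const_mul]
    refine integral_congr_ae (ae_of_all _ fun x => ?_)
    simp only [ContMDiffMap.coe_smul, Pi.smul_apply, smul_eq_mul, Complex.ofReal_mul]
    ring

variable [IsLocallyFiniteMeasure μ]

theorem pairing_apply (f : TestFun (𝓡 d) M) (h : Config (d := d) M) :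
    pairing μ f h = ∫ x, f.1 x * (h x : ℂ) ∂μ := rfl

theorem pairing_add_left (f g : TestFun (𝓡 d) M) (h : Config (d := d) M) :
    pairing μ (f + g) h = pairing μ f h + pairing μ g h := by
  have hc : Continuous fun x => (h x : ℂ) :=
    Complex.continuous_ofReal.comp (Config.continuous h)
  rw [pairing_apply, pairing_apply, pairing_apply,
    ← integral_add (integrable_testFun_mul f hc) (integrable_testFun_mul g hc)]
  refine integral_congr_ae (ae_of_all _ fun x => ?_)
  simp [add_mul]

theorem pairing_smul_left (c : ℂ) (f : TestFun (𝓡 d) M) (h : Config (d := d) M) :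
    pairing μ (c • f) h = c * pairing μ f h := by
  rw [pairing_apply, pairing_apply, ← integral_const_mul]
  refine integral_congr_ae (ae_of_all _ fun x => ?_)
  simp [mul_assoc]

theorem pairing_zero_left (h : Config (d := d) M) :
    pairing μ (0 : TestFun (𝓡 d) M) h = 0 := by
  rw [← zero_smul ℂ (0 : TestFun (𝓡 d) M), pairing_smul_left, zero_mul]

/-- A linear functional on a topological vector space that is bounded on a neighbourhood of zero is
continuous. -/
theorem continuous_of_bounded_nhds {A : Type*} [AddCommGroup A] [Module ℝ A] [TopologicalSpace A]
    [IsTopologicalAddGroup A] [ContinuousSMul ℝ A] (ℓ : A →ₗ[ℝ] ℂ) {C : ℝ}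
    (h : ∀ᶠ v in 𝓝 (0 : A), ‖ℓ v‖ ≤ C) : Continuous ℓ := by
  refine (ℓ.clmOfExistsBoundedImage (𝕜' := ℝ) ⟨_, h, ?_⟩).continuous
  rw [NormedSpace.isVonNBounded_iff]
  refine isBounded_iff_forall_norm_le.2 ⟨C, ?_⟩
  rintro _ ⟨v, hv, rfl⟩
  exact hv

theorem norm_pairing_le (f : TestFun (𝓡 d) M) (h : Config (d := d) M) {B : ℝ}
    (hB : ∀ x ∈ tsupport f.1, |h x| ≤ B) : ‖pairing μ f h‖ ≤ (∫ x, ‖f.1 x‖ ∂μ) * B := by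
  refine (norm_integral_le_integral_norm _).trans ?_
  rw [← integral_mul_const]
  have hi : Integrable f.1 μ := (continuous_testFun f).integrable_of_hasCompactSupport f.2.2
  refine integral_mono_of_nonneg (ae_of_all _ fun x => norm_nonneg _) (hi.norm.mul_const B)
    (ae_of_all _ fun x => ?_)
  simp only [norm_mul, Complex.norm_real, Real.norm_eq_abs]
  by_cases hx : x ∈ tsupport f.1
  · gcongr; exact hB x hx
  · simp [image_eq_zero_of_notMem_tsupport hx]

theorem eventually_norm_pairing_le [LocallyCompactSpace M] [IsManifold (𝓡 d) ∞ M] (f : TestFun (𝓡 d) M) :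
    ∀ᶠ h : Config (d := d) M in 𝓝 0, ‖pairing μ f h‖ ≤ ∫ x, ‖f.1 x‖ ∂μ := by
  filter_upwards [eventually_config_bound (I := 𝓡 d) f.2.2.isCompact] with h hh
  simpa using norm_pairing_le (μ := μ) f h hh

theorem continuous_pairing [LocallyCompactSpace M] [IsManifold (𝓡 d) ∞ M] (f : TestFun (𝓡 d) M) :
    Continuous (pairing μ f) :=
  continuous_of_bounded_nhds _ (eventually_norm_pairing_le f)

/-- A test function vanishes on an open set if its pairings with all smooth functions supported
there vanish. -/
theorem TestFun.eq_zero_of_pairing_eq_zero [T2Space M] [SigmaCompactSpace M]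
    [IsManifold (𝓡 d) ∞ M] [μ.IsOpenPosMeasure]
    {U : Set M} (hU : IsOpen U) (f : TestFun (𝓡 d) M)
    (h : ∀ g : Config (d := d) M, tsupport g ⊆ U → pairing μ f g = 0) : ∀ x ∈ U, f.1 x = 0 := by
  have hli : LocallyIntegrableOn f.1 U μ := (continuous_testFun f).locallyIntegrable.locallyIntegrableOn U
  have h0 := hU.ae_eq_zero_of_integral_contMDiff_smul_eq_zero (𝓡 d) hli fun g hg _ hgU => by
    let g' : Config (d := d) M := ⟨g, hg⟩
    rw [← h g' hgU, pairing_apply]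
    refine integral_congr_ae (ae_of_all _ fun x => ?_)
    change g x • f.1 x = f.1 x * (g x : ℂ)
    rw [Complex.real_smul, mul_comm]
  -- Vanishing almost everywhere becomes vanishing everywhere, because the points of U with f ≠ 0
  -- form an open set, and non-empty open sets have positive measure.
  by_contra! hcon
  obtain ⟨x, hxU, hx⟩ := hcon
  have hopen : IsOpen (U ∩ {y | f.1 y ≠ 0}) := hU.inter (isOpen_ne_fun (continuous_testFun f) continuous_const)
  refine hopen.measure_ne_zero μ ⟨x, hxU, hx⟩ ?_
  rw [ae_iff] at h0
  refine measure_mono_null ?_ h0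
  exact fun y hy hyU => hy.2 (hyU hy.1)

/-- Makes the density of a first derivative unique, so that the chosen `gradient` can be computed.
-/
theorem TestFun.eq_of_pairing_eq [T2Space M] [SigmaCompactSpace M]
    [IsManifold (𝓡 d) ∞ M] [μ.IsOpenPosMeasure]
    (f g : TestFun (𝓡 d) M)
    (h : ∀ k : Config (d := d) M, pairing μ f k = pairing μ g k) : f = g := by
  rw [← sub_eq_zero]
  refine Subtype.ext (funext fun x => ?_)
  refine TestFun.eq_zero_of_pairing_eq_zero (μ := μ) isOpen_univ _ (fun k _ => ?_) x (mem_univ x)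
  have : f - g = f + (-1 : ℂ) • g := by
    refine Subtype.ext (funext fun y => ?_)
    change f.1 y - g.1 y = f.1 y + (-1 : ℂ) * g.1 y
    ring
  rw [this, pairing_add_left, pairing_smul_left, h k]
  ring

theorem mem_extChartAt_target_of_mem_image {E H N : Type*} [NormedAddCommGroup E]
    [NormedSpace ℝ E] [TopologicalSpace H] {I : ModelWithCorners ℝ E H} [TopologicalSpace N]
    [ChartedSpace H N] {c : N} {K : Set N} (hK : K ⊆ (chartAt H c).source) {y : E}
    (hy : y ∈ extChartAt I c '' K) : y ∈ (extChartAt I c).target := by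
  obtain ⟨x, hx, rfl⟩ := hy
  exact (extChartAt I c).map_source (by rw [extChartAt_source]; exact hK hx)

theorem isCompact_extChartAt_image {E H N : Type*} [NormedAddCommGroup E]
    [NormedSpace ℝ E] [TopologicalSpace H] {I : ModelWithCorners ℝ E H} [TopologicalSpace N]
    [ChartedSpace H N] {c : N} {K : Set N} (hK : IsCompact K) (hKs : K ⊆ (chartAt H c).source) :
    IsCompact (extChartAt I c '' K) :=
  hK.image_of_continuousOn ((continuousOn_extChartAt c).mono (by rwa [extChartAt_source]))

variable [IsManifold (𝓡 d) ∞ M]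

/-- Pairing with an oscillating test function decays rapidly in the frequency, uniformly for smooth
functions with bounded derivatives. -/
theorem IsSmoothVolume.exists_pairing_modulate_decay (hμ : IsSmoothVolume d μ)
    (c : M) (χ : TestFun (𝓡 d) M)
    (hχ : tsupport (χ : M → ℂ) ⊆ (chartAt (EuclideanSpace ℝ (Fin d)) c).source) (n : ℕ) :
    ∃ C : ℝ, 0 ≤ C ∧ ∀ h : Config (d := d) M,
      (∀ j ≤ n, ∀ y ∈ extChartAt (𝓡 d) c '' tsupport χ.1,
        ‖iteratedFDeriv ℝ j (h ∘ (extChartAt (𝓡 d) c).symm) y‖ ≤ 1) →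
      ∀ η : EuclideanSpace ℝ (Fin d) →L[ℝ] ℝ,
        (1 + ‖η‖) ^ n * ‖pairing μ (modulate c χ hχ η) h‖ ≤ C := by
  let κ := extChartAt (𝓡 d) c
  let K := κ '' tsupport χ.1
  have hK : IsCompact K := isCompact_extChartAt_image χ.2.2.isCompact hχ
  have hKt : K ⊆ κ.target := fun y hy => mem_extChartAt_target_of_mem_image hχ hy
  have hto : IsOpen κ.target := isOpen_extChartAt_target c
  have hχK : ∀ y ∈ κ.target, y ∉ K → χ.1 (κ.symm y) = 0 := by
    intro y hy hyK
    refine image_eq_zero_of_notMem_tsupport fun hmem => hyK ⟨_, hmem, κ.right_inv hy⟩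
  -- In the chart the integrand is h times the fixed function q times a plane wave; bounds on the
  -- derivatives of h therefore suffice for a uniform estimate.
  let q : EuclideanSpace ℝ (Fin d) → ℂ := fun y => hμ.density c y • χ.1 (κ.symm y)
  have hq : ContDiffOn ℝ ∞ q κ.target :=
    (hμ.contDiffOn_density c).smul (contDiffOn_comp_extChartAt_symm χ.2.1 c)
  obtain ⟨A, hA1, hA⟩ := exists_bound_iteratedFDeriv_of_isCompact hto hq hK hKt n
  obtain ⟨C, hC0, hC⟩ := exists_fourier_decay_bound
    (volume : Measure (EuclideanSpace ℝ (Fin d))) hK n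
  refine ⟨C * (2 ^ n * (1 * A)), by positivity, fun h hh η => ?_⟩
  have hh' : ContDiffOn ℝ ∞ (h ∘ κ.symm) κ.target := contDiffOn_comp_extChartAt_symm h.contMDiff c
  let p : EuclideanSpace ℝ (Fin d) → ℂ := fun y => (h ∘ κ.symm) y • q y
  have hp : ContDiffOn ℝ ∞ p κ.target := hh'.smul hq
  have hp0 : ∀ y ∈ κ.target, y ∉ K → p y = 0 := fun y hy hyK => by
    simp only [p, q, hχK y hy hyK, smul_zero]
  have hint : pairing μ (modulate c χ hχ η) h =
      ∫ y, κ.target.indicator p y * Complex.exp (-(Complex.I * (η y : ℂ))) := by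
    rw [pairing_apply, hμ.integral_eq c]
    · rw [← integral_indicator hto.measurableSet]
      refine integral_congr_ae (ae_of_all _ fun y => ?_)
      simp only
      by_cases hy : y ∈ κ.target
      · rw [indicator_of_mem hy, indicator_of_mem hy]
        simp only [modulate, p, q, Function.comp_apply, Complex.real_smul]
        rw [show extChartAt (𝓡 d) c ((extChartAt (𝓡 d) c).symm y) = y from κ.right_inv hy]
        ring
      · rw [indicator_of_notMem hy, indicator_of_notMem hy, zero_mul]
    · exact ((continuous_testFun (modulate c χ hχ η)).mul
        (Complex.continuous_ofReal.comp (Config.continuous h))).continuousOn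
    · intro x hx
      have : χ.1 x = 0 := image_eq_zero_of_notMem_tsupport fun hmem => hx (by
        rw [extChartAt_source]; exact hχ hmem)
      simp [modulate, this]
  rw [hint]
  refine hC _ (contDiff_indicator_of_isCompact hto hp hK hKt hp0) ?_ _ (by positivity) ?_ η
  · intro y hyK
    by_cases hy : y ∈ κ.target
    · rw [indicator_of_mem hy, hp0 y hy hyK]
    · exact indicator_of_notMem hy p
  · intro j hj y hy
    have heq : κ.target.indicator p =ᶠ[𝓝 y] p := by
      filter_upwards [hto.mem_nhds (hKt hy)] with z hz using indicator_of_mem hz p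
    rw [(heq.iteratedFDeriv ℝ j).eq_of_nhds]
    refine (norm_iteratedFDeriv_smul_le_of_bounds hto hh' hq (hKt hy) zero_le_one
      (fun i hi => hh i (hi.trans hj) y hy) fun i hi => hA i (hi.trans hj) y hy).trans ?_
    gcongr
    exact one_le_two

end Pairing

/-! ### Product manifolds, bump functions and products of test functions -/

instance boundaryless_pi {ι : Type*} [Fintype ι] {E : Type*} [NormedAddCommGroup E]
    [NormedSpace ℝ E] {H : Type*} [TopologicalSpace H] (I : ModelWithCorners ℝ E H)
    [I.Boundaryless] : (ModelWithCorners.pi fun _ : ι => I).Boundaryless := by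
  refine ⟨eq_univ_of_forall fun y => ⟨fun i => I.symm (y i), funext fun i => ?_⟩⟩
  exact I.right_inv (by rw [I.range_eq_univ]; exact mem_univ _)

theorem contMDiff_piApply {E H N : Type*} [NormedAddCommGroup E]
    [NormedSpace ℝ E] [TopologicalSpace H] (I : ModelWithCorners ℝ E H)
    [TopologicalSpace N] [ChartedSpace H N] {ι : Type*} [Fintype ι] (i : ι) :
    ContMDiff (ModelWithCorners.pi fun _ : ι => I) I ∞ (fun x : ι → N => x i) := by
  intro x
  refine contMDiffAt_iff.2 ⟨(continuous_apply i).continuousAt, ?_⟩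
  have h := (contMDiffAt_iff.1 (contMDiffAt_id (I := I) (n := ∞) (x := x i))).2
  refine ContDiffWithinAt.comp (g := extChartAt I (x i) ∘ id ∘ (extChartAt I (x i)).symm)
    (f := fun y : ι → E => y i) _ h (contDiff_apply ℝ E i).contDiffWithinAt ?_
  rintro _ ⟨y, rfl⟩
  exact mem_range_self (y i)

/-- Every point carries a test function with value one there, supported in the chart domain. -/
theorem exists_testFun_bump {E H N : Type*} [NormedAddCommGroup E] [NormedSpace ℝ E]
    [FiniteDimensional ℝ E] [TopologicalSpace H] (I : ModelWithCorners ℝ E H)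
    [TopologicalSpace N] [ChartedSpace H N] [IsManifold I ∞ N] [T2Space N] (x : N) :
    ∃ χ : TestFun I N, tsupport (χ : N → ℂ) ⊆ (chartAt H x).source ∧ χ.1 x = 1 ∧
      ∀ y, ∃ r : ℝ, 0 ≤ r ∧ χ.1 y = r := by
  obtain ⟨b⟩ : Nonempty (SmoothBumpFunction I x) := inferInstance
  have h0 : Function.support (fun y => ((b y : ℝ) : ℂ)) = Function.support b := by
    ext y; simp
  refine ⟨⟨fun y => (b y : ℂ), ?_, ?_⟩, ?_, ?_, fun y => ⟨b y, b.nonneg, rfl⟩⟩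
  · exact Complex.ofRealCLM.contDiff.contMDiff.comp b.contMDiff
  · rw [HasCompactSupport, tsupport, h0]; exact b.hasCompactSupport
  · change closure (Function.support fun y => ((b y : ℝ) : ℂ)) ⊆ _
    rw [h0]; exact b.tsupport_subset_chartAt_source
  · simp

/-- The product of two test functions. -/
noncomputable def mulTest {E H N : Type*} [NormedAddCommGroup E] [NormedSpace ℝ E]
    [TopologicalSpace H] {I : ModelWithCorners ℝ E H} [TopologicalSpace N] [ChartedSpace H N]
    (f g : TestFun I N) : TestFun I N :=
  ⟨fun x => f.1 x * g.1 x,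
    (contDiff_mul (𝕜 := ℝ) (𝔸 := ℂ)).contMDiff.comp (f.2.1.prodMk_space g.2.1), f.2.2.mul_right⟩

theorem tsupport_mulTest_subset {E H N : Type*} [NormedAddCommGroup E] [NormedSpace ℝ E]
    [TopologicalSpace H] {I : ModelWithCorners ℝ E H} [TopologicalSpace N] [ChartedSpace H N]
    (f g : TestFun I N) : tsupport (mulTest f g).1 ⊆ tsupport f.1 :=
  closure_mono (Function.support_mul_subset_left _ _)

/-- Turns decay in each component of a covector into decay in the whole covector. -/
theorem one_add_sum_le_prod {ι : Type*} (s : Finset ι) {a : ι → ℝ} (ha : ∀ i, 0 ≤ a i) :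
    1 + ∑ i ∈ s, a i ≤ ∏ i ∈ s, (1 + a i) := by
  classical
  induction s using Finset.induction_on with
  | empty => simp
  | insert i s hi ih =>
    rw [Finset.sum_insert hi, Finset.prod_insert hi]
    have := Finset.sum_nonneg (s := s) fun i _ => ha i
    nlinarith [ha i, mul_nonneg (ha i) this]

/-! ### Tensor product kernels have empty wavefront set -/

section Tensor

variable {d : ℕ} {M : Type*} [TopologicalSpace M] [ChartedSpace (EuclideanSpace ℝ (Fin d)) M]

/-- The tensor product of finitely many test functions. -/
noncomputable def tensorPow [T2Space M] {n : ℕ} (f : Fin n → TestFun (𝓡 d) M) :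
    TestFunPow (d := d) M n :=
  ⟨fun x => ∏ i, (f i).1 (x i), by
    refine ⟨?_, ?_⟩
    · have h : ContMDiff (ModelWithCorners.pi fun _ : Fin n => 𝓡 d) 𝓘(ℝ, Fin n → ℂ) ∞
          (fun (x : Fin n → M) i => (f i).1 (x i)) :=
        contMDiff_pi_space.2 fun i => (f i).2.1.comp (contMDiff_piApply (𝓡 d) i)
      have h2 : ContDiff ℝ ∞ fun z : Fin n → ℂ => ∏ i, z i :=
        contDiff_prod fun i _ => contDiff_apply ℝ ℂ i
      exact h2.contMDiff.comp h
    · refine HasCompactSupport.of_support_subset_isCompact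
        (isCompact_univ_pi fun i => (f i).2.2.isCompact) fun x hx i _ => ?_
      exact subset_tsupport _ fun h0 => hx (Finset.prod_eq_zero (Finset.mem_univ i) h0)⟩

theorem tensorPow_apply [T2Space M] {n : ℕ} (f : Fin n → TestFun (𝓡 d) M) (x : Fin n → M) :
    (tensorPow f).1 x = ∏ i, (f i).1 (x i) := rfl

theorem tsupport_tensorPow_subset [T2Space M] {n : ℕ} (f : Fin n → TestFun (𝓡 d) M) :
    tsupport (tensorPow f).1 ⊆ univ.pi fun i => tsupport (f i).1 := by
  refine closure_minimal (fun x hx i _ => ?_) (isClosed_set_pi fun i _ => isClosed_tsupport _)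
  exact subset_tsupport _ fun h0 => hx (Finset.prod_eq_zero (Finset.mem_univ i) h0)

variable [MeasurableSpace M] [BorelSpace M] [T2Space M] [SecondCountableTopology M]
  [IsManifold (𝓡 d) ∞ M] (μ : Measure M) [IsLocallyFiniteMeasure μ] [SigmaFinite μ]

theorem integrable_kernel_mul {n : ℕ} (k : TestFunPow (d := d) M n) {w : (Fin n → M) → ℂ}
    (hw : Continuous w) : Integrable (fun x => k.1 x * w x) (Measure.pi fun _ => μ) :=
  ((continuous_testFun k).mul hw).integrable_of_hasCompactSupport k.2.2.mul_right

/-- The distribution on `Mⁿ` given by integration against a test function. -/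
noncomputable def kernelDistr {n : ℕ} (k : TestFunPow (d := d) M n) : DistrPow (d := d) M n where
  toLinearMap :=
    { toFun := fun w => ∫ x, k.1 x * w.1 x ∂(Measure.pi fun _ => μ)
      map_add' := fun w v => by
        rw [← integral_add (integrable_kernel_mul μ k (continuous_testFun w))
          (integrable_kernel_mul μ k (continuous_testFun v))]
        refine integral_congr_ae (ae_of_all _ fun x => ?_)
        simp [mul_add]
      map_smul' := fun c w => by
        rw [RingHom.id_apply, smul_eq_mul, ← integral_const_mul]
        refine integral_congr_ae (ae_of_all _ fun x => ?_)
        simp only [SetLike.val_smul, Pi.smul_apply, smul_eq_mul]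
        ring }
  continuousOn' := by
    intro K _
    have : LocallyCompactSpace M := ChartedSpace.locallyCompactSpace (EuclideanSpace ℝ (Fin d)) M
    let I' := ModelWithCorners.pi fun _ : Fin n => 𝓡 d
    let τ : TopologicalSpace (TestFun I' (Fin n → M)) :=
      TopologicalSpace.induced (fun f => (f : (Fin n → M) → ℂ)) (smoothTopology I' (Fin n → M) ℂ)
    refine @Continuous.continuousOn _ _ τ _ _ _ ?_
    refine @continuous_iff_continuousAt _ _ τ _ _ |>.2 fun w => ?_
    have h1 : Tendsto (fun v : TestFun I' (Fin n → M) => v.1) (@nhds _ τ w)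
        (@nhds _ (smoothTopology I' (Fin n → M) ℂ) w.1) := by
      rw [@nhds_induced _ _ (smoothTopology I' (Fin n → M) ℂ)]
      exact tendsto_comap
    have h2 := Metric.tendstoUniformlyOn_iff.1
      (tendstoUniformlyOn_of_tendsto_smoothTopology h1 k.2.2.isCompact)
    refine Metric.tendsto_nhds.2 fun ε hε => ?_
    set A := ∫ x, ‖k.1 x‖ ∂(Measure.pi fun _ => μ) with hA
    have hA0 : 0 ≤ A := integral_nonneg fun x => norm_nonneg _
    have hk : Integrable k.1 (Measure.pi fun _ => μ) :=
      (continuous_testFun k).integrable_of_hasCompactSupport k.2.2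
    filter_upwards [h2 (ε / (A + 1)) (by positivity)] with v hv
    change dist (∫ x, k.1 x * v.1 x ∂(Measure.pi fun _ => μ))
      (∫ x, k.1 x * w.1 x ∂(Measure.pi fun _ => μ)) < ε
    rw [dist_eq_norm, ← integral_sub (integrable_kernel_mul μ k (continuous_testFun v))
      (integrable_kernel_mul μ k (continuous_testFun w))]
    refine (norm_integral_le_integral_norm _).trans_lt ?_
    have : ∫ x, ‖k.1 x * v.1 x - k.1 x * w.1 x‖ ∂(Measure.pi fun _ => μ) ≤ A * (ε / (A + 1)) := by
      rw [hA, ← integral_mul_const]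
      refine integral_mono_of_nonneg (ae_of_all _ fun x => norm_nonneg _) (hk.norm.mul_const _)
        (ae_of_all _ fun x => ?_)
      simp only [← mul_sub, norm_mul]
      by_cases hx : x ∈ tsupport k.1
      · have := (hv x hx).le
        rw [dist_comm, dist_eq_norm] at this
        gcongr
      · simp [image_eq_zero_of_notMem_tsupport hx]
    refine this.trans_lt ?_
    rw [mul_div_assoc', div_lt_iff₀ (by positivity)]
    nlinarith

theorem kernelDistr_apply {n : ℕ} (k w : TestFunPow (d := d) M n) :
    kernelDistr μ k w = ∫ x, k.1 x * w.1 x ∂(Measure.pi fun _ => μ) := rfl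

/-- The wavefront set of a finite sum of tensor products of test functions is empty. -/
theorem WF_kernelDistr_sum_tensorPow (hμ : IsSmoothVolume d μ) {n : ℕ} {ι : Type*} (s : Finset ι)
    (c : ι → ℂ) (f : ι → Fin n → TestFun (𝓡 d) M) :
    WF (kernelDistr μ (∑ a ∈ s, c a • tensorPow (f a))) = ∅ := by
  refine eq_empty_of_forall_notMem ?_
  rintro ⟨x, ξ⟩ ⟨hξ, hreg⟩
  -- All directions are handled at once: the cone consists of all non-zero covectors.
  refine hreg ⟨{η | η ≠ 0}, isOpen_ne, hξ, fun h => h rfl,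
    fun η hη t ht => smul_ne_zero ht.ne' hη, ?_⟩
  choose χ hχs hχ1 _ using fun i => exists_testFun_bump (𝓡 d) (x i)
  have hχ : tsupport (tensorPow χ).1 ⊆
      (chartAt (ModelPi fun _ : Fin n => EuclideanSpace ℝ (Fin d)) x).source :=
    (tsupport_tensorPow_subset χ).trans fun y hy i _ => hχs i (hy i (mem_univ i))
  refine ⟨tensorPow χ, hχ, ?_, fun k => ?_⟩
  · rw [tensorPow_apply]; simp [hχ1]
  have hsup : ∀ a i, tsupport (mulTest (χ i) (f a i)).1 ⊆
      (chartAt (EuclideanSpace ℝ (Fin d)) (x i)).source :=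
    fun a i => (tsupport_mulTest_subset _ _).trans (hχs i)
  -- Pairing with the constant one is integration, so the decay estimate for pairings applies to the
  -- Fourier transforms.
  let one : Config (d := d) M := ⟨fun _ => 1, contMDiff_const⟩
  let comp : ((Fin n → EuclideanSpace ℝ (Fin d)) →L[ℝ] ℝ) → Fin n →
      EuclideanSpace ℝ (Fin d) →L[ℝ] ℝ := fun η i => η.comp
        (ContinuousLinearMap.single ℝ (fun _ : Fin n => EuclideanSpace ℝ (Fin d)) i)
  have hcomp : ∀ η v, η v = ∑ i, comp η i (v i) := by
    intro η v
    simp only [comp, ContinuousLinearMap.comp_apply, ContinuousLinearMap.single_apply]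
    rw [← map_sum, Finset.univ_sum_single]
  have hnorm : ∀ η, ‖η‖ ≤ ∑ i, ‖comp η i‖ := by
    intro η
    refine η.opNorm_le_bound (Finset.sum_nonneg fun i _ => norm_nonneg _) fun v => ?_
    rw [hcomp η v, Finset.sum_mul]
    refine (norm_sum_le _ _).trans (Finset.sum_le_sum fun i _ => ?_)
    exact ((comp η i).le_opNorm _).trans (by gcongr; exact norm_le_pi_norm v i)
  choose C hC0 hC using fun a i => hμ.exists_pairing_modulate_decay (x i)
    (mulTest (χ i) (f a i)) (hsup a i) k
  have hC' : ∀ a i η, (1 + ‖η‖) ^ k * ‖pairing μ (modulate (x i) _ (hsup a i) η) one‖ ≤ C a i := by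
    intro a i η
    refine hC a i one (fun j _ y _ => ?_) η
    change ‖iteratedFDeriv ℝ j (fun _ => (1 : ℝ)) y‖ ≤ 1
    rcases Nat.eq_zero_or_pos j with rfl | hj
    · rw [norm_iteratedFDeriv_zero, norm_one]
    · rw [iteratedFDeriv_const_of_ne hj.ne']
      simp
  -- A plane wave on a product factors into plane waves; by Fubini the transform is a finite sum of
  -- products of transforms on M.
  have hval : ∀ η, kernelDistr μ (∑ a ∈ s, c a • tensorPow (f a)) (modulate x (tensorPow χ) hχ η) =
      ∑ a ∈ s, c a * ∏ i, pairing μ (modulate (x i) _ (hsup a i) (comp η i)) one := by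
    intro η
    rw [kernelDistr_apply]
    have hpt : ∀ y : Fin n → M, (∑ a ∈ s, c a • tensorPow (f a) : TestFunPow (d := d) M n).1 y *
        (modulate x (tensorPow χ) hχ η).1 y = ∑ a ∈ s, c a * ∏ i,
          ((modulate (x i) _ (hsup a i) (comp η i)).1 (y i) * (one (y i) : ℂ)) := by
      intro y
      have h1 : (∑ a ∈ s, c a • tensorPow (f a) : TestFunPow (d := d) M n).1 y =
          ∑ a ∈ s, c a * ∏ i, (f a i).1 (y i) := by
        rw [AddSubmonoidClass.coe_finsetSum, Finset.sum_apply]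
        rfl
      rw [h1, Finset.sum_mul]
      refine Finset.sum_congr rfl fun a _ => ?_
      rw [mul_assoc]
      congr 1
      have h2 : (modulate x (tensorPow χ) hχ η).1 y = (∏ i, (χ i).1 (y i)) *
          ∏ i, Complex.exp (-(Complex.I * (comp η i (extChartAt (𝓡 d) (x i) (y i)) : ℂ))) := by
        rw [← Complex.exp_sum, Finset.sum_neg_distrib, ← Finset.mul_sum, ← Complex.ofReal_sum,
          ← hcomp η fun i => extChartAt (𝓡 d) (x i) (y i)]
        rfl
      rw [h2, ← Finset.prod_mul_distrib, ← Finset.prod_mul_distrib]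
      refine Finset.prod_congr rfl fun i _ => ?_
      simp only [modulate, mulTest, one, ContMDiffMap.coeFn_mk]
      push_cast
      ring
    simp only [hpt]
    rw [integral_finsetSum]
    · refine Finset.sum_congr rfl fun a _ => ?_
      rw [integral_const_mul]
      congr 1
      exact integral_fintype_prod_eq_prod (μ := fun _ => μ) fun i z =>
        (modulate (x i) _ (hsup a i) (comp η i)).1 z * (one z : ℂ)
    · intro a _
      refine Integrable.const_mul (Integrable.fintype_prod (μ := fun _ => μ) (f := fun i z =>
        (modulate (x i) _ (hsup a i) (comp η i)).1 z * (one z : ℂ)) fun i => ?_) _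
      exact integrable_testFun_mul _ (Complex.continuous_ofReal.comp (Config.continuous one))
  refine ⟨∑ a ∈ s, ‖c a‖ * ∏ i, C a i, fun η _ => ?_⟩
  have hv := hval η
  rw [hv]
  refine (mul_le_mul_of_nonneg_left (norm_sum_le _ _) (by positivity)).trans ?_
  rw [Finset.mul_sum]
  refine Finset.sum_le_sum fun a _ => ?_
  rw [norm_mul, norm_prod, mul_left_comm]
  gcongr
  calc (1 + ‖η‖) ^ k * ∏ i, ‖pairing μ (modulate (x i) _ (hsup a i) (comp η i)) one‖
      ≤ (∏ i, (1 + ‖comp η i‖)) ^ k *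
          ∏ i, ‖pairing μ (modulate (x i) _ (hsup a i) (comp η i)) one‖ := by
        gcongr
        exact (add_le_add_right (hnorm η) 1).trans
          (one_add_sum_le_prod _ fun i => norm_nonneg _)
    _ = ∏ i, ((1 + ‖comp η i‖) ^ k *
          ‖pairing μ (modulate (x i) _ (hsup a i) (comp η i)) one‖) := by
        rw [Finset.prod_mul_distrib, Finset.prod_pow]
    _ ≤ ∏ i, C a i := Finset.prod_le_prod (fun i _ => by positivity) fun i _ => hC' a i _

end Tensor

/-! ### Disjoint bumps accumulating at zero, and weights that dominate their derivatives -/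

section Bumps

/-- Bump functions around the points `2⁻ʲ` with pairwise disjoint supports. -/
noncomputable def bumpSeq (j : ℕ) : ContDiffBump ((1 / 2 : ℝ) ^ j) where
  rIn := (1 / 2 : ℝ) ^ j / 8
  rOut := (1 / 2 : ℝ) ^ j / 4
  rIn_pos := by positivity
  rIn_lt_rOut := by
    have : (0 : ℝ) < (1 / 2 : ℝ) ^ j := by positivity
    linarith

theorem mem_tsupport_bumpSeq {j : ℕ} {t : ℝ} (h : t ∈ tsupport (bumpSeq j)) :
    |t - (1 / 2 : ℝ) ^ j| ≤ (1 / 2 : ℝ) ^ j / 4 := by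
  rw [(bumpSeq j).tsupport_eq, Metric.mem_closedBall, Real.dist_eq] at h
  exact h

/-- The j-th support lies between 3/4 and 5/4 of 2⁻ʲ, and for j > i one has 5/4 · 2⁻ʲ ≤ 5/8 · 2⁻ⁱ <
3/4 · 2⁻ⁱ. -/
theorem tsupport_bumpSeq_inj {i j : ℕ} {t : ℝ} (hi : t ∈ tsupport (bumpSeq i))
    (hj : t ∈ tsupport (bumpSeq j)) : i = j := by
  wlog hij : i < j generalizing i j
  · rcases eq_or_lt_of_le (not_lt.1 hij) with h | h
    · exact h.symm
    · exact (this hj hi h).symm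
  exfalso
  have h1 := abs_le.1 (mem_tsupport_bumpSeq hi)
  have h2 := abs_le.1 (mem_tsupport_bumpSeq hj)
  have h3 : (1 / 2 : ℝ) ^ j ≤ (1 / 2 : ℝ) ^ (i + 1) :=
    pow_le_pow_of_le_one (by norm_num) (by norm_num) hij
  rw [pow_succ] at h3
  have h4 : (0 : ℝ) < (1 / 2 : ℝ) ^ i := by positivity
  linarith [h1.1, h2.2]

theorem zero_notMem_tsupport_bumpSeq (j : ℕ) : (0 : ℝ) ∉ tsupport (bumpSeq j) := by
  intro h
  have h1 := abs_le.1 (mem_tsupport_bumpSeq h)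
  have h4 : (0 : ℝ) < (1 / 2 : ℝ) ^ j := by positivity
  linarith [h1.1]

theorem pow_mem_tsupport_bumpSeq (j : ℕ) : (1 / 2 : ℝ) ^ j ∈ tsupport (bumpSeq j) := by
  rw [(bumpSeq j).tsupport_eq]
  exact Metric.mem_closedBall_self (bumpSeq j).rOut_pos.le

theorem iteratedDeriv_bumpSeq_eq_zero {j : ℕ} (m : ℕ) {t : ℝ} (h : t ∉ tsupport (bumpSeq j)) :
    iteratedDeriv m (bumpSeq j) t = 0 := by
  have h1 : iteratedFDeriv ℝ m (bumpSeq j) t = 0 :=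
    iteratedFDeriv_eq_zero_of_notMem (isClosed_tsupport _)
      (fun y hy => image_eq_zero_of_notMem_tsupport hy) m h
  rw [iteratedDeriv, h1]; rfl

theorem bumpSeq_pow (j : ℕ) : bumpSeq j ((1 / 2 : ℝ) ^ j) = 1 :=
  (bumpSeq j).one_of_mem_closedBall (Metric.mem_closedBall_self (bumpSeq j).rIn_pos.le)

/-- The bump is constant near its centre. This removes from the gradient the term in which the bump
is differentiated. -/
theorem iteratedDeriv_one_bumpSeq_pow (j : ℕ) :
    iteratedDeriv 1 (bumpSeq j) ((1 / 2 : ℝ) ^ j) = 0 := by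
  rw [iteratedDeriv_one, (bumpSeq j).eventuallyEq_one.deriv_eq]
  exact deriv_const _ _

theorem exists_bumpSeq_bound : ∃ B : ℕ → ℕ → ℝ, (∀ m j, 0 ≤ B m j) ∧
    ∀ m j t, ‖iteratedDeriv m (bumpSeq j) t‖ ≤ B m j := by
  have h : ∀ m j, ∃ C : ℝ, ∀ t, ‖iteratedDeriv m (bumpSeq j) t‖ ≤ C := by
    intro m j
    have hc : Continuous (iteratedDeriv m (bumpSeq j)) :=
      ((bumpSeq j).contDiff (n := ⊤)).continuous_iteratedDeriv m (by exact_mod_cast le_top)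
    obtain ⟨C, hC⟩ := (bumpSeq j).hasCompactSupport.isCompact.exists_bound_of_continuousOn
      hc.continuousOn
    refine ⟨max C 0, fun t => ?_⟩
    by_cases ht : t ∈ tsupport (bumpSeq j)
    · exact (hC t ht).trans (le_max_left _ _)
    · rw [iteratedDeriv_bumpSeq_eq_zero m ht, norm_zero]; exact le_max_right _ _
  choose B hB using h
  exact ⟨B, fun m j => (norm_nonneg _).trans (hB m j 0), hB⟩

/-- A sequence decaying faster than the growth of each derivative of the bump functions. -/
theorem exists_bumpSeq_weight : ∃ ε : ℕ → ℝ, (∀ j, 0 < ε j) ∧ ∀ m, ∃ B : ℕ → ℝ, (∀ j, 0 ≤ B j) ∧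
    (∀ j t, ‖iteratedDeriv m (bumpSeq j) t‖ ≤ B j) ∧ Summable fun j => B j * ε j := by
  obtain ⟨B, hB0, hB⟩ := exists_bumpSeq_bound
  -- A diagonal choice: S j dominates the bounds of all orders m ≤ j. For fixed m the weighted bound
  -- is then at most 2⁻ʲ as soon as j ≥ m.
  let S : ℕ → ℝ := fun j => 1 + ∑ m ∈ Finset.range (j + 1), B m j
  have hS : ∀ j, 1 ≤ S j := fun j =>
    le_add_of_nonneg_right (Finset.sum_nonneg fun m _ => hB0 m j)
  refine ⟨fun j => (1 / 2 : ℝ) ^ j / S j,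
    fun j => div_pos (by positivity) (one_pos.trans_le (hS j)), fun m =>
    ⟨B m, hB0 m, hB m, ?_⟩⟩
  refine Summable.of_norm_bounded_eventually_nat (g := fun j => (1 / 2 : ℝ) ^ j)
    summable_geometric_two ?_
  filter_upwards [eventually_ge_atTop m] with j hj
  have h1 : 0 < S j := one_pos.trans_le (hS j)
  have h2 : B m j ≤ S j := by
    have := Finset.single_le_sum (f := fun m => B m j) (fun m _ => hB0 m j)
      (Finset.mem_range.2 (Nat.lt_succ_of_le hj))
    simp only [S]; linarith
  rw [Real.norm_of_nonneg (mul_nonneg (hB0 m j) (by positivity))]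
  calc B m j * ((1 / 2 : ℝ) ^ j / S j) ≤ S j * ((1 / 2 : ℝ) ^ j / S j) := by gcongr
    _ = _ := by field_simp

end Bumps

/-! ### The functional built from a bump series, and its derivatives -/

section Functional

variable {A : Type*} [AddCommGroup A] [Module ℝ A]

/-- The series `∑ⱼ ψⱼ⁽ᵐ⁾(t) pⱼ(φ)`. -/
noncomputable def bumpSeries (p : ℕ → A →ₗ[ℝ] ℂ) (m : ℕ) (t : ℝ) (φ : A) : ℂ :=
  ∑' j, ((iteratedDeriv m (bumpSeq j) t : ℝ) : ℂ) * p j φ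

/-- The functional `φ ↦ ∑ⱼ ψⱼ(ℓ(φ)) pⱼ(φ)`. -/
noncomputable def bumpFunctional (ℓ : A →ₗ[ℝ] ℝ) (p : ℕ → A →ₗ[ℝ] ℂ) (φ : A) : ℂ :=
  bumpSeries p 0 (ℓ φ) φ

/-- The derivatives of `bumpFunctional`. -/
noncomputable def bumpFunctionalDeriv (ℓ : A →ₗ[ℝ] ℝ) (p : ℕ → A →ₗ[ℝ] ℂ) (n : ℕ) (φ : A)
    (v : Fin n → A) : ℂ :=
  bumpSeries p n (ℓ φ) φ * ∏ i, (ℓ (v i) : ℂ) +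
    ∑ i, bumpSeries p (n - 1) (ℓ φ) (v i) * ∏ i', if i' = i then (1 : ℂ) else ℓ (v i')

variable [TopologicalSpace A] [IsTopologicalAddGroup A] [ContinuousSMul ℝ A]

/-- A family of functionals that is uniformly bounded by weights near zero is so near each point. -/
theorem exists_eventually_bound {ι : Type*} {p : ι → A →ₗ[ℝ] ℂ} {ε : ι → ℝ}
    (hp : ∀ᶠ h in 𝓝 (0 : A), ∀ j, ‖p j h‖ ≤ ε j) (φ : A) :
    ∃ R : ℝ, 0 ≤ R ∧ ∀ᶠ χ in 𝓝 φ, ∀ j, ‖p j χ‖ ≤ R * ε j := by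
  -- Some small multiple t • φ with t > 0 lies in the given neighbourhood of zero. Homogeneity
  -- bounds the values at φ by t⁻¹ ε j, and an increment χ - φ in that neighbourhood adds another ε
  -- j.
  have h1 : ∀ᶠ t : ℝ in 𝓝 0, ∀ j, ‖p j (t • φ)‖ ≤ ε j := by
    have : Tendsto (fun t : ℝ => t • φ) (𝓝 0) (𝓝 0) :=
      (continuous_id.smul continuous_const).tendsto' _ _ (zero_smul ℝ φ)
    exact this.eventually hp
  obtain ⟨t, ht, ht0⟩ := ((h1.filter_mono nhdsWithin_le_nhds).and
    (self_mem_nhdsWithin (s := Ioi (0 : ℝ)))).exists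
  have ht0' : 0 < t := ht0
  have h2 : ∀ j, ‖p j φ‖ ≤ t⁻¹ * ε j := by
    intro j
    have := ht j
    rw [map_smul, norm_smul, Real.norm_of_nonneg ht0'.le] at this
    rwa [inv_mul_eq_div, le_div_iff₀ ht0', mul_comm]
  refine ⟨t⁻¹ + 1, by positivity, ?_⟩
  have h3 : Tendsto (fun χ : A => χ - φ) (𝓝 φ) (𝓝 0) :=
    (continuous_id.sub continuous_const).tendsto' _ _ (sub_self φ)
  filter_upwards [h3.eventually hp] with χ hχ j
  calc ‖p j χ‖ = ‖p j φ + p j (χ - φ)‖ := by rw [← map_add]; congr 2; abel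
    _ ≤ ‖p j φ‖ + ‖p j (χ - φ)‖ := norm_add_le _ _
    _ ≤ t⁻¹ * ε j + ε j := add_le_add (h2 j) (hχ j)
    _ = _ := by ring

variable {ε : ℕ → ℝ} {p : ℕ → A →ₗ[ℝ] ℂ}

/-- The weights of `exists_bumpSeq_weight`. -/
def IsBumpWeight (ε : ℕ → ℝ) : Prop := ∀ m, ∃ B : ℕ → ℝ, (∀ j, 0 ≤ B j) ∧
    (∀ j t, ‖iteratedDeriv m (bumpSeq j) t‖ ≤ B j) ∧ Summable fun j => B j * ε j

/-- The majorant `R * (B j * ε j)` does not depend on t and is locally uniform in φ. The same bound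
therefore justifies differentiation in t and joint continuity. -/
theorem IsBumpWeight.summable_bumpSeries (hε : IsBumpWeight ε)
    (hp : ∀ᶠ h in 𝓝 (0 : A), ∀ j, ‖p j h‖ ≤ ε j) (m : ℕ) (t : ℝ) (φ : A) :
    Summable fun j => ((iteratedDeriv m (bumpSeq j) t : ℝ) : ℂ) * p j φ := by
  obtain ⟨R, hR0, hR⟩ := exists_eventually_bound hp φ
  obtain ⟨B, hB0, hB, hs⟩ := hε m
  refine Summable.of_norm_bounded (g := fun j => R * (B j * ε j)) (hs.mul_left R) fun j => ?_
  rw [norm_mul, Complex.norm_real]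
  calc _ ≤ B j * (R * ε j) := mul_le_mul (hB j t) (hR.self_of_nhds j) (norm_nonneg _) (hB0 j)
    _ = _ := by ring

theorem IsBumpWeight.bumpSeries_add (hε : IsBumpWeight ε)
    (hp : ∀ᶠ h in 𝓝 (0 : A), ∀ j, ‖p j h‖ ≤ ε j) (m : ℕ) (t : ℝ) (φ χ : A) :
    bumpSeries p m t (φ + χ) = bumpSeries p m t φ + bumpSeries p m t χ := by
  rw [bumpSeries, bumpSeries, bumpSeries, ← (hε.summable_bumpSeries hp m t φ).tsum_add
    (hε.summable_bumpSeries hp m t χ)]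
  exact tsum_congr fun j => by rw [map_add, mul_add]

theorem bumpSeries_smul (m : ℕ) (t s : ℝ) (φ : A) :
    bumpSeries p m t (s • φ) = s * bumpSeries p m t φ := by
  rw [bumpSeries, bumpSeries, ← tsum_mul_left]
  exact tsum_congr fun j => by rw [map_smul, Complex.real_smul]; ring

theorem IsBumpWeight.hasDerivAt_bumpSeries (hε : IsBumpWeight ε)
    (hp : ∀ᶠ h in 𝓝 (0 : A), ∀ j, ‖p j h‖ ≤ ε j) (m : ℕ) (t : ℝ) (φ : A) :
    HasDerivAt (fun s => bumpSeries p m s φ) (bumpSeries p (m + 1) t φ) t := by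
  obtain ⟨R, hR0, hR⟩ := exists_eventually_bound hp φ
  obtain ⟨B, hB0, hB, hs⟩ := hε (m + 1)
  let g : ℕ → ℝ → ℂ := fun j s => ((iteratedDeriv m (bumpSeq j) s : ℝ) : ℂ) * p j φ
  let g' : ℕ → ℝ → ℂ := fun j s => ((iteratedDeriv (m + 1) (bumpSeq j) s : ℝ) : ℂ) * p j φ
  have hg : ∀ j s, HasDerivAt (g j) (g' j s) s := by
    intro j s
    have h0 : Differentiable ℝ (iteratedDeriv m (bumpSeq j)) :=
      ((bumpSeq j).contDiff (n := ⊤)).differentiable_iteratedDeriv m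
        (by exact_mod_cast WithTop.coe_lt_top _)
    have h1 : HasDerivAt (iteratedDeriv m (bumpSeq j)) (iteratedDeriv (m + 1) (bumpSeq j) s) s := by
      rw [iteratedDeriv_succ]
      exact (h0 s).hasDerivAt
    exact h1.ofReal_comp.mul_const _
  have hg' : ∀ j s, ‖g' j s‖ ≤ R * (B j * ε j) := by
    intro j s
    rw [norm_mul, Complex.norm_real]
    calc _ ≤ B j * (R * ε j) := mul_le_mul (hB j s) (hR.self_of_nhds j) (norm_nonneg _) (hB0 j)
      _ = _ := by ring
  exact hasDerivAt_tsum (hs.mul_left R) hg hg' (y₀ := t) (hε.summable_bumpSeries hp m t φ) t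

theorem IsBumpWeight.continuous_bumpSeries (hε : IsBumpWeight ε)
    (hp : ∀ᶠ h in 𝓝 (0 : A), ∀ j, ‖p j h‖ ≤ ε j) (m : ℕ) :
    Continuous fun q : ℝ × A => bumpSeries p m q.1 q.2 := by
  refine continuous_iff_continuousAt.2 fun q => ?_
  obtain ⟨R, hR0, hR⟩ := exists_eventually_bound hp q.2
  obtain ⟨B, hB0, hB, hs⟩ := hε m
  have hpc : ∀ j, Continuous (p j) := fun j =>
    continuous_of_bounded_nhds (p j) (C := ε j) (hp.mono fun h hh => hh j)
  have hmem : {r : ℝ × A | ∀ j, ‖p j r.2‖ ≤ R * ε j} ∈ 𝓝 q :=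
    continuousAt_snd.eventually hR
  refine ContinuousOn.continuousAt (continuousOn_tsum (u := fun j => R * (B j * ε j))
    (fun j => ?_) (hs.mul_left R) fun j r hr => ?_) hmem
  · have hc : Continuous (iteratedDeriv m (bumpSeq j)) :=
      ((bumpSeq j).contDiff (n := ⊤)).continuous_iteratedDeriv m (by exact_mod_cast le_top)
    exact ((Complex.continuous_ofReal.comp (hc.comp continuous_fst)).mul
      ((hpc j).comp continuous_snd)).continuousOn
  · rw [norm_mul, Complex.norm_real]
    calc _ ≤ B j * (R * ε j) := mul_le_mul (hB j r.1) (hr j) (norm_nonneg _) (hB0 j)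
      _ = _ := by ring

variable {ℓ : A →ₗ[ℝ] ℝ}

/-- Each p j is linear, so a new direction either falls on the bump, raising its order by one and
producing a factor ℓ χ, or replaces the argument φ of p j. The latter can happen only once. -/
theorem IsBumpWeight.hasDerivAt_bumpFunctionalDeriv (hε : IsBumpWeight ε)
    (hp : ∀ᶠ h in 𝓝 (0 : A), ∀ j, ‖p j h‖ ≤ ε j) (n : ℕ) (φ χ : A) (v : Fin n → A) :
    HasLineDerivAt ℝ (fun ψ => bumpFunctionalDeriv ℓ p n ψ v)
      (bumpFunctionalDeriv ℓ p (n + 1) φ (Fin.snoc v χ)) φ χ := by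
  have hℓ : HasDerivAt (fun s : ℝ => ℓ (φ + s • χ)) (ℓ χ) 0 := by
    have h : (fun s : ℝ => ℓ (φ + s • χ)) = fun s => ℓ φ + s * ℓ χ := by
      ext s; rw [map_add, map_smul, smul_eq_mul]
    rw [h]
    simpa using ((hasDerivAt_id (0 : ℝ)).mul_const (ℓ χ)).const_add (ℓ φ)
  have h0 : ℓ (φ + (0 : ℝ) • χ) = ℓ φ := by rw [zero_smul, add_zero]
  have h1 : ∀ m w, HasDerivAt (fun s : ℝ => bumpSeries p m (ℓ (φ + s • χ)) w)
      (bumpSeries p (m + 1) (ℓ φ) w * ℓ χ) 0 := by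
    intro m w
    have := hε.hasDerivAt_bumpSeries hp m (ℓ φ) w
    rw [← h0] at this
    have h2 := this.scomp (0 : ℝ) hℓ
    rw [h0, Complex.real_smul, mul_comm] at h2
    exact h2
  have h2 : HasDerivAt (fun s : ℝ => bumpSeries p n (ℓ (φ + s • χ)) (φ + s • χ))
      (bumpSeries p (n + 1) (ℓ φ) φ * ℓ χ + bumpSeries p n (ℓ φ) χ) 0 := by
    -- Additivity in the last argument leaves s only in the bump variable and as a scalar factor.
    have h3 : (fun s : ℝ => bumpSeries p n (ℓ (φ + s • χ)) (φ + s • χ)) = fun s : ℝ =>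
        bumpSeries p n (ℓ (φ + s • χ)) φ + (s : ℂ) * bumpSeries p n (ℓ (φ + s • χ)) χ := by
      ext s
      rw [hε.bumpSeries_add hp, bumpSeries_smul]
    rw [h3]
    have h4 := (h1 n φ).add ((Complex.ofRealCLM.hasDerivAt (x := (0 : ℝ))).mul (h1 n χ))
    refine h4.congr_deriv ?_
    rw [h0]
    simp
  have h5 : ∀ i : Fin n, HasDerivAt
      (fun s : ℝ => bumpSeries p (n - 1) (ℓ (φ + s • χ)) (v i))
      (bumpSeries p n (ℓ φ) (v i) * ℓ χ) 0 := by
    intro i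
    have := h1 (n - 1) (v i)
    -- An index i exists only for n ≥ 1; for n = 0 the sum is empty and the truncated n - 1 plays no
    -- role.
    rwa [Nat.sub_add_cancel (Nat.one_le_of_lt i.pos)] at this
  have h6 := (h2.mul_const (∏ i, (ℓ (v i) : ℂ))).add (HasDerivAt.fun_sum (u := Finset.univ)
    fun i _ => (h5 i).mul_const (∏ i', if i' = i then (1 : ℂ) else ℓ (v i')))
  refine h6.congr_deriv ?_
  simp only [bumpFunctionalDeriv, Fin.prod_univ_castSucc, Fin.sum_univ_castSucc, Fin.snoc_castSucc,
    Fin.snoc_last, Nat.add_sub_cancel, Fin.castSucc_inj, Fin.castSucc_ne_last,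
    (Fin.castSucc_ne_last _).symm, if_true, if_false]
  have h7 : ∑ i, bumpSeries p n (ℓ φ) (v i) * ℓ χ * (∏ i', if i' = i then (1 : ℂ) else ℓ (v i')) =
      ∑ i, bumpSeries p n (ℓ φ) (v i) * ((∏ i', if i' = i then (1 : ℂ) else ℓ (v i')) * ℓ χ) :=
    Finset.sum_congr rfl fun i _ => by ring
  rw [h7]
  ring

theorem IsBumpWeight.dirDeriv_bumpFunctional (hε : IsBumpWeight ε)
    (hp : ∀ᶠ h in 𝓝 (0 : A), ∀ j, ‖p j h‖ ≤ ε j) (n : ℕ) (φ : A) (v : Fin n → A) :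
    dirDeriv (bumpFunctional ℓ p) n φ v = bumpFunctionalDeriv ℓ p n φ v := by
  induction n generalizing φ with
  | zero => simp [dirDeriv, bumpFunctional, bumpFunctionalDeriv]
  | succ n ih =>
    have h1 : (fun χ => dirDeriv (bumpFunctional ℓ p) n χ (Fin.init v)) =
        fun χ => bumpFunctionalDeriv ℓ p n χ (Fin.init v) := funext fun χ => ih χ _
    rw [dirDeriv, h1]
    have h2 := (hε.hasDerivAt_bumpFunctionalDeriv (ℓ := ℓ) hp n φ (v (Fin.last n))
      (Fin.init v)).lineDeriv
    rw [h2, Fin.snoc_init_self]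

theorem IsBumpWeight.isBastianiSmooth_bumpFunctional (hε : IsBumpWeight ε)
    (hp : ∀ᶠ h in 𝓝 (0 : A), ∀ j, ‖p j h‖ ≤ ε j) (hℓ : Continuous ℓ) :
    IsBastianiSmooth (bumpFunctional ℓ p) := by
  intro n
  refine ⟨fun φ v χ => ?_, ?_⟩
  · simp only [hε.dirDeriv_bumpFunctional hp]
    exact (hε.hasDerivAt_bumpFunctionalDeriv hp n φ χ v).lineDifferentiableAt
  · simp only [hε.dirDeriv_bumpFunctional hp, bumpFunctionalDeriv]
    have h1 : ∀ m, ∀ w : A × (Fin n → A) → A, Continuous w →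
        Continuous fun q : A × (Fin n → A) => bumpSeries p m (ℓ q.1) (w q) := fun m w hw =>
      (hε.continuous_bumpSeries hp m).comp ((hℓ.comp continuous_fst).prodMk hw)
    have h2 : ∀ i, Continuous fun q : A × (Fin n → A) => (ℓ (q.2 i) : ℂ) := fun i =>
      Complex.continuous_ofReal.comp (hℓ.comp ((continuous_apply i).comp continuous_snd))
    refine ((h1 n _ continuous_fst).mul (continuous_finsetProd _ fun i _ => h2 i)).add
      (continuous_finsetSum _ fun i _ => (h1 _ _ ((continuous_apply i).comp continuous_snd)).mul
        (continuous_finsetProd _ fun i' _ => ?_))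
    split_ifs
    · exact continuous_const
    · exact h2 i'

end Functional

/-! ### Regular functionals with prescribed gradients -/

section Regular

/-- Disjointness of the supports leaves a single summand at each t. The derivatives thus have test
function kernels even though the series is infinite. -/
theorem bumpSeries_eq_of_mem {A : Type*} [AddCommGroup A] [Module ℝ A] (p : ℕ → A →ₗ[ℝ] ℂ)
    (m : ℕ) {t : ℝ} {j : ℕ} (h : t ∈ tsupport (bumpSeq j)) (φ : A) :
    bumpSeries p m t φ = ((iteratedDeriv m (bumpSeq j) t : ℝ) : ℂ) * p j φ := by
  refine tsum_eq_single j fun i hi => ?_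
  rw [iteratedDeriv_bumpSeq_eq_zero m fun h' => hi (tsupport_bumpSeq_inj h' h)]
  simp

theorem bumpSeries_eq_zero {A : Type*} [AddCommGroup A] [Module ℝ A] (p : ℕ → A →ₗ[ℝ] ℂ)
    (m : ℕ) {t : ℝ} (h : ∀ j, t ∉ tsupport (bumpSeq j)) (φ : A) :
    bumpSeries p m t φ = 0 := by
  rw [bumpSeries]
  simp [iteratedDeriv_bumpSeq_eq_zero m (h _)]

variable {d : ℕ} {M : Type*} [TopologicalSpace M] [ChartedSpace (EuclideanSpace ℝ (Fin d)) M]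
  [MeasurableSpace M] [BorelSpace M] [T2Space M] [SecondCountableTopology M]
  [IsManifold (𝓡 d) ∞ M] {μ : Measure M} [IsLocallyFiniteMeasure μ]

theorem gradient_eq_of_isGradient (hμ : IsSmoothVolume d μ) {F : Config (d := d) M → ℂ}
    {φ : Config (d := d) M} {f : TestFun (𝓡 d) M} (hf : IsGradient μ F φ f) :
    gradient μ F φ = f := by
  have : LocallyCompactSpace M := ChartedSpace.locallyCompactSpace (EuclideanSpace ℝ (Fin d)) M
  have := hμ.isOpenPosMeasure
  have key : ∃ f, IsGradient μ F φ f := ⟨f, hf⟩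
  rw [gradient, dif_pos key]
  refine TestFun.eq_of_pairing_eq (μ := μ) _ _ fun h => ?_
  exact (key.choose_spec h).symm.trans (hf h)

theorem isClosed_spacetimeSupport (F : Config (d := d) M → ℂ) : IsClosed (spacetimeSupport F) := by
  rw [← isOpen_compl_iff, spacetimeSupport, compl_compl, isOpen_iff_mem_nhds]
  rintro x ⟨U, hU, hx, h⟩
  filter_upwards [hU.mem_nhds hx] with y hy using ⟨U, hU, hy, h⟩

theorem integral_sum_tensorPow_mul [SigmaFinite μ] {n : ℕ} {ι : Type*} (s : Finset ι)
    (c : ι → ℂ) (f : ι → Fin n → TestFun (𝓡 d) M) (h : Fin n → Config (d := d) M) :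
    ∫ x, (∑ a ∈ s, c a • tensorPow (f a) : TestFunPow (d := d) M n).1 x * ∏ i, (h i (x i) : ℂ)
      ∂(Measure.pi fun _ => μ) = ∑ a ∈ s, c a * ∏ i, pairing μ (f a i) (h i) := by
  have hpt : ∀ y : Fin n → M, (∑ a ∈ s, c a • tensorPow (f a) : TestFunPow (d := d) M n).1 y *
      ∏ i, (h i (y i) : ℂ) = ∑ a ∈ s, c a * ∏ i, ((f a i).1 (y i) * (h i (y i) : ℂ)) := by
    intro y
    have h1 : (∑ a ∈ s, c a • tensorPow (f a) : TestFunPow (d := d) M n).1 y =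
        ∑ a ∈ s, c a * ∏ i, (f a i).1 (y i) := by
      rw [AddSubmonoidClass.coe_finsetSum, Finset.sum_apply]
      rfl
    rw [h1, Finset.sum_mul]
    refine Finset.sum_congr rfl fun a _ => ?_
    rw [mul_assoc, ← Finset.prod_mul_distrib]
  have hint : ∀ a i, Integrable (fun z => (f a i).1 z * (h i z : ℂ)) μ := fun a i =>
    integrable_testFun_mul _ (Complex.continuous_ofReal.comp (Config.continuous (h i)))
  simp only [hpt]
  rw [integral_finsetSum]
  · refine Finset.sum_congr rfl fun a _ => ?_
    rw [integral_const_mul]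
    congr 1
    exact integral_fintype_prod_eq_prod (μ := fun _ => μ) fun i z =>
      (f a i).1 z * (h i z : ℂ)
  · intro a _
    exact Integrable.const_mul (Integrable.fintype_prod (μ := fun _ => μ) (f := fun i z =>
      (f a i).1 z * (h i z : ℂ)) fun i => hint a i) _

/-- A smooth, compactly supported functional whose derivatives are finite sums of tensor products
of test functions is regular, and microcausal with respect to every set of covectors. -/
theorem isRegular_and_isMicrocausal_of_tensor [SigmaFinite μ] (hμ : IsSmoothVolume d μ)
    {F : Config (d := d) M → ℂ} (hF : IsBastianiSmooth F) (hK : IsCompact (spacetimeSupport F))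
    (h : ∀ (n : ℕ) (φ : Config (d := d) M), ∃ (ι : Type) (s : Finset ι) (c : ι → ℂ)
      (f : ι → Fin n → TestFun (𝓡 d) M), ∀ v, dirDeriv F n φ v =
        ∑ a ∈ s, c a * ∏ i, pairing μ (f a i) (v i)) :
    IsRegularFunctional μ F ∧ ∀ 𝒱 : Set (Covectors (𝓡 d) M), IsMicrocausal 𝒱 F := by
  refine ⟨⟨hF, hK, fun n φ => ?_⟩, fun 𝒱 => ⟨hF, fun n φ => ?_⟩⟩
  · obtain ⟨ι, s, c, f, hf⟩ := h n φ
    exact ⟨∑ a ∈ s, c a • tensorPow (f a), fun v =>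
      (hf v).trans (integral_sum_tensorPow_mul s c f v).symm⟩
  · obtain ⟨ι, s, c, f, hf⟩ := h n φ
    refine ⟨kernelDistr μ (∑ a ∈ s, c a • tensorPow (f a)), fun v w hw => ?_, ?_⟩
    · rw [hf v, ← integral_sum_tensorPow_mul s c f v, kernelDistr_apply]
      simp only [hw]
    · rw [WF_kernelDistr_sum_tensorPow μ hμ, empty_inter]

/-- Real part of the pairing with a test function. -/
noncomputable def realPairing (μ : Measure M) [IsLocallyFiniteMeasure μ] (b : TestFun (𝓡 d) M) :
    Config (d := d) M →ₗ[ℝ] ℝ := Complex.reLm.comp (pairing μ b)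

theorem ofReal_realPairing {b : TestFun (𝓡 d) M} (hb : ∀ y, ∃ r : ℝ, 0 ≤ r ∧ b.1 y = r)
    (h : Config (d := d) M) : (realPairing μ b h : ℂ) = pairing μ b h := by
  choose r _ hr using hb
  have : pairing μ b h = ((∫ x, r x * h x ∂μ : ℝ) : ℂ) := by
    rw [← integral_complex_ofReal, pairing_apply]
    refine integral_congr_ae (ae_of_all _ fun x => ?_)
    simp [hr]
  change ((pairing μ b h).re : ℂ) = _
  rw [this, Complex.ofReal_re]

/-- A constant configuration serves: b is non-negative and not zero, so its integral is positive. -/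
theorem exists_realPairing_eq_one [μ.IsOpenPosMeasure] {b : TestFun (𝓡 d) M}
    (hb : ∀ y, ∃ r : ℝ, 0 ≤ r ∧ b.1 y = r) {x₀ : M} (hx₀ : b.1 x₀ ≠ 0) :
    ∃ φ₀ : Config (d := d) M, realPairing μ b φ₀ = 1 := by
  choose r hr0 hr using hb
  let one : Config (d := d) M := ⟨fun _ => 1, contMDiff_const⟩
  have hrr : r = fun y => (b.1 y).re := by ext y; rw [hr, Complex.ofReal_re]
  have hrc : Continuous r := by
    rw [hrr]; exact Complex.continuous_re.comp (continuous_testFun b)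
  have hrs : HasCompactSupport r := by
    rw [hrr]; exact b.2.2.comp_left (g := Complex.re) rfl
  have h1 : realPairing μ b one = ∫ x, r x ∂μ := by
    have : (realPairing μ b one : ℂ) = ((∫ x, r x ∂μ : ℝ) : ℂ) := by
      rw [ofReal_realPairing (fun y => ⟨r y, hr0 y, hr y⟩), ← integral_complex_ofReal,
        pairing_apply]
      refine integral_congr_ae (ae_of_all _ fun x => ?_)
      simp [hr, one]
    exact_mod_cast this
  have h2 : 0 < ∫ x, r x ∂μ := by
    refine hrc.integral_pos_of_hasCompactSupport_nonneg_nonzero hrs hr0 (x := x₀) fun h0 => hx₀ ?_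
    rw [hr, h0, Complex.ofReal_zero]
  refine ⟨(∫ x, r x ∂μ)⁻¹ • one, ?_⟩
  rw [map_smul, h1, smul_eq_mul, inv_mul_cancel₀ h2.ne']

variable {b : TestFun (𝓡 d) M} {f : ℕ → TestFun (𝓡 d) M} {ε : ℕ → ℝ}

theorem bumpFunctional_regular [SigmaFinite μ] (hμ : IsSmoothVolume d μ)
    (hb : ∀ y, ∃ r : ℝ, 0 ≤ r ∧ b.1 y = r) {K : Set M} (hK : IsCompact K)
    (hfK : ∀ j, ∀ x ∉ K, (f j).1 x = 0) (hε : IsBumpWeight ε)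
    (hp : ∀ᶠ h : Config (d := d) M in 𝓝 0, ∀ j, ‖pairing μ (f j) h‖ ≤ ε j) :
    IsRegularFunctional μ (bumpFunctional (realPairing μ b) fun j => pairing μ (f j)) ∧
      ∀ 𝒱 : Set (Covectors (𝓡 d) M),
        IsMicrocausal 𝒱 (bumpFunctional (realPairing μ b) fun j => pairing μ (f j)) := by
  have : LocallyCompactSpace M := ChartedSpace.locallyCompactSpace (EuclideanSpace ℝ (Fin d)) M
  have hℓ : Continuous (realPairing μ b) := Complex.continuous_re.comp (continuous_pairing b)
  refine isRegular_and_isMicrocausal_of_tensor hμ (hε.isBastianiSmooth_bumpFunctional hp hℓ) ?_ ?_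
  · refine (hK.union b.2.2.isCompact).of_isClosed_subset (isClosed_spacetimeSupport _) ?_
    rw [← compl_subset_compl, spacetimeSupport, compl_compl]
    intro x hx
    refine ⟨(K ∪ tsupport b.1)ᶜ, (hK.union b.2.2.isCompact).isClosed.isOpen_compl, hx,
      fun φ ψ h => ?_⟩
    rw [compl_compl] at h
    have h1 : ∀ g : TestFun (𝓡 d) M, (∀ x ∉ K ∪ tsupport b.1, g.1 x = 0) →
        pairing μ g φ = pairing μ g ψ := by
      intro g hg
      refine integral_congr_ae (ae_of_all _ fun x => ?_)
      by_cases hx : x ∈ K ∪ tsupport b.1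
      · simp only [h x hx]
      · simp only [hg x hx, zero_mul]
    have h2 : realPairing μ b φ = realPairing μ b ψ := congrArg Complex.re
      (h1 b fun x hx => image_eq_zero_of_notMem_tsupport fun h' => hx (Or.inr h'))
    rw [bumpFunctional, bumpFunctional, h2, bumpSeries, bumpSeries]
    exact tsum_congr fun j => by rw [h1 (f j) fun x hx => hfK j x fun h' => hx (Or.inl h')]
  · intro n φ
    -- For fixed φ at most one bump is active, so the series in v is the pairing with one multiple
    -- of some f j.
    have hS : ∃ g : TestFun (𝓡 d) M, ∀ v, bumpSeries (fun j => pairing μ (f j)) (n - 1)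
        (realPairing μ b φ) v = pairing μ g v := by
      by_cases h : ∃ j, realPairing μ b φ ∈ tsupport (bumpSeq j)
      · obtain ⟨j, hj⟩ := h
        exact ⟨((iteratedDeriv (n - 1) (bumpSeq j) (realPairing μ b φ) : ℝ) : ℂ) • f j, fun v => by
          rw [bumpSeries_eq_of_mem _ _ hj, pairing_smul_left]⟩
      · push Not at h
        exact ⟨0, fun v => by rw [bumpSeries_eq_zero _ _ h, pairing_zero_left]⟩
    obtain ⟨g, hg⟩ := hS
    -- `none` stands for the term with b in every slot, `some i` for the term with g in slot i and b
    -- in the others.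
    refine ⟨Option (Fin n), Finset.univ, fun a => a.elim (bumpSeries (fun j => pairing μ (f j)) n
      (realPairing μ b φ) φ) fun _ => 1, fun a i' => a.elim b fun i => if i' = i then g else b,
      fun v => ?_⟩
    rw [hε.dirDeriv_bumpFunctional hp, bumpFunctionalDeriv, Fintype.sum_option]
    simp only [ofReal_realPairing hb, Option.elim_none, Option.elim_some, one_mul, hg]
    congr 1
    refine Finset.sum_congr rfl fun i _ => ?_
    rw [← Finset.mul_prod_erase Finset.univ (fun i' => pairing μ (if i' = i then g else b) (v i'))
      (Finset.mem_univ i), ← Finset.mul_prod_erase Finset.univ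
        (fun i' => if i' = i then (1 : ℂ) else pairing μ b (v i')) (Finset.mem_univ i)]
    simp only [if_true, one_mul]
    congr 1
    refine Finset.prod_congr rfl fun i' hi' => ?_
    rw [if_neg (Finset.ne_of_mem_erase hi'), if_neg (Finset.ne_of_mem_erase hi')]

theorem dirDeriv_one_bumpFunctional (hε : IsBumpWeight ε)
    (hp : ∀ᶠ h : Config (d := d) M in 𝓝 0, ∀ j, ‖pairing μ (f j) h‖ ≤ ε j)
    (φ h : Config (d := d) M) :
    dirDeriv (bumpFunctional (realPairing μ b) fun j => pairing μ (f j)) 1 φ (fun _ => h) =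
      bumpSeries (fun j => pairing μ (f j)) 1 (realPairing μ b φ) φ * realPairing μ b h +
        bumpSeries (fun j => pairing μ (f j)) 0 (realPairing μ b φ) h := by
  rw [hε.dirDeriv_bumpFunctional hp, bumpFunctionalDeriv]
  simp

theorem gradient_bumpFunctional_zero (hμ : IsSmoothVolume d μ) (hε : IsBumpWeight ε)
    (hp : ∀ᶠ h : Config (d := d) M in 𝓝 0, ∀ j, ‖pairing μ (f j) h‖ ≤ ε j) :
    gradient μ (bumpFunctional (realPairing μ b) fun j => pairing μ (f j)) 0 = 0 := by
  refine gradient_eq_of_isGradient hμ fun h => ?_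
  rw [dirDeriv_one_bumpFunctional hε hp, map_zero,
    bumpSeries_eq_zero _ _ zero_notMem_tsupport_bumpSeq,
    bumpSeries_eq_zero _ _ zero_notMem_tsupport_bumpSeq, zero_mul, zero_add]
  exact (pairing_zero_left h).symm

/-- At this configuration ℓ takes the value 2⁻ʲ, the centre of the j-th bump, which has value one
and derivative zero there. -/
theorem gradient_bumpFunctional (hμ : IsSmoothVolume d μ) (hε : IsBumpWeight ε)
    (hp : ∀ᶠ h : Config (d := d) M in 𝓝 0, ∀ j, ‖pairing μ (f j) h‖ ≤ ε j)
    {φ₀ : Config (d := d) M} (hφ₀ : realPairing μ b φ₀ = 1) (j : ℕ) :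
    gradient μ (bumpFunctional (realPairing μ b) fun j => pairing μ (f j))
      ((1 / 2 : ℝ) ^ j • φ₀) = f j := by
  refine gradient_eq_of_isGradient hμ fun h => ?_
  rw [dirDeriv_one_bumpFunctional hε hp, map_smul, hφ₀, smul_eq_mul, mul_one,
    bumpSeries_eq_of_mem _ _ (pow_mem_tsupport_bumpSeq j),
    bumpSeries_eq_of_mem _ _ (pow_mem_tsupport_bumpSeq j), iteratedDeriv_one_bumpSeq_pow,
    iteratedDeriv_zero, bumpSeq_pow]
  simp [pairing_apply]

end Regular

/-! ### Plane waves and polynomial bounds on localized Fourier transforms -/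

section Osc

variable {E : Type*} [NormedAddCommGroup E] [NormedSpace ℝ E]

/-- The plane wave `y ↦ exp(i ⟨η, y⟩)`. -/
noncomputable def osc (η : E →L[ℝ] ℝ) (y : E) : ℂ := Complex.exp (Complex.I * (η y : ℂ))

theorem contDiff_osc (η : E →L[ℝ] ℝ) : ContDiff ℝ ∞ (osc η) := by
  have : ContDiff ℝ ∞ (fun e : E => (η e : ℂ)) := Complex.ofRealCLM.contDiff.comp η.contDiff
  unfold osc
  fun_prop

theorem osc_add (η ζ : E →L[ℝ] ℝ) (y : E) : osc (η + ζ) y = osc η y * osc ζ y := by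
  rw [osc, osc, osc, ← Complex.exp_add, ← mul_add, ← Complex.ofReal_add]
  rfl

theorem norm_osc (η : E →L[ℝ] ℝ) (y : E) : ‖osc η y‖ = 1 := by
  rw [osc, mul_comm, Complex.norm_exp_ofReal_mul_I]

theorem norm_iteratedFDeriv_osc_le (η : E →L[ℝ] ℝ) (j : ℕ) (y : E) :
    ‖iteratedFDeriv ℝ j (osc η) y‖ ≤ ‖η‖ ^ j := by
  let g : ℝ → ℂ := fun t => Complex.exp (Complex.I * t)
  have hg : ∀ j t, iteratedDeriv j g t = Complex.I ^ j * g t := by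
    intro j
    induction j with
    | zero => intro t; simp
    | succ j ih =>
      intro t
      rw [iteratedDeriv_succ, funext ih]
      have h1 : HasDerivAt g (g t * (Complex.I * 1)) t :=
        ((Complex.ofRealCLM.hasDerivAt (x := t)).const_mul Complex.I).cexp
      rw [(h1.const_mul (Complex.I ^ j)).deriv]
      ring
  have hgc : ContDiff ℝ ∞ g := by
    have : ContDiff ℝ ∞ (fun e : ℝ => (e : ℂ)) := Complex.ofRealCLM.contDiff
    fun_prop
  have h : osc η = g ∘ η := rfl
  rw [h, ContinuousLinearMap.iteratedFDeriv_comp_right η hgc y (by exact_mod_cast le_top)]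
  refine (ContinuousMultilinearMap.norm_compContinuousLinearMap_le _ _).trans ?_
  have h1 : ‖g (η y)‖ = 1 := by
    simp only [g]; rw [mul_comm, Complex.norm_exp_ofReal_mul_I]
  rw [norm_iteratedFDeriv_eq_norm_iteratedDeriv, hg, norm_mul, norm_pow, Complex.norm_I, one_pow,
    h1, one_mul, one_mul, Finset.prod_const, Finset.card_fin]

variable {H : Type*} [TopologicalSpace H] {I : ModelWithCorners ℝ E H} [I.Boundaryless]
  {N : Type*} [TopologicalSpace N] [ChartedSpace H N] [IsManifold I ∞ N] [T2Space N]

theorem modulate_eq_mulChart (p : N) (χ : TestFun I N)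
    (hχ : tsupport (χ : N → ℂ) ⊆ (chartAt H p).source) (η : E →L[ℝ] ℝ) :
    modulate p χ hχ η = mulChart p χ hχ (contDiff_osc (-η)) := by
  refine Subtype.ext (funext fun y => ?_)
  simp [modulate, mulChart, osc]

/-- Order bound for a distribution applied to a test function times a function of the
coordinates. -/
theorem Distr.exists_mulChart_bound (u : Distr I N) (p : N) (χ : TestFun I N)
    (hχ : tsupport (χ : N → ℂ) ⊆ (chartAt H p).source) :
    ∃ m : ℕ, ∃ C : ℝ, 0 ≤ C ∧ ∀ (a : E → ℂ) (ha : ContDiff ℝ ∞ a) (B : ℝ), 0 ≤ B →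
      (∀ j ≤ m, ∀ y, ‖iteratedFDeriv ℝ j a y‖ ≤ B) → ‖u (mulChart p χ hχ ha)‖ ≤ C * B := by
  have hK : IsCompact (tsupport χ.1) := χ.2.2.isCompact
  obtain ⟨m, C, hC0, hC⟩ := u.exists_order_bound hK hχ
  have hKi := isCompact_extChartAt_image (I := I) hK hχ
  have hKt : ∀ y ∈ extChartAt I p '' tsupport χ.1, y ∈ (extChartAt I p).target :=
    fun y hy => mem_extChartAt_target_of_mem_image hχ hy
  obtain ⟨A, hA1, hA⟩ := exists_bound_iteratedFDeriv_of_isCompact (isOpen_extChartAt_target p)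
    (contDiffOn_comp_extChartAt_symm χ.2.1 p) hKi hKt m
  refine ⟨m, C * (2 ^ m * A), by positivity, fun a ha B hB haB => ?_⟩
  have h1 := hC (mulChart p χ hχ ha) (fun x hx => by
    rw [mulChart_apply, image_eq_zero_of_notMem_tsupport hx, zero_mul]) (2 ^ m * (A * B))
    (by positivity) fun j hj y hy => ?_
  · refine h1.trans (le_of_eq ?_)
    ring
  · have hyt := hKt y hy
    have heq : (mulChart p χ hχ ha).1 ∘ (extChartAt I p).symm =ᶠ[𝓝 y]
        fun z => (χ.1 ∘ (extChartAt I p).symm) z • a z := by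
      filter_upwards [(isOpen_extChartAt_target p).mem_nhds hyt] with z hz
      simp only [Function.comp_apply, mulChart_apply, (extChartAt I p).right_inv hz, smul_eq_mul]
    rw [(heq.iteratedFDeriv ℝ j).eq_of_nhds]
    refine (norm_iteratedFDeriv_smul_le_of_bounds (isOpen_extChartAt_target p)
      (contDiffOn_comp_extChartAt_symm χ.2.1 p) ha.contDiffOn hyt (by positivity)
      (fun i hi => hA i (hi.trans hj) y hy) fun i hi => haB i (hi.trans hj) y).trans ?_
    gcongr
    exact one_le_two

/-- The Fourier transform of a localized distribution is polynomially bounded. -/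
theorem Distr.exists_modulate_bound (u : Distr I N) (p : N) (χ : TestFun I N)
    (hχ : tsupport (χ : N → ℂ) ⊆ (chartAt H p).source) :
    ∃ m : ℕ, ∃ C : ℝ, 0 ≤ C ∧ ∀ η : E →L[ℝ] ℝ, ‖u (modulate p χ hχ η)‖ ≤ C * (1 + ‖η‖) ^ m := by
  obtain ⟨m, C, hC0, hC⟩ := u.exists_mulChart_bound p χ hχ
  refine ⟨m, C, hC0, fun η => ?_⟩
  rw [modulate_eq_mulChart]
  refine hC _ _ _ (by positivity) fun j hj y => (norm_iteratedFDeriv_osc_le _ j y).trans ?_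
  rw [norm_neg]
  calc ‖η‖ ^ j ≤ (1 + ‖η‖) ^ j := by gcongr; linarith
    _ ≤ (1 + ‖η‖) ^ m := by gcongr; linarith [norm_nonneg η]

end Osc

/-! ### Discontinuous brackets from a non-empty wavefront set -/

section Discontinuity

/-- Here β is the component of large frequency. The amplitude a j is as large as a bound without
decay permits, and b j then brings the product with V up to one. Since k + 1 powers of decay are
available in β and only k are spent, one spare power of 1 + ‖β j‖ absorbs the constants and the
factor ε j⁻². -/
theorem exists_amplitudes {D : Type*} [SeminormedAddGroup D] {V : D → D → ℝ} {k : ℕ}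
    (h : ∀ T : ℝ, ∃ α β, T ≤ 1 + ‖β‖ ∧ 1 ≤ 2 ^ k * (1 + ‖β‖) ^ k * V α β) {ε : ℕ → ℝ}
    (hε : ∀ j, 0 < ε j) {C₁ C₂ : ℝ} (hC₁ : 0 < C₁) :
    ∃ (α β : ℕ → D) (a b : ℕ → ℝ), ∀ j, 0 ≤ a j ∧ 0 ≤ b j ∧ a j * C₁ ≤ ε j ∧
      b j * C₂ ≤ ε j * (1 + ‖β j‖) ^ (k + 1) ∧ 1 ≤ a j * b j * V (α j) (β j) := by
  -- This threshold is exactly what the bound on b j requires.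
  choose α β hT hV using fun j => h (2 ^ k * C₁ * C₂ / ε j ^ 2)
  have hpos : ∀ j, 0 < 1 + ‖β j‖ := fun j => by positivity
  refine ⟨α, β, fun j => ε j / C₁, fun j => 2 ^ k * (1 + ‖β j‖) ^ k * C₁ / ε j, fun j => ?_⟩
  have := hε j
  refine ⟨by positivity, by positivity, ?_, ?_, ?_⟩
  · rw [div_mul_cancel₀ _ hC₁.ne']
  · have h1 := hT j
    rw [div_le_iff₀ (by positivity)] at h1
    rw [div_mul_eq_mul_div, div_le_iff₀ this]
    calc 2 ^ k * (1 + ‖β j‖) ^ k * C₁ * C₂ = (1 + ‖β j‖) ^ k * (2 ^ k * C₁ * C₂) := by ring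
      _ ≤ (1 + ‖β j‖) ^ k * ((1 + ‖β j‖) * ε j ^ 2) := by gcongr
      _ = _ := by ring
  · have h2 : ε j / C₁ * (2 ^ k * (1 + ‖β j‖) ^ k * C₁ / ε j) = 2 ^ k * (1 + ‖β j‖) ^ k := by
      field_simp
    rw [h2]
    exact hV j

variable {d : ℕ} {M : Type*} [TopologicalSpace M] [ChartedSpace (EuclideanSpace ℝ (Fin d)) M]
  [MeasurableSpace M] [BorelSpace M] [T2Space M] [SecondCountableTopology M]
  [IsManifold (𝓡 d) ∞ M] {μ : Measure M} [IsLocallyFiniteMeasure μ]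

theorem tensor_smul_smul (a b : ℂ) (f g : TestFun (𝓡 d) M) :
    tensor (a • f) (b • g) = (a * b) • tensor f g := by
  refine Subtype.ext (funext fun y => ?_)
  change a * f.1 y.1 * (b * g.1 y.2) = a * b * (f.1 y.1 * g.1 y.2)
  ring

theorem tensor_zero_left (g : TestFun (𝓡 d) M) : tensor 0 g = 0 := by
  refine Subtype.ext (funext fun y => ?_)
  change 0 * g.1 y.2 = 0
  rw [zero_mul]

/-- If `W(fⱼ ⊗ gⱼ)` is bounded below for rapidly vanishing sequences of densities `fⱼ`, `gⱼ`, the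
bracket of the associated regular functionals is discontinuous. -/
theorem exists_discontinuous_of_sequences (hμ : IsSmoothVolume d μ) (W : Bidistr (d := d) M)
    (x₀ : M) {f g : ℕ → TestFun (𝓡 d) M} {K L : Set M} (hK : IsCompact K) (hL : IsCompact L)
    (hfK : ∀ j, ∀ x ∉ K, (f j).1 x = 0) (hgL : ∀ j, ∀ x ∉ L, (g j).1 x = 0) {ε : ℕ → ℝ}
    (hε : IsBumpWeight ε)
    (hf : ∀ᶠ h : Config (d := d) M in 𝓝 0, ∀ j, ‖pairing μ (f j) h‖ ≤ ε j)
    (hg : ∀ᶠ h : Config (d := d) M in 𝓝 0, ∀ j, ‖pairing μ (g j) h‖ ≤ ε j)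
    (hW : ∀ j, 1 ≤ ‖W (tensor (f j) (g j))‖) :
    ∃ F G : Config (d := d) M → ℂ,
      IsRegularFunctional μ F ∧ IsRegularFunctional μ G ∧ ¬ Continuous (bracket μ W F G) ∧
      ∀ 𝒱 : Set (Covectors (𝓡 d) M), IsMicrocausal 𝒱 F ∧ IsMicrocausal 𝒱 G := by
  have : LocallyCompactSpace M := ChartedSpace.locallyCompactSpace (EuclideanSpace ℝ (Fin d)) M
  have := hμ.isOpenPosMeasure
  obtain ⟨b, _, hb1, hb⟩ := exists_testFun_bump (𝓡 d) x₀
  obtain ⟨φ₀, hφ₀⟩ := exists_realPairing_eq_one (μ := μ) hb (x₀ := x₀) (by rw [hb1]; exact one_ne_zero)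
  have hF := bumpFunctional_regular hμ hb hK hfK hε hf
  have hG := bumpFunctional_regular hμ hb hL hgL hε hg
  refine ⟨_, _, hF.1, hG.1, fun hc => ?_, fun 𝒱 => ⟨hF.2 𝒱, hG.2 𝒱⟩⟩
  -- Along this sequence the gradients are f j and g j, so the bracket stays away from zero, whereas
  -- both gradients vanish at the limit.
  have h1 : Tendsto (fun j : ℕ => (1 / 2 : ℝ) ^ j • φ₀) atTop (𝓝 0) := by
    have := (tendsto_pow_atTop_nhds_zero_of_lt_one (r := (1 / 2 : ℝ)) (by norm_num)
      (by norm_num)).smul_const φ₀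
    rwa [zero_smul] at this
  have h2 := (hc.tendsto 0).comp h1
  have h3 : bracket μ W (bumpFunctional (realPairing μ b) fun j => pairing μ (f j))
      (bumpFunctional (realPairing μ b) fun j => pairing μ (g j)) 0 = 0 := by
    rw [bracket, gradient_bumpFunctional_zero hμ hε hf, tensor_zero_left, map_zero]
  rw [h3] at h2
  have h4 := h2.norm
  rw [norm_zero] at h4
  obtain ⟨j, hj⟩ := (h4.eventually (gt_mem_nhds (zero_lt_one' ℝ))).exists
  simp only [Function.comp_apply, bracket] at hj
  rw [gradient_bumpFunctional hμ hε hf hφ₀, gradient_bumpFunctional hμ hε hg hφ₀] at hj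
  exact absurd (hW j) (not_le.2 hj)

theorem modulate_tensor (p : M × M) (χ₁ χ₂ : TestFun (𝓡 d) M)
    (h₁ : tsupport (χ₁ : M → ℂ) ⊆ (chartAt (EuclideanSpace ℝ (Fin d)) p.1).source)
    (h₂ : tsupport (χ₂ : M → ℂ) ⊆ (chartAt (EuclideanSpace ℝ (Fin d)) p.2).source)
    (h : tsupport (tensor χ₁ χ₂ : M × M → ℂ) ⊆
      (chartAt (ModelProd (EuclideanSpace ℝ (Fin d)) (EuclideanSpace ℝ (Fin d))) p).source)
    (η : EuclideanSpace ℝ (Fin d) × EuclideanSpace ℝ (Fin d) →L[ℝ] ℝ) :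
    modulate p (tensor χ₁ χ₂) h η =
      tensor (modulate p.1 χ₁ h₁ (η.comp (ContinuousLinearMap.inl ℝ _ _)))
        (modulate p.2 χ₂ h₂ (η.comp (ContinuousLinearMap.inr ℝ _ _))) := by
  refine Subtype.ext (funext fun y => ?_)
  have hη : ∀ v, η v = η.comp (ContinuousLinearMap.inl ℝ _ _) v.1 +
      η.comp (ContinuousLinearMap.inr ℝ _ _) v.2 := by
    intro v
    simp only [ContinuousLinearMap.comp_apply, ContinuousLinearMap.inl_apply,
      ContinuousLinearMap.inr_apply, ← map_add]
    simp
  simp only [modulate, tensor]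
  rw [hη]
  simp only [extChartAt_prod, PartialEquiv.prod_coe]
  push_cast
  rw [mul_add, neg_add, Complex.exp_add]
  ring

theorem tsupport_tensor_subset (f g : TestFun (𝓡 d) M) :
    tsupport (tensor f g : M × M → ℂ) ⊆ tsupport f.1 ×ˢ tsupport g.1 := by
  refine closure_minimal (fun p hp => ?_) ((isClosed_tsupport _).prod (isClosed_tsupport _))
  exact ⟨subset_tsupport _ (left_ne_zero_of_mul hp), subset_tsupport _ (right_ne_zero_of_mul hp)⟩

theorem eventually_pairing_modulate_decay (hμ : IsSmoothVolume d μ)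
    (c : M) (χ : TestFun (𝓡 d) M)
    (hχ : tsupport (χ : M → ℂ) ⊆ (chartAt (EuclideanSpace ℝ (Fin d)) c).source) (n : ℕ) :
    ∃ C : ℝ, 0 < C ∧ ∀ᶠ h : Config (d := d) M in 𝓝 0,
      ∀ η : EuclideanSpace ℝ (Fin d) →L[ℝ] ℝ,
        (1 + ‖η‖) ^ n * ‖pairing μ (modulate c χ hχ η) h‖ ≤ C := by
  obtain ⟨C, hC0, hC⟩ := hμ.exists_pairing_modulate_decay c χ hχ n
  refine ⟨C + 1, by positivity, ?_⟩
  filter_upwards [eventually_config_chart_bound (I := 𝓡 d) χ.2.2.isCompact hχ n] with h hh η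
  exact (hC h hh η).trans (by linarith)

/-- The neighbourhood of zero depends on the order n of decay but not on j, so one neighbourhood
serves the whole sequence of densities, whatever the frequencies are. -/
theorem eventually_smul_modulate_le (hμ : IsSmoothVolume d μ)
    (c : M) (χ : TestFun (𝓡 d) M)
    (hχ : tsupport (χ : M → ℂ) ⊆ (chartAt (EuclideanSpace ℝ (Fin d)) c).source) (n : ℕ) :
    ∃ C : ℝ, 0 < C ∧ ∀ (η : ℕ → EuclideanSpace ℝ (Fin d) →L[ℝ] ℝ) (a ε : ℕ → ℝ),
      (∀ j, 0 ≤ a j ∧ a j * C ≤ ε j * (1 + ‖η j‖) ^ n) →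
      ∀ᶠ h : Config (d := d) M in 𝓝 0, ∀ j,
        ‖pairing μ ((a j : ℂ) • modulate c χ hχ (η j)) h‖ ≤ ε j := by
  obtain ⟨C, hC0, hC⟩ := eventually_pairing_modulate_decay hμ c χ hχ n
  refine ⟨C, hC0, fun η a ε ha => ?_⟩
  filter_upwards [hC] with h hh j
  rw [pairing_smul_left, norm_mul, Complex.norm_real, Real.norm_of_nonneg (ha j).1]
  have hpos : 0 < (1 + ‖η j‖) ^ n := by positivity
  refine le_of_mul_le_mul_right ?_ hpos
  calc a j * ‖pairing μ (modulate c χ hχ (η j)) h‖ * (1 + ‖η j‖) ^ n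
      = a j * ((1 + ‖η j‖) ^ n * ‖pairing μ (modulate c χ hχ (η j)) h‖) := by ring
    _ ≤ a j * C := by gcongr; exacts [(ha j).1, hh _]
    _ ≤ _ := (ha j).2

/-- If the wavefront set of `W` is not empty, there are regular functionals, microcausal with
respect to every set of covectors, with discontinuous bracket. -/
theorem exists_discontinuous_bracket (hμ : IsSmoothVolume d μ) (W : Bidistr (d := d) M)
    (hW : WF W ≠ ∅) :
    ∃ F G : Config (d := d) M → ℂ,
      IsRegularFunctional μ F ∧ IsRegularFunctional μ G ∧ ¬ Continuous (bracket μ W F G) ∧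
      ∀ 𝒱 : Set (Covectors (𝓡 d) M), IsMicrocausal 𝒱 F ∧ IsMicrocausal 𝒱 G := by
  obtain ⟨⟨p, ξ⟩, hξ, hreg⟩ := nonempty_iff_ne_empty.2 hW
  obtain ⟨χ₁, h₁, h₁', _⟩ := exists_testFun_bump (𝓡 d) p.1
  obtain ⟨χ₂, h₂, h₂', _⟩ := exists_testFun_bump (𝓡 d) p.2
  have hχ : tsupport (tensor χ₁ χ₂ : M × M → ℂ) ⊆
      (chartAt (ModelProd (EuclideanSpace ℝ (Fin d)) (EuclideanSpace ℝ (Fin d))) p).source :=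
    (tsupport_tensor_subset χ₁ χ₂).trans (prod_mono h₁ h₂)
  -- Otherwise the transform would decay rapidly on the cone of all non-zero covectors, and ξ would
  -- be a regular direction.
  have hk : ∃ k : ℕ, ∀ C : ℝ, ∃ η,
      C < (1 + ‖η‖) ^ k * ‖W (modulate p (tensor χ₁ χ₂) hχ η)‖ := by
    by_contra! hcon
    refine hreg ⟨{η | η ≠ 0}, isOpen_ne, hξ, fun h => h rfl,
      fun η hη t ht => smul_ne_zero ht.ne' hη, tensor χ₁ χ₂, hχ, ?_, fun k => ?_⟩
    · change χ₁.1 p.1 * χ₂.1 p.2 ≠ 0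
      rw [h₁', h₂', one_mul]; exact one_ne_zero
    · obtain ⟨C, hC⟩ := hcon k
      exact ⟨C, fun η _ => hC η⟩
  obtain ⟨k, hk⟩ := hk
  obtain ⟨m, C₀, hC₀, hbound⟩ := W.exists_modulate_bound p (tensor χ₁ χ₂) hχ
  have hlarge : ∀ T : ℝ, 0 ≤ T → ∃ η, T ≤ 1 + ‖η‖ ∧
      1 ≤ (1 + ‖η‖) ^ k * ‖W (modulate p (tensor χ₁ χ₂) hχ η)‖ := by
    intro T hT
    -- For 1 + ‖η‖ < T the polynomial bound keeps the weighted transform below C₀ T^(k+m); exceeding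
    -- this value forces a large frequency.
    obtain ⟨η, hη⟩ := hk (max 1 (C₀ * T ^ (k + m)))
    refine ⟨η, ?_, ((le_max_left _ _).trans_lt hη).le⟩
    by_contra! hlt
    refine absurd ((le_max_right _ _).trans_lt hη) (not_lt.2 ?_)
    calc _ ≤ (1 + ‖η‖) ^ k * (C₀ * (1 + ‖η‖) ^ m) := by gcongr; exact hbound η
      _ = C₀ * (1 + ‖η‖) ^ (k + m) := by ring
      _ ≤ _ := by gcongr
  let V : (EuclideanSpace ℝ (Fin d) →L[ℝ] ℝ) → (EuclideanSpace ℝ (Fin d) →L[ℝ] ℝ) → ℝ :=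
    fun α β => ‖W (tensor (modulate p.1 χ₁ h₁ α) (modulate p.2 χ₂ h₂ β))‖
  have hnorm : ∀ η : EuclideanSpace ℝ (Fin d) × EuclideanSpace ℝ (Fin d) →L[ℝ] ℝ,
      ‖η‖ ≤ ‖η.comp (ContinuousLinearMap.inl ℝ _ _)‖ +
        ‖η.comp (ContinuousLinearMap.inr ℝ _ _)‖ := by
    intro η
    refine η.opNorm_le_bound (by positivity) fun v => ?_
    have : η v = η.comp (ContinuousLinearMap.inl ℝ _ _) v.1 +
        η.comp (ContinuousLinearMap.inr ℝ _ _) v.2 := by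
      simp only [ContinuousLinearMap.comp_apply, ContinuousLinearMap.inl_apply,
        ContinuousLinearMap.inr_apply, ← map_add]
      simp
    rw [this, add_mul]
    refine (norm_add_le _ _).trans (add_le_add ?_ ?_)
    · exact (ContinuousLinearMap.le_opNorm _ _).trans (by gcongr; exact norm_fst_le v)
    · exact (ContinuousLinearMap.le_opNorm _ _).trans (by gcongr; exact norm_snd_le v)
  have hV : ∀ T : ℝ, 0 ≤ T → ∃ α β, T ≤ 1 + (‖α‖ + ‖β‖) ∧ 1 ≤ (1 + (‖α‖ + ‖β‖)) ^ k * V α β := by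
    intro T hT
    obtain ⟨η, h1, h2⟩ := hlarge T hT
    refine ⟨_, _, h1.trans (add_le_add_right (hnorm η) 1), h2.trans ?_⟩
    rw [modulate_tensor p χ₁ χ₂ h₁ h₂]
    exact mul_le_mul_of_nonneg_right
      (pow_le_pow_left₀ (by positivity) (add_le_add_right (hnorm η) 1) k) (norm_nonneg _)
  obtain ⟨ε, hε0, hε⟩ := exists_bumpSeq_weight
  have hzero : ∀ (c : M) (χ : TestFun (𝓡 d) M)
      (h : tsupport (χ : M → ℂ) ⊆ (chartAt (EuclideanSpace ℝ (Fin d)) c).source) (a : ℂ)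
      (η : EuclideanSpace ℝ (Fin d) →L[ℝ] ℝ), ∀ x ∉ tsupport χ.1,
      (a • modulate c χ h η : TestFun (𝓡 d) M).1 x = 0 := by
    intro c χ h a η x hx
    change a * (χ.1 x * _) = 0
    rw [image_eq_zero_of_notMem_tsupport hx, zero_mul, mul_zero]
  have hval : ∀ (a b : ℝ) α β, 0 ≤ a → 0 ≤ b →
      ‖W (tensor ((a : ℂ) • modulate p.1 χ₁ h₁ α) ((b : ℂ) • modulate p.2 χ₂ h₂ β))‖ =
        a * b * V α β := by
    intro a b α β ha hb
    rw [tensor_smul_smul, map_smul, norm_smul, norm_mul, Complex.norm_real, Complex.norm_real,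
      Real.norm_of_nonneg ha, Real.norm_of_nonneg hb]
  -- A large covector has a large component, but amplitudes are gained only from a component that
  -- stays large along the sequence. Either β does, or beyond some frequency ‖β‖ ≤ ‖α‖ and the roles
  -- are exchanged.
  by_cases hcase : ∀ T : ℝ, ∃ α β, T ≤ 1 + ‖β‖ ∧ 1 ≤ 2 ^ k * (1 + ‖β‖) ^ k * V α β
  · obtain ⟨C₁, hC₁, H₁⟩ := eventually_smul_modulate_le hμ p.1 χ₁ h₁ 0
    obtain ⟨C₂, _, H₂⟩ := eventually_smul_modulate_le hμ p.2 χ₂ h₂ (k + 1)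
    obtain ⟨α, β, a, b, hab⟩ := exists_amplitudes hcase hε0 hC₁
    refine exists_discontinuous_of_sequences hμ W p.1 (K := tsupport χ₁.1) (L := tsupport χ₂.1)
      χ₁.2.2.isCompact χ₂.2.2.isCompact (fun j => hzero _ _ _ (a j : ℂ) (α j))
      (fun j => hzero _ _ _ (b j : ℂ) (β j)) hε
      (H₁ α a ε fun j => ⟨(hab j).1, by rw [pow_zero, mul_one]; exact (hab j).2.2.1⟩)
      (H₂ β b ε fun j => ⟨(hab j).2.1, (hab j).2.2.2.1⟩) fun j => ?_
    rw [hval _ _ _ _ (hab j).1 (hab j).2.1]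
    exact (hab j).2.2.2.2
  · push Not at hcase
    obtain ⟨T₀, hT₀⟩ := hcase
    have hcase' : ∀ T : ℝ, ∃ β α, T ≤ 1 + ‖α‖ ∧ 1 ≤ 2 ^ k * (1 + ‖α‖) ^ k * V α β := by
      intro T
      -- The larger component satisfies 1 + ‖α‖ + ‖β‖ ≤ 2 (1 + max ‖α‖ ‖β‖), which explains the 2
      -- here and the factor 2^k.
      obtain ⟨α, β, h1, h2⟩ := hV (2 * max (max T T₀) 1) (by positivity)
      have hV0 : 0 ≤ V α β := norm_nonneg _
      have hle : ‖β‖ ≤ ‖α‖ := by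
        by_contra! hlt
        have h3 : max (max T T₀) 1 ≤ 1 + ‖β‖ := by linarith
        refine absurd (hT₀ α β ((le_max_right T T₀).trans ((le_max_left _ _).trans h3)))
          (not_lt.2 (h2.trans ?_))
        rw [← mul_pow]
        gcongr
        linarith
      refine ⟨β, α, ?_, h2.trans ?_⟩
      · refine (le_max_left T T₀).trans ((le_max_left _ 1).trans ?_)
        linarith
      · rw [← mul_pow]
        gcongr
        linarith
    obtain ⟨C₁, _, H₁⟩ := eventually_smul_modulate_le hμ p.1 χ₁ h₁ (k + 1)
    obtain ⟨C₂, hC₂, H₂⟩ := eventually_smul_modulate_le hμ p.2 χ₂ h₂ 0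
    obtain ⟨β, α, b, a, hab⟩ := exists_amplitudes (V := fun β α => V α β) hcase' hε0 hC₂
    refine exists_discontinuous_of_sequences hμ W p.1 (K := tsupport χ₁.1) (L := tsupport χ₂.1)
      χ₁.2.2.isCompact χ₂.2.2.isCompact (fun j => hzero _ _ _ (a j : ℂ) (α j))
      (fun j => hzero _ _ _ (b j : ℂ) (β j)) hε
      (H₁ α a ε fun j => ⟨(hab j).2.1, (hab j).2.2.2.1⟩)
      (H₂ β b ε fun j => ⟨(hab j).1, by rw [pow_zero, mul_one]; exact (hab j).2.2.1⟩) fun j => ?_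
    rw [hval _ _ _ _ (hab j).2.1 (hab j).1, mul_comm (a j)]
    exact (hab j).2.2.2.2

end Discontinuity

/-! ### Fourier series of compactly supported functions -/

section FourierSeries

variable {ι : Type} [Fintype ι]

/-- The covector `2π k` on `ℝ^ι`. -/
noncomputable def latticeCovector (k : ι → ℤ) : (ι → ℝ) →L[ℝ] ℝ :=
  ∑ i, (2 * Real.pi * k i) • ContinuousLinearMap.proj i

theorem latticeCovector_apply (k : ι → ℤ) (y : ι → ℝ) :
    latticeCovector k y = ∑ i, 2 * Real.pi * k i * y i := by
  simp [latticeCovector]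

theorem latticeCovector_neg (k : ι → ℤ) : latticeCovector (-k) = -latticeCovector k := by
  ext y
  simp [latticeCovector_apply]

theorem mFourier_coe (k : ι → ℤ) (y : ι → ℝ) :
    UnitAddTorus.mFourier k (fun i => (y i : UnitAddCircle)) = osc (latticeCovector k) y := by
  simp only [UnitAddTorus.mFourier, ContinuousMap.coe_mk, fourier_coe_apply, osc,
    latticeCovector_apply]
  rw [← Complex.exp_sum]
  congr 1
  push_cast
  rw [Finset.mul_sum]
  refine Finset.sum_congr rfl fun i _ => ?_
  ring

/-- Pointwise convergence of the Fourier series of a function supported inside the unit cube. -/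
theorem hasSum_fourier_of_cube {ψ : (ι → ℝ) → ℂ} (hψ : Continuous ψ) {K : Set (ι → ℝ)}
    (hK : IsCompact K) (hKc : ∀ y ∈ K, ∀ i, y i ∈ Ioo (-(1 / 2) : ℝ) (1 / 2))
    (h0 : ∀ y ∉ K, ψ y = 0)
    (hs : Summable fun k : ι → ℤ => ∫ z, ψ z * osc (-latticeCovector k) z) {y : ι → ℝ}
    (hy : y ∈ K) :
    HasSum (fun k : ι → ℤ => (∫ z, ψ z * osc (-latticeCovector k) z) * osc (latticeCovector k) y)
      (ψ y) := by
  have e : (-(1 / 2) : ℝ) + 1 = 1 / 2 := by norm_num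
  let q : (ι → ℝ) → UnitAddTorus ι := fun y i => (y i : UnitAddCircle)
  have hq : Continuous q := continuous_pi fun i =>
    (AddCircle.continuous_mk' 1).comp (continuous_apply i)
  let s : UnitAddTorus ι → (ι → ℝ) := fun t i => (AddCircle.equivIoc 1 (-(1 / 2) : ℝ) (t i) : ℝ)
  have hqs : ∀ t, q (s t) = t := fun t => funext fun i => AddCircle.coe_equivIoc
  have hsq : ∀ y : ι → ℝ, (∀ i, y i ∈ Ioc (-(1 / 2) : ℝ) (-(1 / 2) + 1)) → s (q y) = y :=
    fun y hy => funext fun i => AddCircle.equivIoc_coe_of_mem (hy i)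
  -- The section s of the quotient map jumps only over faces of the cube, and ψ vanishes near these
  -- because K is a compact subset of the open cube.
  have hFc : Continuous (ψ ∘ s) := by
    rw [continuous_iff_continuousAt]
    intro t
    by_cases ht : s t ∈ K
    · refine hψ.continuousAt.comp (continuousAt_pi.2 fun i => ?_)
      refine continuous_subtype_val.continuousAt.comp
        (ContinuousAt.comp (AddCircle.continuousAt_equivIoc 1 _ fun hne => ?_)
          (continuous_apply i).continuousAt)
      have h1 := hKc _ ht i
      have h2 : ((s t i : ℝ) : UnitAddCircle) = ((-(1 / 2) + 1 : ℝ) : UnitAddCircle) := by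
        rw [show ((s t i : ℝ) : UnitAddCircle) = t i from congrFun (hqs t) i, hne]
        rw [AddCircle.coe_add_period 1]
      rw [AddCircle.coe_eq_coe_iff_of_mem_Ioc (a := (-(1 / 2) : ℝ)) (by rw [e]; exact ⟨h1.1, h1.2.le⟩)
        (by constructor <;> norm_num)] at h2
      rw [h2, e] at h1
      exact lt_irrefl _ h1.2
    · have hcl : IsClosed (q '' K) := (hK.image hq).isClosed
      have hmem : t ∈ (q '' K)ᶜ := by
        rintro ⟨y, hy, rfl⟩
        rw [hsq y fun i => by rw [e]; exact ⟨(hKc y hy i).1, (hKc y hy i).2.le⟩] at ht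
        exact ht hy
      refine (continuousAt_const (y := (0 : ℂ))).congr ?_
      filter_upwards [hcl.isOpen_compl.mem_nhds hmem] with t' ht'
      exact (h0 _ fun h => ht' ⟨_, h, hqs t'⟩).symm
  let F : C(UnitAddTorus ι, ℂ) := ⟨ψ ∘ s, hFc⟩
  have hcoef : ∀ k, UnitAddTorus.mFourierCoeff F k = ∫ z, ψ z * osc (-latticeCovector k) z := by
    intro k
    rw [UnitAddTorus.mFourierCoeff_eq_integral _ _ fun _ => (-(1 / 2) : ℝ)]
    have hms : MeasurableSet {x : ι → ℝ | ∀ i, x i ∈ Ioc (-(1 / 2) : ℝ) (-(1 / 2) + 1)} :=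
      MeasurableSet.univ_pi' fun i => measurableSet_Ioc
    rw [← integral_indicator hms]
    congr 1
    funext z
    by_cases hz : z ∈ {x : ι → ℝ | ∀ i, x i ∈ Ioc (-(1 / 2) : ℝ) (-(1 / 2) + 1)}
    · rw [indicator_of_mem hz, mFourier_coe, latticeCovector_neg, smul_eq_mul, mul_comm]
      congr 1
      change ψ (s (q z)) = ψ z
      rw [hsq z hz]
    · rw [indicator_of_notMem hz, h0 z fun h => hz fun i => ?_, zero_mul]
      rw [e]; exact ⟨(hKc z h i).1, (hKc z h i).2.le⟩
  have h1 := UnitAddTorus.hasSum_mFourier_series_apply_of_summable (f := F)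
    (by rw [funext hcoef]; exact hs) (q y)
  have h2 : F (q y) = ψ y := by
    change ψ (s (q y)) = ψ y
    rw [hsq y fun i => by rw [e]; exact ⟨(hKc y hy i).1, (hKc y hy i).2.le⟩]
  rw [h2] at h1
  refine h1.congr_fun fun k => ?_
  rw [hcoef, ← mFourier_coe, smul_eq_mul]

/-- Over a lattice, inverse powers of the norm are summable once the exponent exceeds the rank; the
zero vector contributes 0 because 0⁻¹ = 0 and the exponent is positive. -/
theorem summable_norm_intVector_inv_pow :
    ∃ n : ℕ, Summable fun k : ι → ℤ => ‖(fun i => (k i : ℝ))‖⁻¹ ^ n := by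
  classical
  let b := Pi.basisFun ℝ ι
  let Λ := Submodule.span ℤ (Set.range b)
  let e : (ι → ℤ) → Λ := fun k => ⟨∑ i, k i • b i,
    Submodule.sum_mem _ fun i _ => Submodule.smul_mem _ _ (Submodule.subset_span ⟨i, rfl⟩)⟩
  have he : ∀ k, ((e k : Λ) : ι → ℝ) = fun i => (k i : ℝ) := by
    intro k
    funext i
    simp [e, b, Finset.sum_apply, Pi.single_apply]
  refine ⟨Module.finrank ℤ Λ + 1, ?_⟩
  have h := (ZLattice.summable_norm_pow_inv Λ _ (Nat.lt_succ_self _)).comp_injective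
    (i := e) fun k l hkl => ?_
  · refine h.congr fun k => ?_
    simp only [Function.comp_apply]
    rw [← he, Nat.succ_eq_add_one]
    rfl
  · have := congrArg (Subtype.val) hkl
    rw [he, he] at this
    funext i
    exact_mod_cast congrFun this i

end FourierSeries

/-- Fourier expansion of smooth functions supported in a fixed compact set. -/
theorem exists_fourier_expansion {X : Type*} [NormedAddCommGroup X] [NormedSpace ℝ X]
    [FiniteDimensional ℝ X] [MeasurableSpace X] [BorelSpace X] {K : Set X} (hK : IsCompact K) :
    ∃ (ν : Measure X) (_ : ν.IsAddHaarMeasure) (J : Type) (η : J → X →L[ℝ] ℝ) (n : ℕ),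
      (Summable fun k => ((1 + ‖η k‖) ^ n)⁻¹) ∧
      ∀ ψ : X → ℂ, ContDiff ℝ ∞ ψ → (∀ y ∉ K, ψ y = 0) → ∀ y ∈ K,
        HasSum (fun k => (∫ z, ψ z * osc (-η k) z ∂ν) * osc (η k) y) (ψ y) := by
  let ι := Fin (Module.finrank ℝ X)
  let L₀ : X ≃L[ℝ] (ι → ℝ) := ContinuousLinearEquiv.ofFinrankEq (by simp [ι])
  obtain ⟨R, hR⟩ := (hK.image L₀.continuous).isBounded.exists_norm_le
  -- The factor r exceeds twice the size of the image of K, so division by r moves K into the open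
  -- cube of side one centred at zero.
  let r : ℝ := 2 * (|R| + 1)
  have hr : 0 < r := by positivity
  let L : X ≃L[ℝ] (ι → ℝ) :=
    L₀.trans (ContinuousLinearEquiv.smulLeft (Units.mk0 r⁻¹ (inv_ne_zero hr.ne')))
  have hL : ∀ x, L x = r⁻¹ • L₀ x := fun x => rfl
  have hKc : ∀ y ∈ L '' K, ∀ i, y i ∈ Ioo (-(1 / 2) : ℝ) (1 / 2) := by
    rintro _ ⟨x, hx, rfl⟩ i
    have h1 : |L₀ x i| ≤ |R| := (norm_le_pi_norm (L₀ x) i).trans ((hR _ ⟨x, hx, rfl⟩).trans (le_abs_self R))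
    rw [hL, Pi.smul_apply, smul_eq_mul, mem_Ioo, ← abs_lt, abs_mul, abs_of_pos (inv_pos.2 hr),
      inv_mul_lt_iff₀ hr]
    simp only [r]
    linarith
  -- Transporting Lebesgue measure avoids a normalizing constant in the coefficients.
  let ν : Measure X := Measure.map L.symm volume
  have hν : ν.IsAddHaarMeasure := L.symm.isAddHaarMeasure_map volume
  let η : (ι → ℤ) → X →L[ℝ] ℝ := fun k => (latticeCovector k).comp (L : X →L[ℝ] (ι → ℝ))
  have hη : ∀ k x, osc (η k) x = osc (latticeCovector k) (L x) := fun k x => rfl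
  have hη' : ∀ k x, osc (-η k) x = osc (-latticeCovector k) (L x) := fun k x => rfl
  obtain ⟨n, hn⟩ := summable_norm_intVector_inv_pow (ι := ι)
  have hsum : Summable fun k => ((1 + ‖η k‖) ^ n)⁻¹ := by
    let c : ℝ := ‖(L.symm : (ι → ℝ) →L[ℝ] X)‖ + 1
    have hc : 0 < c := by positivity
    -- Evaluation at the preimages of the basis vectors recovers 2π k i from η k.
    have hbd : ∀ k : ι → ℤ, ‖(fun i => (k i : ℝ))‖ ≤ c * ‖η k‖ := by
      classical
      intro k
      refine (pi_norm_le_iff_of_nonneg (by positivity)).2 fun i => ?_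
      have h1 : η k (L.symm (Pi.single i 1)) = 2 * Real.pi * k i := by
        change latticeCovector k (L (L.symm _)) = _
        rw [L.apply_symm_apply, latticeCovector_apply]
        rw [Finset.sum_eq_single i (fun j _ hj => by simp [hj]) (by simp)]
        simp
      have h2 := (η k).le_opNorm (L.symm (Pi.single i 1))
      have h3 : ‖L.symm (Pi.single i (1 : ℝ))‖ ≤ c * 1 := by
        refine ((L.symm : (ι → ℝ) →L[ℝ] X).le_opNorm _).trans ?_
        have : ‖(Pi.single i (1 : ℝ) : ι → ℝ)‖ = 1 := by rw [Pi.norm_single, norm_one]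
        rw [this]
        exact mul_le_mul_of_nonneg_right (by simp only [c]; linarith) zero_le_one
      rw [h1, norm_mul, Real.norm_of_nonneg (by positivity)] at h2
      have h4 : 1 ≤ 2 * Real.pi := by linarith [Real.pi_gt_three]
      calc ‖(k i : ℝ)‖ ≤ 2 * Real.pi * ‖(k i : ℝ)‖ := le_mul_of_one_le_left (norm_nonneg _) h4
        _ ≤ ‖η k‖ * ‖L.symm (Pi.single i 1)‖ := h2
        _ ≤ ‖η k‖ * (c * 1) := by gcongr
        _ = _ := by ring
    refine Summable.of_norm_bounded_eventually (hn.mul_left (c ^ n)) ?_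
    filter_upwards [(finite_singleton (0 : ι → ℤ)).compl_mem_cofinite] with k hk
    have hk0 : 0 < ‖(fun i => (k i : ℝ))‖ := by
      rw [norm_pos_iff]
      intro h
      exact hk (funext fun i => by simpa using congrFun h i)
    rw [Real.norm_of_nonneg (by positivity), inv_pow, ← div_eq_mul_inv, inv_eq_one_div,
      div_le_div_iff₀ (by positivity) (by positivity), one_mul, ← mul_pow]
    refine pow_le_pow_left₀ hk0.le ((hbd k).trans ?_) n
    gcongr
    linarith
  refine ⟨ν, hν, ι → ℤ, η, n, hsum, fun ψ hψ h0 y hy => ?_⟩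
  have hint : ∀ k, ∫ z, ψ z * osc (-η k) z ∂ν =
      ∫ z, (ψ ∘ L.symm) z * osc (-latticeCovector k) z := by
    intro k
    simp only [ν]
    rw [show (L.symm : (ι → ℝ) → X) = L.symm.toHomeomorph from rfl,
      L.symm.toHomeomorph.measurableEmbedding.integral_map]
    refine integral_congr_ae (ae_of_all _ fun z => ?_)
    change ψ (L.symm z) * osc (-η k) (L.symm z) = ψ (L.symm z) * _
    rw [hη', L.apply_symm_apply]
  obtain ⟨A, hA1, hA⟩ := exists_bound_iteratedFDeriv_of_isCompact isOpen_univ hψ.contDiffOn hK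
    (subset_univ K) n
  obtain ⟨C, hC0, hC⟩ := exists_fourier_decay_bound ν hK n
  have h1 := hasSum_fourier_of_cube (hψ.continuous.comp L.symm.continuous) (hK.image L.continuous)
    hKc (fun z hz => h0 _ fun h => hz ⟨_, h, L.apply_symm_apply z⟩) ?_ (mem_image_of_mem L hy)
  · simp only [Function.comp_apply, L.symm_apply_apply] at h1
    refine h1.congr_fun fun k => ?_
    rw [hint, hη]
    rfl
  · refine Summable.of_norm_bounded (hsum.mul_left (C * A)) fun k => ?_
    rw [← hint, ← div_eq_mul_inv, le_div_iff₀ (by positivity), mul_comm]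
    refine le_trans (le_of_eq ?_) (hC ψ hψ h0 A (by linarith) hA (η k))
    congr 3
    funext z
    simp [osc]

/-! ### Rapidly convergent series of plane waves -/

section OscSeries

variable {E : Type*} [NormedAddCommGroup E] [NormedSpace ℝ E]

theorem iteratedFDeriv_const_mul_osc (c : ℂ) (η : E →L[ℝ] ℝ) (j : ℕ) (y : E) :
    ‖iteratedFDeriv ℝ j (fun z => c * osc η z) y‖ ≤ ‖c‖ * (1 + ‖η‖) ^ j := by
  have h : (fun z => c * osc η z) = c • osc η := rfl
  rw [h, iteratedFDeriv_const_smul_apply (by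
    exact (contDiff_osc η).contDiffAt.of_le (by exact_mod_cast le_top)), norm_smul]
  gcongr
  refine (norm_iteratedFDeriv_osc_le η j y).trans ?_
  gcongr
  linarith

variable {J : Type*} {c : J → ℂ} {η : J → E →L[ℝ] ℝ}

theorem contDiff_tsum_osc (hc : ∀ n : ℕ, Summable fun k => ‖c k‖ * (1 + ‖η k‖) ^ n) :
    ContDiff ℝ ∞ fun y => ∑' k, c k * osc (η k) y :=
  contDiff_tsum (N := ⊤) (fun _ => contDiff_const.mul (contDiff_osc _)) (fun n _ => hc n)
    fun n k y _ => iteratedFDeriv_const_mul_osc (c k) (η k) n y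

/-- Finitely many derivatives of the tail are uniformly small, which is all that a distribution of
finite order sees. -/
theorem eventually_norm_iteratedFDeriv_tsum_osc_sub_le
    (hc : ∀ n : ℕ, Summable fun k => ‖c k‖ * (1 + ‖η k‖) ^ n) (m : ℕ) {ε : ℝ} (hε : 0 < ε) :
    ∀ᶠ s : Finset J in atTop, ∀ j ≤ m, ∀ y,
      ‖iteratedFDeriv ℝ j (fun z => ∑' k, c k * osc (η k) z - ∑ k ∈ s, c k * osc (η k) z) y‖
        ≤ ε := by
  have h1 : ∀ j : ℕ, ∀ᶠ s : Finset J in atTop, ∀ y,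
      ‖iteratedFDeriv ℝ j (fun z => ∑' k, c k * osc (η k) z - ∑ k ∈ s, c k * osc (η k) z) y‖
        ≤ ε := by
    intro j
    have h2 := tendstoUniformly_tsum (f := fun k y => iteratedFDeriv ℝ j (fun z => c k * osc (η k) z) y)
      (hc j) fun k y => iteratedFDeriv_const_mul_osc (c k) (η k) j y
    rw [Metric.tendstoUniformly_iff] at h2
    filter_upwards [h2 ε hε] with s hs y
    have hd : ∀ k, ContDiff ℝ ∞ fun z => c k * osc (η k) z :=
      fun k => contDiff_const.mul (contDiff_osc _)
    have hj : ((j : ℕ∞) : WithTop ℕ∞) ≤ ∞ := by exact_mod_cast le_top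
    have h3 : (fun z => ∑' k, c k * osc (η k) z - ∑ k ∈ s, c k * osc (η k) z) =
        (fun z => ∑' k, c k * osc (η k) z) - fun z => ∑ k ∈ s, c k * osc (η k) z := rfl
    rw [h3, iteratedFDeriv_sub_apply ((contDiff_tsum_osc hc).contDiffAt.of_le hj)
      ((ContDiff.sum fun k _ => hd k).contDiffAt.of_le hj),
      iteratedFDeriv_tsum_apply (N := ⊤) hd (fun n _ => hc n)
        (fun n k y _ => iteratedFDeriv_const_mul_osc (c k) (η k) n y) le_top,
      iteratedFDeriv_fun_sum_apply fun k _ => ((hd k).contDiffAt.of_le hj)]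
    have := hs y
    rw [dist_eq_norm] at this
    exact this.le
  have h4 : ∀ m : ℕ, ∀ᶠ s : Finset J in atTop, ∀ j ≤ m, ∀ y,
      ‖iteratedFDeriv ℝ j (fun z => ∑' k, c k * osc (η k) z - ∑ k ∈ s, c k * osc (η k) z) y‖
        ≤ ε := fun m => (eventually_all_finite (finite_Iic m)).2 fun j _ => h1 j
  exact h4 m

end OscSeries

/-! ### Localization and decay of Fourier transforms in cones -/

section Localization

variable {E : Type*} [NormedAddCommGroup E] [NormedSpace ℝ E]
  {H : Type*} [TopologicalSpace H] {I : ModelWithCorners ℝ E H} [I.Boundaryless]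
  {N : Type*} [TopologicalSpace N] [ChartedSpace H N] [IsManifold I ∞ N] [T2Space N]

/-- A distribution may be applied term by term to an expansion into plane waves. -/
theorem Distr.hasSum_mulChart (u : Distr I N) (p : N) (χ : TestFun I N)
    (hχ : tsupport (χ : N → ℂ) ⊆ (chartAt H p).source) {J : Type*} {c : J → ℂ}
    {η : J → E →L[ℝ] ℝ} (hc : ∀ n : ℕ, Summable fun k => ‖c k‖ * (1 + ‖η k‖) ^ n)
    {a : E → ℂ} (ha : ContDiff ℝ ∞ a)
    (hsum : ∀ y ∈ extChartAt I p '' tsupport χ.1, HasSum (fun k => c k * osc (η k) y) (a y)) :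
    HasSum (fun k => c k * u (modulate p χ hχ (-η k))) (u (mulChart p χ hχ ha)) := by
  obtain ⟨m, C, hC0, hC⟩ := u.exists_mulChart_bound p χ hχ
  rw [HasSum, SummationFilter.unconditional_filter, Metric.tendsto_nhds]
  intro ε hε
  filter_upwards [eventually_norm_iteratedFDeriv_tsum_osc_sub_le hc m
    (show 0 < ε / (2 * (C + 1)) by positivity)] with s hs
  have hP : ContDiff ℝ ∞ fun z => ∑' k, c k * osc (η k) z - ∑ k ∈ s, c k * osc (η k) z :=
    (contDiff_tsum_osc hc).sub (ContDiff.sum fun k _ => contDiff_const.mul (contDiff_osc _))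
  -- The error is again χ times a function of the coordinates, namely the tail of the series, so the
  -- order bound applies to it.
  have h1 : mulChart p χ hχ hP = mulChart p χ hχ ha - ∑ k ∈ s, c k • modulate p χ hχ (-η k) := by
    refine Subtype.ext (funext fun y => ?_)
    have h2 : (mulChart p χ hχ ha - ∑ k ∈ s, c k • modulate p χ hχ (-η k)).1 y =
        χ.1 y * a (extChartAt I p y) - ∑ k ∈ s, c k * (χ.1 y * osc (η k) (extChartAt I p y)) := by
      rw [AddSubgroupClass.coe_sub, Pi.sub_apply, AddSubmonoidClass.coe_finsetSum,
        Finset.sum_apply, mulChart_apply]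
      congr 1
      refine Finset.sum_congr rfl fun k _ => ?_
      rw [modulate_eq_mulChart, Submodule.coe_smul, Pi.smul_apply, mulChart_apply, neg_neg,
        smul_eq_mul]
    rw [h2, mulChart_apply]
    by_cases hy : y ∈ tsupport χ.1
    · rw [(hsum _ (mem_image_of_mem _ hy)).tsum_eq, mul_sub, Finset.mul_sum]
      congr 1
      exact Finset.sum_congr rfl fun k _ => by ring
    · simp [image_eq_zero_of_notMem_tsupport hy]
  have h3 := hC _ hP _ (by positivity) hs
  rw [h1, map_sub, map_sum] at h3
  simp only [map_smul, smul_eq_mul] at h3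
  rw [dist_comm, dist_eq_norm]
  refine h3.trans_lt ?_
  rw [mul_div_assoc', div_lt_iff₀ (by positivity)]
  nlinarith

/-- The Fourier coefficients of a smooth function with compact support decay rapidly. -/
theorem summable_fourierCoeff {X : Type*} [NormedAddCommGroup X] [NormedSpace ℝ X]
    [FiniteDimensional ℝ X] [MeasurableSpace X] [BorelSpace X] (ν : Measure X)
    [ν.IsAddHaarMeasure] {K : Set X} (hK : IsCompact K) {J : Type*} {ζ : J → X →L[ℝ] ℝ} {n₀ : ℕ}
    (hζ : Summable fun k => ((1 + ‖ζ k‖) ^ n₀)⁻¹) {b : X → ℂ} (hb : ContDiff ℝ ∞ b)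
    (hb0 : ∀ y ∉ K, b y = 0) (n : ℕ) :
    Summable fun k => ‖∫ z, b z * osc (-ζ k) z ∂ν‖ * (1 + ‖ζ k‖) ^ n := by
  obtain ⟨A, hA1, hA⟩ := exists_bound_iteratedFDeriv_of_isCompact isOpen_univ hb.contDiffOn hK
    (subset_univ K) (n + n₀)
  obtain ⟨C, hC0, hC⟩ := exists_fourier_decay_bound ν hK (n + n₀)
  refine Summable.of_nonneg_of_le (fun k => by positivity) (fun k => ?_) (hζ.mul_left (C * A))
  rw [← div_eq_mul_inv, le_div_iff₀ (by positivity)]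
  refine le_trans (le_of_eq ?_) (hC b hb hb0 A (by linarith) hA (ζ k))
  have h : ∀ z, osc (-ζ k) z = Complex.exp (-(Complex.I * (ζ k z : ℂ))) := fun z => by simp [osc]
  simp only [h]
  ring

/-- The localized Fourier transform of `u` decays rapidly on the set `V` of covectors. -/
def Distr.DecaysOn (u : Distr I N) (p : N) (χ : TestFun I N)
    (hχ : tsupport (χ : N → ℂ) ⊆ (chartAt H p).source) (V : Set (E →L[ℝ] ℝ)) : Prop :=
  ∀ k : ℕ, ∃ C : ℝ, ∀ η ∈ V, (1 + ‖η‖) ^ k * ‖u (modulate p χ hχ η)‖ ≤ C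

/-- Peetre's inequality, used to move polynomial weights from η to η - ζ. -/
theorem one_add_norm_le_mul {X : Type*} [SeminormedAddCommGroup X] (a b : X) :
    1 + ‖a‖ ≤ (1 + ‖a - b‖) * (1 + ‖b‖) := by
  have := norm_sub_norm_le a b
  have h1 := norm_nonneg b
  have h2 := norm_nonneg (a - b)
  nlinarith

theorem tsupport_mulChart_subset (p : N) (χ : TestFun I N)
    (hχ : tsupport (χ : N → ℂ) ⊆ (chartAt H p).source) {b : E → ℂ} (hb : ContDiff ℝ ∞ b) :
    tsupport (mulChart p χ hχ hb).1 ⊆ tsupport χ.1 :=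
  closure_mono (Function.support_mul_subset_left _ _)

/-- Multiplication with a further cutoff function preserves rapid decay in slightly smaller sets
of directions. -/
theorem Distr.DecaysOn.mulChart [FiniteDimensional ℝ E] {u : Distr I N} {p : N} {χ : TestFun I N}
    {hχ : tsupport (χ : N → ℂ) ⊆ (chartAt H p).source} {V V' : Set (E →L[ℝ] ℝ)}
    (h : u.DecaysOn p χ hχ V) {ε : ℝ} (hε : 0 < ε)
    (hV : ∀ η ∈ V', ∀ ζ, ‖ζ‖ < ε * ‖η‖ → η - ζ ∈ V) {b : E → ℂ} (hb : ContDiff ℝ ∞ b)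
    (hbs : HasCompactSupport b)
    (hχb : tsupport (mulChart p χ hχ hb : N → ℂ) ⊆ (chartAt H p).source) :
    u.DecaysOn p (PAQFT.mulChart p χ hχ hb) hχb V' := by
  borelize E
  let K := extChartAt I p '' tsupport χ.1 ∪ tsupport b
  have hK : IsCompact K := (isCompact_extChartAt_image χ.2.2.isCompact hχ).union hbs.isCompact
  have hb0 : ∀ y ∉ K, b y = 0 :=
    fun y hy => image_eq_zero_of_notMem_tsupport fun h => hy (Or.inr h)
  obtain ⟨ν, hν, J, ζ, n₀, hζ, hexp⟩ := exists_fourier_expansion hK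
  let c : J → ℂ := fun k => ∫ z, b z * osc (-ζ k) z ∂ν
  have hc : ∀ n : ℕ, Summable fun k => ‖c k‖ * (1 + ‖ζ k‖) ^ n :=
    summable_fourierCoeff ν hK hζ hb hb0
  intro n
  obtain ⟨C₁, hC₁⟩ := h n
  obtain ⟨m, C₂, hC₂0, hC₂⟩ := u.exists_modulate_bound p χ hχ
  let A : ℝ := max C₁ 0 + C₂ * (1 + ε⁻¹) ^ (n + m)
  refine ⟨A * ∑' k, ‖c k‖ * (1 + ‖ζ k‖) ^ (n + m + m), fun η hη => ?_⟩
  -- Expanding b into plane waves writes the transform of b χ u at η as a sum of c k times the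
  -- transform of χ u at η - ζ k. For ‖ζ k‖ < ε ‖η‖ the shifted covector lies in V and decay
  -- applies. Otherwise ‖η‖ ≤ ε⁻¹ ‖ζ k‖, and the polynomial bound costs only powers of ‖ζ k‖, which
  -- the rapidly decreasing c k absorb.
  have hterm : ∀ k, (1 + ‖η‖) ^ n * ‖u (modulate p χ hχ (η - ζ k))‖ ≤
      A * (1 + ‖ζ k‖) ^ (n + m + m) := by
    intro k
    have hζ1 : 1 ≤ 1 + ‖ζ k‖ := by linarith [norm_nonneg (ζ k)]
    have hA0 : 0 ≤ A := add_nonneg (le_max_right _ _) (by positivity)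
    set r := ‖u (modulate p χ hχ (η - ζ k))‖
    by_cases hk : ‖ζ k‖ < ε * ‖η‖
    · calc (1 + ‖η‖) ^ n * r ≤ ((1 + ‖η - ζ k‖) * (1 + ‖ζ k‖)) ^ n * r := by
            gcongr; exact one_add_norm_le_mul _ _
        _ = ((1 + ‖η - ζ k‖) ^ n * r) * (1 + ‖ζ k‖) ^ n := by rw [mul_pow]; ring
        _ ≤ A * (1 + ‖ζ k‖) ^ n := by
            gcongr
            refine (hC₁ _ (hV η hη _ hk)).trans ((le_max_left _ 0).trans ?_)
            exact le_add_of_nonneg_right (by positivity)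
        _ ≤ A * (1 + ‖ζ k‖) ^ (n + m + m) := by
            gcongr
            omega
    · push Not at hk
      have h1 : 1 + ‖η‖ ≤ (1 + ε⁻¹) * (1 + ‖ζ k‖) := by
        have : ‖η‖ ≤ ε⁻¹ * ‖ζ k‖ := by rwa [le_inv_mul_iff₀ hε]
        have h2 : 0 < ε⁻¹ := inv_pos.2 hε
        nlinarith [norm_nonneg (ζ k)]
      have h2 : 1 + ‖η - ζ k‖ ≤ (1 + ‖η‖) * (1 + ‖ζ k‖) := by
        have := norm_sub_le η (ζ k)
        nlinarith [norm_nonneg (ζ k), norm_nonneg η]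
      calc (1 + ‖η‖) ^ n * r ≤ (1 + ‖η‖) ^ n * (C₂ * ((1 + ‖η‖) * (1 + ‖ζ k‖)) ^ m) := by
            gcongr
            refine (hC₂ _).trans ?_
            gcongr
        _ = C₂ * (1 + ‖η‖) ^ (n + m) * (1 + ‖ζ k‖) ^ m := by rw [mul_pow]; ring
        _ ≤ C₂ * ((1 + ε⁻¹) * (1 + ‖ζ k‖)) ^ (n + m) * (1 + ‖ζ k‖) ^ m := by gcongr
        _ = C₂ * (1 + ε⁻¹) ^ (n + m) * (1 + ‖ζ k‖) ^ (n + m + m) := by rw [mul_pow]; ring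
        _ ≤ A * (1 + ‖ζ k‖) ^ (n + m + m) := by
            gcongr
            exact le_add_of_nonneg_left (le_max_right _ _)
  have hbη : ContDiff ℝ ∞ fun y => b y * osc (-η) y := hb.mul (contDiff_osc _)
  have hc' : ∀ n : ℕ, Summable fun k => ‖c k‖ * (1 + ‖ζ k + -η‖) ^ n := by
    intro n
    refine Summable.of_nonneg_of_le (fun k => by positivity) (fun k => ?_)
      ((hc n).mul_right ((1 + ‖η‖) ^ n))
    rw [mul_assoc, ← mul_pow]
    gcongr
    have := norm_add_le (ζ k) (-η)
    rw [norm_neg] at this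
    nlinarith [norm_nonneg (ζ k), norm_nonneg η]
  have h1 := u.hasSum_mulChart p χ hχ hc' hbη fun y hy => by
    have := (hexp b hb hb0 y (Or.inl hy)).mul_right (osc (-η) y)
    refine this.congr_fun fun k => ?_
    rw [osc_add]
    ring
  have h2 : modulate p (PAQFT.mulChart p χ hχ hb) hχb η = PAQFT.mulChart p χ hχ hbη := by
    rw [modulate_eq_mulChart]
    refine Subtype.ext (funext fun y => ?_)
    simp only [mulChart_apply]
    ring
  rw [h2, ← h1.tsum_eq]
  have hle : ∀ k, ‖c k * u (modulate p χ hχ (-(ζ k + -η)))‖ * (1 + ‖η‖) ^ n ≤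
      A * (‖c k‖ * (1 + ‖ζ k‖) ^ (n + m + m)) := by
    intro k
    rw [norm_mul, neg_add, neg_neg, neg_add_eq_sub]
    calc _ = ‖c k‖ * ((1 + ‖η‖) ^ n * ‖u (modulate p χ hχ (η - ζ k))‖) := by ring
      _ ≤ ‖c k‖ * (A * (1 + ‖ζ k‖) ^ (n + m + m)) :=
          mul_le_mul_of_nonneg_left (hterm k) (norm_nonneg _)
      _ = _ := by ring
  have hpos : 0 < (1 + ‖η‖) ^ n := by positivity
  have hs := (hc (n + m + m)).mul_left A
  have hs' : Summable fun k => ‖c k * u (modulate p χ hχ (-(ζ k + -η)))‖ :=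
    Summable.of_nonneg_of_le (fun k => norm_nonneg _)
      (fun k => (le_div_iff₀ hpos).2 (hle k)) (hs.div_const _)
  calc _ ≤ (1 + ‖η‖) ^ n * ∑' k, ‖c k * u (modulate p χ hχ (-(ζ k + -η)))‖ := by
        gcongr
        exact norm_tsum_le_tsum_norm hs'
    _ = ∑' k, ‖c k * u (modulate p χ hχ (-(ζ k + -η)))‖ * (1 + ‖η‖) ^ n := by
        rw [mul_comm, tsum_mul_right]
    _ ≤ _ := (hs'.mul_right _).tsum_le_tsum hle hs
    _ = _ := tsum_mul_left

end Localization

/-! ### Empty wavefront set: rapid decay in all directions -/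

section EmptyWavefront

variable {E : Type*} [NormedAddCommGroup E] [NormedSpace ℝ E]
  {H : Type*} [TopologicalSpace H] {I : ModelWithCorners ℝ E H} [I.Boundaryless]
  {N : Type*} [TopologicalSpace N] [ChartedSpace H N] [IsManifold I ∞ N] [T2Space N]

/-- A test function supported where `χ ≠ 0` is a multiple of `χ` in the chart. -/
theorem exists_eq_mulChart (p : N) (χ : TestFun I N)
    (hχ : tsupport (χ : N → ℂ) ⊆ (chartAt H p).source) (ψ : TestFun I N)
    (hψ : tsupport (ψ : N → ℂ) ⊆ {x | χ.1 x ≠ 0}) :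
    ∃ (b : E → ℂ) (hb : ContDiff ℝ ∞ b), HasCompactSupport b ∧ ψ = mulChart p χ hχ hb := by
  let κ := extChartAt I p
  have hsub : tsupport ψ.1 ⊆ (chartAt H p).source :=
    fun x hx => hχ (subset_tsupport _ (hψ hx))
  have hχc : ContDiffOn ℝ ∞ (χ.1 ∘ κ.symm) κ.target := contDiffOn_comp_extChartAt_symm χ.2.1 p
  have hψc : ContDiffOn ℝ ∞ (ψ.1 ∘ κ.symm) κ.target := contDiffOn_comp_extChartAt_symm ψ.2.1 p
  let s : Set E := κ.target ∩ (χ.1 ∘ κ.symm) ⁻¹' {0}ᶜ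
  have hs : IsOpen s :=
    hχc.continuousOn.isOpen_inter_preimage (isOpen_extChartAt_target p) isOpen_compl_singleton
  let K : Set E := κ '' tsupport ψ.1
  have hK : IsCompact K := isCompact_extChartAt_image ψ.2.2.isCompact hsub
  have hKt : ∀ x ∈ tsupport ψ.1, κ.symm (κ x) = x := fun x hx =>
    κ.left_inv (by rw [extChartAt_source]; exact hsub hx)
  have hKs : K ⊆ s := by
    rintro _ ⟨x, hx, rfl⟩
    refine ⟨mem_extChartAt_target_of_mem_image hsub (mem_image_of_mem _ hx), ?_⟩
    change χ.1 (κ.symm (κ x)) ≠ 0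
    rw [hKt x hx]
    exact hψ hx
  let g : E → ℂ := fun y => (ψ.1 ∘ κ.symm) y * ((χ.1 ∘ κ.symm) y)⁻¹
  have hg : ContDiffOn ℝ ∞ g s :=
    (hψc.mono inter_subset_left).mul ((hχc.mono inter_subset_left).inv fun _ hy => hy.2)
  have h0 : ∀ y ∈ s, y ∉ K → g y = 0 := by
    intro y hy hyK
    have : ψ.1 (κ.symm y) = 0 := image_eq_zero_of_notMem_tsupport fun h =>
      hyK ⟨_, h, κ.right_inv hy.1⟩
    simp only [g, Function.comp_apply, this, zero_mul]
  refine ⟨s.indicator g, contDiff_indicator_of_isCompact hs hg hK hKs h0,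
    HasCompactSupport.intro hK fun y hy => ?_, Subtype.ext (funext fun x => ?_)⟩
  · by_cases hys : y ∈ s
    · rw [indicator_of_mem hys, h0 y hys hy]
    · exact indicator_of_notMem hys g
  · rw [mulChart_apply]
    by_cases hx : x ∈ tsupport ψ.1
    · rw [indicator_of_mem (hKs (mem_image_of_mem κ hx))]
      simp only [g, Function.comp_apply]
      rw [hKt x hx, mul_comm, inv_mul_cancel_right₀ (hψ hx)]
    · rw [image_eq_zero_of_notMem_tsupport hx]
      by_cases hxs : x ∈ (chartAt H p).source
      · by_cases hys : κ x ∈ s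
        · rw [indicator_of_mem hys]
          simp only [g, Function.comp_apply]
          rw [κ.left_inv (by rw [extChartAt_source]; exact hxs),
            image_eq_zero_of_notMem_tsupport hx, zero_mul, mul_zero]
        · rw [indicator_of_notMem hys, mul_zero]
      · rw [image_eq_zero_of_notMem_tsupport fun h => hxs (hχ h), zero_mul]

/-- Extension by zero, in a chart, of a test function supported in the chart domain. -/
theorem exists_chart_extension (p : N) (χ : TestFun I N)
    (hχ : tsupport (χ : N → ℂ) ⊆ (chartAt H p).source) :
    ∃ b : E → ℂ, ContDiff ℝ ∞ b ∧ (∀ y ∉ extChartAt I p '' tsupport χ.1, b y = 0) ∧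
      ∀ x ∈ (chartAt H p).source, b (extChartAt I p x) = χ.1 x := by
  let κ := extChartAt I p
  have h0 : ∀ y ∈ κ.target, y ∉ κ '' tsupport χ.1 → (χ.1 ∘ κ.symm) y = 0 := fun y hy hyK =>
    image_eq_zero_of_notMem_tsupport (f := χ.1) fun h => hyK ⟨_, h, κ.right_inv hy⟩
  refine ⟨κ.target.indicator (χ.1 ∘ κ.symm),
    contDiff_indicator_of_isCompact (isOpen_extChartAt_target p)
      (contDiffOn_comp_extChartAt_symm χ.2.1 p) (isCompact_extChartAt_image χ.2.2.isCompact hχ)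
      (fun y hy => mem_extChartAt_target_of_mem_image hχ hy) h0, fun y hy => ?_, fun x hx => ?_⟩
  · by_cases hyt : y ∈ κ.target
    · rw [indicator_of_mem hyt, h0 y hyt hy]
    · exact indicator_of_notMem hyt _
  · have hxs : x ∈ κ.source := by rw [extChartAt_source]; exact hx
    rw [indicator_of_mem (κ.map_source hxs), Function.comp_apply, κ.left_inv hxs]

/-- The quotient ψ / χ is smooth with compact support in the chart, and for the set of all
directions the shrinking of the cone is void. This permits the passage to a partition of unity. -/
theorem Distr.DecaysOn.of_tsupport_subset [FiniteDimensional ℝ E] {u : Distr I N} {p : N}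
    {χ : TestFun I N} {hχ : tsupport (χ : N → ℂ) ⊆ (chartAt H p).source}
    (h : u.DecaysOn p χ hχ univ) (ψ : TestFun I N)
    (hψ : tsupport (ψ : N → ℂ) ⊆ {x | χ.1 x ≠ 0})
    (hψp : tsupport (ψ : N → ℂ) ⊆ (chartAt H p).source) : u.DecaysOn p ψ hψp univ := by
  obtain ⟨b, hb, hbs, rfl⟩ := exists_eq_mulChart p χ hχ ψ hψ
  exact h.mulChart zero_lt_one (fun _ _ _ _ => mem_univ _) hb hbs hψp

/-- Finitely many cutoff functions have a common multiple. -/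
theorem exists_common_mulChart [FiniteDimensional ℝ E] (p : N) {A : Type*} (s : Finset A)
    (χ : A → TestFun I N) (hχ : ∀ a, tsupport (χ a : N → ℂ) ⊆ (chartAt H p).source)
    (hχp : ∀ a, (χ a).1 p ≠ 0) :
    ∃ θ : TestFun I N, tsupport (θ : N → ℂ) ⊆ (chartAt H p).source ∧ θ.1 p ≠ 0 ∧
      ∀ a ∈ s, ∃ (b : E → ℂ) (hb : ContDiff ℝ ∞ b), HasCompactSupport b ∧
        θ = mulChart p (χ a) (hχ a) hb := by
  classical
  induction s using Finset.induction_on with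
  | empty =>
    obtain ⟨θ, h1, h2, _⟩ := exists_testFun_bump I p
    exact ⟨θ, h1, by rw [h2]; exact one_ne_zero, by simp⟩
  | insert a s _ ih =>
    obtain ⟨θ, h1, h2, h3⟩ := ih
    refine ⟨mulTest θ (χ a), (tsupport_mulTest_subset _ _).trans h1, mul_ne_zero h2 (hχp a), ?_⟩
    intro a' ha'
    rcases Finset.mem_insert.1 ha' with rfl | ha'
    · obtain ⟨b, hb, hb0, hbx⟩ := exists_chart_extension p θ h1
      refine ⟨b, hb, HasCompactSupport.intro (isCompact_extChartAt_image θ.2.2.isCompact h1) hb0,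
        Subtype.ext (funext fun x => ?_)⟩
      rw [mulChart_apply]
      change θ.1 x * (χ a').1 x = _
      by_cases hx : x ∈ (chartAt H p).source
      · rw [hbx x hx, mul_comm]
      · rw [image_eq_zero_of_notMem_tsupport fun h => hx (hχ a' h), mul_zero, zero_mul]
    · obtain ⟨b, hb, hbs, hθ⟩ := h3 a' ha'
      obtain ⟨b', hb', _, hbx'⟩ := exists_chart_extension p (χ a) (hχ a)
      refine ⟨fun y => b y * b' y, hb.mul hb', hbs.mul_right, Subtype.ext (funext fun x => ?_)⟩
      rw [mulChart_apply]
      change θ.1 x * (χ a).1 x = _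
      rw [hθ, mulChart_apply]
      by_cases hx : x ∈ (chartAt H p).source
      · rw [hbx' x hx, mul_assoc]
      · rw [image_eq_zero_of_notMem_tsupport fun h => hx (hχ a' h), zero_mul, zero_mul, zero_mul]

/-- If the wavefront set is empty, every point has a cutoff function for which the localized
Fourier transform decays rapidly in all directions. -/
theorem exists_decaysOn_univ_of_WF_eq_empty [FiniteDimensional ℝ E] {u : Distr I N}
    (hu : WF u = ∅) (p : N) :
    ∃ (θ : TestFun I N) (hθ : tsupport (θ : N → ℂ) ⊆ (chartAt H p).source), θ.1 p ≠ 0 ∧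
      u.DecaysOn p θ hθ univ := by
  have hreg : ∀ ξ : Metric.sphere (0 : E →L[ℝ] ℝ) 1, IsRegularDirected u p ξ.1 := by
    intro ξ
    by_contra hξ
    have hξ0 : ξ.1 ≠ 0 := by
      intro h
      have := ξ.2
      rw [h] at this
      simp at this
    have : (⟨p, ξ.1⟩ : Covectors I N) ∈ WF u := ⟨hξ0, hξ⟩
    rw [hu] at this
    exact this
  choose V hVo hξV hV0 hVc χ hχ hχp hdec using hreg
  -- Balls of radius ε will cover the sphere; the second ε leaves room for the perturbation ζ in the
  -- localization estimate.
  have hε : ∀ ξ : Metric.sphere (0 : E →L[ℝ] ℝ) 1, ∃ ε > 0, Metric.ball ξ.1 (2 * ε) ⊆ V ξ := by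
    intro ξ
    obtain ⟨ε, hε, h⟩ := Metric.isOpen_iff.1 (hVo ξ) _ (hξV ξ)
    exact ⟨ε / 2, by positivity, by rwa [mul_div_cancel₀ _ two_ne_zero]⟩
  choose ε hε hball using hε
  have : ProperSpace (E →L[ℝ] ℝ) := FiniteDimensional.proper_real _
  obtain ⟨t, ht⟩ := (isCompact_sphere (0 : E →L[ℝ] ℝ) 1).elim_finite_subcover
    (fun ξ : Metric.sphere (0 : E →L[ℝ] ℝ) 1 => Metric.ball ξ.1 (ε ξ))
    (fun ξ => Metric.isOpen_ball)
    fun ξ hξ => mem_iUnion.2 ⟨⟨ξ, hξ⟩, Metric.mem_ball_self (hε _)⟩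
  obtain ⟨θ, hθ, hθp, hθm⟩ := exists_common_mulChart p t χ hχ hχp
  refine ⟨θ, hθ, hθp, fun k => ?_⟩
  let V' : Metric.sphere (0 : E →L[ℝ] ℝ) 1 → Set (E →L[ℝ] ℝ) :=
    fun ξ => {η | η ≠ 0 ∧ ‖η‖⁻¹ • η ∈ Metric.ball ξ.1 (ε ξ)}
  have hdec' : ∀ ξ ∈ t, u.DecaysOn p θ hθ (V' ξ) := by
    intro ξ hξ
    obtain ⟨b, hb, hbs, rfl⟩ := hθm ξ hξ
    refine Distr.DecaysOn.mulChart (V := V ξ) (hdec ξ) (hε ξ) (fun η hη ζ hζ => ?_) hb hbs hθ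
    have hpos : 0 < ‖η‖ := norm_pos_iff.2 hη.1
    have h1 : ‖η‖⁻¹ • (η - ζ) ∈ V ξ := by
      refine hball ξ ?_
      rw [Metric.mem_ball, smul_sub]
      have h2 : ‖‖η‖⁻¹ • ζ‖ < ε ξ := by
        rw [norm_smul, norm_inv, norm_norm, inv_mul_lt_iff₀ hpos, mul_comm]
        exact hζ
      have h3 := hη.2
      rw [Metric.mem_ball, dist_eq_norm] at h3
      rw [dist_eq_norm, sub_right_comm]
      refine (norm_sub_le _ _).trans_lt ?_
      linarith
    have h4 := hVc ξ _ h1 ‖η‖ hpos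
    rwa [smul_smul, mul_inv_cancel₀ hpos.ne', one_smul] at h4
  choose! C hC using fun ξ (hξ : ξ ∈ t) => hdec' ξ hξ k
  -- The zero covector lies in none of the cones and needs a term of its own.
  refine ⟨∑ ξ ∈ t, |C ξ| + ‖u (modulate p θ hθ 0)‖, fun η _ => ?_⟩
  by_cases hη : η = 0
  · rw [hη, norm_zero, add_zero, one_pow, one_mul]
    exact le_add_of_nonneg_left (Finset.sum_nonneg fun _ _ => abs_nonneg _)
  · have hpos : 0 < ‖η‖ := norm_pos_iff.2 hη
    have h1 : ‖η‖⁻¹ • η ∈ Metric.sphere (0 : E →L[ℝ] ℝ) 1 := by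
      rw [mem_sphere_zero_iff_norm, norm_smul, norm_inv, norm_norm, inv_mul_cancel₀ hpos.ne']
    obtain ⟨ξ, hξ⟩ := mem_iUnion.1 (ht h1)
    obtain ⟨hξt, hξb⟩ := mem_iUnion.1 hξ
    calc _ ≤ C ξ := hC ξ hξt η ⟨hη, hξb⟩
      _ ≤ |C ξ| := le_abs_self _
      _ ≤ ∑ ξ ∈ t, |C ξ| := Finset.single_le_sum (f := fun ξ => |C ξ|) (fun _ _ => abs_nonneg _) hξt
      _ ≤ _ := le_add_of_nonneg_right (norm_nonneg _)

/-- If the wavefront set is empty, there is a partition of unity on each compact set consisting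
of cutoff functions for which the localized Fourier transforms decay rapidly. -/
theorem exists_decaying_partition [FiniteDimensional ℝ E] [SigmaCompactSpace N] {u : Distr I N}
    (hu : WF u = ∅) {K : Set N} (hK : IsCompact K) :
    ∃ (t : Finset N) (ψ : t → TestFun I N)
      (hψ : ∀ p : t, tsupport (ψ p : N → ℂ) ⊆ (chartAt H p.1).source),
      (∀ p, u.DecaysOn p.1 (ψ p) (hψ p) univ) ∧ ∀ x ∈ K, ∑ p, (ψ p).1 x = 1 := by
  choose θ hθ hθp hdec using exists_decaysOn_univ_of_WF_eq_empty hu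
  have hopen : ∀ p, IsOpen {x | (θ p).1 x ≠ 0} := fun p =>
    isOpen_ne.preimage (θ p).2.1.continuous
  obtain ⟨t, ht⟩ := hK.elim_finite_subcover (fun p => {x | (θ p).1 x ≠ 0}) hopen
    fun x _ => mem_iUnion.2 ⟨x, hθp x⟩
  have hcov : K ⊆ ⋃ p : t, {x | (θ p.1).1 x ≠ 0} := by
    intro x hx
    obtain ⟨p, hp⟩ := mem_iUnion.1 (ht hx)
    obtain ⟨hpt, hpx⟩ := mem_iUnion.1 hp
    exact mem_iUnion.2 ⟨⟨p, hpt⟩, hpx⟩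
  obtain ⟨f, hf⟩ := SmoothPartitionOfUnity.exists_isSubordinate I hK.isClosed
    (fun p : t => {x | (θ p.1).1 x ≠ 0}) (fun p => hopen p.1) hcov
  have hsupp : ∀ p : t, tsupport (fun x => ((f p x : ℝ) : ℂ)) ⊆ {x | (θ p.1).1 x ≠ 0} := by
    intro p
    refine subset_trans (closure_mono fun x hx => ?_) (hf p)
    intro h
    exact hx (Complex.ofReal_eq_zero.2 h)
  let ψ : t → TestFun I N := fun p => ⟨fun x => ((f p x : ℝ) : ℂ),
    (Complex.ofRealCLM.contDiff.contMDiff).comp (f p).contMDiff,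
    (θ p.1).2.2.isCompact.of_isClosed_subset (isClosed_tsupport _)
      ((hsupp p).trans fun x hx => subset_tsupport _ hx)⟩
  have hψ : ∀ p : t, tsupport (ψ p : N → ℂ) ⊆ (chartAt H p.1).source := fun p x hx =>
    hθ p.1 (subset_tsupport _ (hsupp p hx))
  refine ⟨t, ψ, hψ, fun p => (hdec p.1).of_tsupport_subset (ψ p) (hsupp p) (hψ p), fun x hx => ?_⟩
  have h1 := f.sum_eq_one hx
  rw [finsum_eq_sum_of_fintype] at h1
  change ∑ p, ((f p x : ℝ) : ℂ) = 1
  rw [← Complex.ofReal_sum, h1, Complex.ofReal_one]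

end EmptyWavefront

/-! ### Nuclear families -/

section NuclearFamilies

variable {A : Type*} [AddCommGroup A] [Module ℝ A] [TopologicalSpace A]

/-- Weights `w` and two families `a`, `b` of vectors for which `∑ⱼ wⱼ P(aⱼ) Q(bⱼ)` converges
absolutely for all continuous linear functionals `P`, `Q`, locally uniformly in `P` and `Q`. -/
def IsNuclearFamily {J : Type*} (w : J → ℂ) (a b : J → A) : Prop :=
  ∀ U ∈ 𝓝 (0 : A), ∀ V ∈ 𝓝 (0 : A), ∃ r s : J → ℝ,
    (∀ j, 0 < r j ∧ 0 < s j ∧ (r j)⁻¹ • a j ∈ U ∧ (s j)⁻¹ • b j ∈ V) ∧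
    Summable fun j => ‖w j‖ * (r j * s j)

theorem norm_le_of_inv_smul_mem {ℓ : A →ₗ[ℝ] ℂ} {U : Set A} (h : ∀ v ∈ U, ‖ℓ v‖ ≤ 1) {r : ℝ}
    (hr : 0 < r) {v : A} (hv : r⁻¹ • v ∈ U) : ‖ℓ v‖ ≤ r := by
  have h1 := h _ hv
  rwa [map_smul, norm_smul, norm_inv, Real.norm_of_nonneg hr.le, inv_mul_le_iff₀ hr, mul_one] at h1

theorem IsNuclearFamily.summable {J : Type*} {w : J → ℂ} {a b : J → A}
    (h : IsNuclearFamily w a b) {P Q : A →ₗ[ℝ] ℂ} (hP : Continuous P) (hQ : Continuous Q) :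
    Summable fun j => w j * (P (a j) * Q (b j)) := by
  have hnhds : ∀ {P : A →ₗ[ℝ] ℂ}, Continuous P → {v | ‖P v‖ ≤ 1} ∈ 𝓝 (0 : A) := by
    intro P hP
    have h1 := (hP.norm.tendsto 0)
    rw [map_zero, norm_zero] at h1
    exact h1.eventually (ge_mem_nhds zero_lt_one)
  obtain ⟨r, s, hrs, hsum⟩ := h _ (hnhds hP) _ (hnhds hQ)
  refine Summable.of_norm_bounded hsum fun j => ?_
  obtain ⟨hr, hs, hra, hsb⟩ := hrs j
  rw [norm_mul, norm_mul]
  gcongr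
  · exact norm_le_of_inv_smul_mem (ℓ := P) (fun v hv => hv) hr hra
  · exact norm_le_of_inv_smul_mem (ℓ := Q) (fun v hv => hv) hs hsb

end NuclearFamilies

/-! ### Fourier coefficients as pairings with oscillating test functions -/

section OneParticle

variable {d : ℕ} {M : Type*} [TopologicalSpace M] [ChartedSpace (EuclideanSpace ℝ (Fin d)) M]
  [IsManifold (𝓡 d) ∞ M] [T2Space M]

/-- The real-valued smooth function `L ∘ f` for a test function `f` and `L : ℂ → ℝ` linear. -/
noncomputable def realComp (L : ℂ →L[ℝ] ℝ) (f : TestFun (𝓡 d) M) : Config (d := d) M :=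
  ⟨fun x => L (f.1 x), L.contDiff.contMDiff.comp f.2.1⟩

theorem realComp_apply (L : ℂ →L[ℝ] ℝ) (f : TestFun (𝓡 d) M) (x : M) :
    realComp L f x = L (f.1 x) := rfl

/-- Oscillating test functions grow at most polynomially in the frequency. -/
theorem exists_inv_smul_realComp_modulate_mem {U : Set (Config (d := d) M)} (hU : U ∈ 𝓝 0)
    (c : M) (θ : TestFun (𝓡 d) M)
    (hθ : tsupport (θ : M → ℂ) ⊆ (chartAt (EuclideanSpace ℝ (Fin d)) c).source) :
    ∃ (m : ℕ) (C : ℝ), 0 < C ∧ ∀ L : ℂ →L[ℝ] ℝ, ‖L‖ ≤ 1 →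
      ∀ η : EuclideanSpace ℝ (Fin d) →L[ℝ] ℝ,
        (C * (1 + ‖η‖) ^ m)⁻¹ • realComp L (modulate c θ hθ η) ∈ U := by
  let κ := extChartAt (𝓡 d) c
  obtain ⟨U', hU', hUU'⟩ := (@mem_nhds_induced _ _ (smoothTopology (𝓡 d) M ℝ) _ 0 U).1 hU
  have hK : IsCompact (κ '' tsupport θ.1) := isCompact_extChartAt_image θ.2.2.isCompact hθ
  have hKt : κ '' tsupport θ.1 ⊆ κ.target := fun y hy => mem_extChartAt_target_of_mem_image hθ hy
  have hU'' : U' ∈ @nhds _ (smoothTopology (𝓡 d) M ℝ) 0 := hU'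
  obtain ⟨m, ε, hε, H⟩ := exists_chart_bound_of_mem_nhds_zero (I := 𝓡 d) θ.2.2.isCompact hθ hU''
  obtain ⟨B, hB1, hB⟩ := exists_bound_iteratedFDeriv_of_isCompact (isOpen_extChartAt_target c)
    (contDiffOn_comp_extChartAt_symm θ.2.1 c) hK hKt m
  have hB0 : 0 < B := by linarith
  refine ⟨m, ε⁻¹ * (2 ^ m * B), by positivity, fun L hL η => hUU' ?_⟩
  set r : ℝ := ε⁻¹ * (2 ^ m * B) * (1 + ‖η‖) ^ m
  have hr : 0 < r := by positivity
  refine H _ (ContMDiffMap.contMDiff _) (fun x hx => ?_) fun j hj y hy => ?_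
  · change r⁻¹ * L (θ.1 x * _) = 0
    rw [image_eq_zero_of_notMem_tsupport hx, zero_mul, map_zero, mul_zero]
  · have hyt := hKt hy
    let g : EuclideanSpace ℝ (Fin d) → ℂ := fun z => (θ.1 ∘ κ.symm) z • osc (-η) z
    have hg : ContDiffOn ℝ ∞ g κ.target :=
      (contDiffOn_comp_extChartAt_symm θ.2.1 c).smul (contDiff_osc _).contDiffOn
    have heq : (r⁻¹ • realComp L (modulate c θ hθ η) : Config (d := d) M) ∘ κ.symm
        =ᶠ[𝓝 y] (r⁻¹ • L) ∘ g := by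
      filter_upwards [(isOpen_extChartAt_target c).mem_nhds hyt] with z hz
      change r⁻¹ * L (θ.1 (κ.symm z) * _) = r⁻¹ * L (θ.1 (κ.symm z) * _)
      rw [show extChartAt (𝓡 d) c (κ.symm z) = z from κ.right_inv hz]
      simp [osc]
    have hj' : ((j : ℕ∞) : WithTop ℕ∞) ≤ ∞ := by exact_mod_cast le_top
    rw [(heq.iteratedFDeriv ℝ j).eq_of_nhds, ContinuousLinearMap.iteratedFDeriv_comp_left _
      (hg.contDiffAt ((isOpen_extChartAt_target c).mem_nhds hyt)) hj']
    have h1 : ‖iteratedFDeriv ℝ j g y‖ ≤ 2 ^ j * (B * (1 + ‖η‖) ^ m) := by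
      refine norm_iteratedFDeriv_smul_le_of_bounds (isOpen_extChartAt_target c)
        (contDiffOn_comp_extChartAt_symm θ.2.1 c) (contDiff_osc _).contDiffOn hyt hB0.le
        (fun i hi => hB i (hi.trans hj) y hy) fun i hi => ?_
      refine (norm_iteratedFDeriv_osc_le _ i y).trans ?_
      rw [norm_neg]
      calc ‖η‖ ^ i ≤ (1 + ‖η‖) ^ i := by gcongr; linarith
        _ ≤ (1 + ‖η‖) ^ m := by
          gcongr
          · linarith [norm_nonneg η]
          · exact hi.trans hj
    have h2 : ‖r⁻¹ • L‖ ≤ r⁻¹ := by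
      rw [norm_smul, norm_inv, Real.norm_of_nonneg hr.le]
      exact mul_le_of_le_one_right (inv_nonneg.2 hr.le) hL
    calc _ ≤ ‖r⁻¹ • L‖ * ‖iteratedFDeriv ℝ j g y‖ :=
          ContinuousLinearMap.norm_compContinuousMultilinearMap_le _ _
      _ ≤ r⁻¹ * (2 ^ m * (B * (1 + ‖η‖) ^ m)) := by
          gcongr
          refine h1.trans ?_
          gcongr
          exact one_le_two
      _ = ε := by
          simp only [r]
          field_simp

variable [MeasurableSpace M] [BorelSpace M] {μ : Measure M} [IsLocallyFiniteMeasure μ]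

theorem integral_mul_testFun_eq (f g : TestFun (𝓡 d) M) :
    ∫ x, f.1 x * g.1 x ∂μ = pairing μ f (realComp Complex.reCLM g) +
      Complex.I * pairing μ f (realComp Complex.imCLM g) := by
  have hc : ∀ L : ℂ →L[ℝ] ℝ, Integrable (fun x => f.1 x * (realComp L g x : ℂ)) μ := fun L =>
    integrable_testFun_mul f (Complex.continuous_ofReal.comp (Config.continuous _))
  rw [pairing_apply, pairing_apply, ← integral_const_mul, ← integral_add (hc _)
    ((hc _).const_mul _)]
  refine integral_congr_ae (ae_of_all _ fun x => ?_)
  simp only [realComp_apply, Complex.reCLM_apply, Complex.imCLM_apply]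
  conv_lhs => rw [← Complex.re_add_im (g.1 x)]
  ring

/-- Fourier expansion, in a chart, of `θ² f`; the coefficients are integrals of `f` against
oscillating test functions. -/
theorem IsSmoothVolume.exists_chart_fourier_expansion (hμ : IsSmoothVolume d μ) (c : M)
    (θ : TestFun (𝓡 d) M)
    (hθ : tsupport (θ : M → ℂ) ⊆ (chartAt (EuclideanSpace ℝ (Fin d)) c).source) :
    ∃ (J : Type) (η : J → EuclideanSpace ℝ (Fin d) →L[ℝ] ℝ) (n₀ : ℕ) (θ' : TestFun (𝓡 d) M)
      (hθ' : tsupport (θ' : M → ℂ) ⊆ (chartAt (EuclideanSpace ℝ (Fin d)) c).source),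
      (Summable fun k => ((1 + ‖η k‖) ^ n₀)⁻¹) ∧ ∀ f : TestFun (𝓡 d) M,
        (∀ n : ℕ, Summable fun k =>
          ‖∫ x, f.1 x * (modulate c θ' hθ' (η k)).1 x ∂μ‖ * (1 + ‖η k‖) ^ n) ∧
        ∃ b : EuclideanSpace ℝ (Fin d) → ℂ, ContDiff ℝ ∞ b ∧
          (∀ x ∈ (chartAt (EuclideanSpace ℝ (Fin d)) c).source,
            b (extChartAt (𝓡 d) c x) = θ.1 x * θ.1 x * f.1 x) ∧
          ∀ y ∈ extChartAt (𝓡 d) c '' tsupport θ.1,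
            HasSum (fun k => (∫ x, f.1 x * (modulate c θ' hθ' (η k)).1 x ∂μ) * osc (η k) y)
              (b y) := by
  let κ := extChartAt (𝓡 d) c
  have hto : IsOpen κ.target := isOpen_extChartAt_target c
  have hK : IsCompact (κ '' tsupport θ.1) := isCompact_extChartAt_image θ.2.2.isCompact hθ
  have hKt : κ '' tsupport θ.1 ⊆ κ.target := fun y hy => mem_extChartAt_target_of_mem_image hθ hy
  obtain ⟨ν, hν, J, η, n₀, hη, hexp⟩ := exists_fourier_expansion hK
  obtain ⟨C, hC⟩ : ∃ C : ℂ, ∀ F : EuclideanSpace ℝ (Fin d) → ℂ,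
      ∫ y, F y ∂ν = C * ∫ y, F y := by
    refine ⟨((ν.addHaarScalarFactor volume : ℝ) : ℂ), fun F => ?_⟩
    conv_lhs => rw [Measure.isAddLeftInvariant_eq_smul ν volume]
    rw [integral_smul_nnreal_measure]
    rfl
  -- Fourier coefficients are integrals over ν, while densities are paired over μ. Dividing by the
  -- density of μ and multiplying by the Haar constant C converts one into the other: the new cutoff
  -- θ' is C θ² / ρ in the chart. One factor θ makes g extend smoothly by zero, the other carries θ'
  -- back to M.
  let g : EuclideanSpace ℝ (Fin d) → ℂ :=
    fun y => (C * θ.1 (κ.symm y)) * ((hμ.density c y : ℝ) : ℂ)⁻¹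
  have hρ : ∀ y ∈ κ.target, ((hμ.density c y : ℝ) : ℂ) ≠ 0 := fun y hy =>
    Complex.ofReal_ne_zero.2 (hμ.density_pos c hy).ne'
  have hg : ContDiffOn ℝ ∞ g κ.target := by
    refine (contDiffOn_const.mul (contDiffOn_comp_extChartAt_symm θ.2.1 c)).mul
      (ContDiffOn.inv ?_ hρ)
    exact Complex.ofRealCLM.contDiff.comp_contDiffOn (hμ.contDiffOn_density c)
  have hg0 : ∀ y ∈ κ.target, y ∉ κ '' tsupport θ.1 → g y = 0 := by
    intro y hy hyK
    have : θ.1 (κ.symm y) = 0 := image_eq_zero_of_notMem_tsupport fun h =>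
      hyK ⟨_, h, κ.right_inv hy⟩
    simp only [g, this, mul_zero, zero_mul]
  let θ' := mulChart c θ hθ (contDiff_indicator_of_isCompact hto hg hK hKt hg0)
  have hθ' : tsupport (θ' : M → ℂ) ⊆ (chartAt (EuclideanSpace ℝ (Fin d)) c).source :=
    (tsupport_mulChart_subset c θ hθ _).trans hθ
  refine ⟨J, η, n₀, θ', hθ', hη, fun f => ?_⟩
  have hsub : tsupport (mulTest (mulTest θ θ) f).1 ⊆ tsupport θ.1 :=
    (tsupport_mulTest_subset _ _).trans (tsupport_mulTest_subset _ _)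
  obtain ⟨b, hb, hb0, hbx⟩ := exists_chart_extension c (mulTest (mulTest θ θ) f) (hsub.trans hθ)
  have hb0' : ∀ y ∉ κ '' tsupport θ.1, b y = 0 := fun y hy => hb0 y fun h =>
    hy (image_mono hsub h)
  have hint : ∀ k, ∫ z, b z * osc (-η k) z ∂ν =
      ∫ x, f.1 x * (modulate c θ' hθ' (η k)).1 x ∂μ := by
    intro k
    rw [hμ.integral_eq c, hC, ← integral_const_mul, ← integral_indicator hto.measurableSet]
    · refine integral_congr_ae (ae_of_all _ fun y => ?_)
      simp only
      by_cases hy : y ∈ κ.target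
      · rw [indicator_of_mem hy]
        have h1 : b y = θ.1 (κ.symm y) * θ.1 (κ.symm y) * f.1 (κ.symm y) := by
          have := hbx (κ.symm y) (by rw [← extChartAt_source (𝓡 d)]; exact κ.map_target hy)
          rwa [show extChartAt (𝓡 d) c (κ.symm y) = y from κ.right_inv hy] at this
        have h2 : (modulate c θ' hθ' (η k)).1 (κ.symm y) =
            θ.1 (κ.symm y) * g y * osc (-η k) y := by
          rw [modulate_eq_mulChart, mulChart_apply, mulChart_apply,
            show extChartAt (𝓡 d) c (κ.symm y) = y from κ.right_inv hy, indicator_of_mem hy]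
        change _ = _ * (f.1 (κ.symm y) * (modulate c θ' hθ' (η k)).1 (κ.symm y))
        rw [h1, h2]
        simp only [g]
        field_simp [hρ y hy]
      · rw [indicator_of_notMem hy, hb0' y fun h => hy (hKt h), zero_mul, mul_zero]
    · exact ((continuous_testFun f).mul (continuous_testFun _)).continuousOn
    · intro x hx
      rw [image_eq_zero_of_notMem_tsupport (f := (modulate c θ' hθ' (η k)).1), mul_zero]
      intro h
      refine hx ?_
      rw [extChartAt_source]
      exact hθ' (closure_mono (Function.support_mul_subset_left _ _) h)
  refine ⟨fun n => ?_, b, hb, fun x hx => (hbx x hx).trans rfl, fun y hy => ?_⟩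
  · simp only [← hint]
    exact summable_fourierCoeff ν hK hη hb hb0' n
  · simp only [← hint]
    exact hexp b hb hb0' y hy

end OneParticle

/-! ### Nuclear expansion of a bidistribution with empty wavefront set -/

section NuclearExpansion

/-- A test function that equals one on a given compact set. -/
theorem exists_testFun_eq_one {E H N : Type*} [NormedAddCommGroup E] [NormedSpace ℝ E]
    [FiniteDimensional ℝ E] [TopologicalSpace H] (I : ModelWithCorners ℝ E H)
    [TopologicalSpace N] [ChartedSpace H N] [IsManifold I ∞ N] [T2Space N] [SigmaCompactSpace N]
    {K U : Set N} (hK : IsCompact K) (hU : IsOpen U) (hKU : K ⊆ U) :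
    ∃ θ : TestFun I N, tsupport (θ : N → ℂ) ⊆ U ∧ ∀ x ∈ K, θ.1 x = 1 := by
  have : LocallyCompactSpace H := I.locallyCompactSpace
  have : LocallyCompactSpace N := ChartedSpace.locallyCompactSpace H N
  obtain ⟨L, hL, hKL, hLU⟩ := exists_compact_between hK hU hKU
  obtain ⟨f, hf⟩ := SmoothPartitionOfUnity.exists_isSubordinate I hK.isClosed
    (fun _ : Unit => interior L) (fun _ => isOpen_interior) (hKL.trans (subset_iUnion_of_subset () subset_rfl))
  have hsupp : tsupport (fun x => ((f () x : ℝ) : ℂ)) ⊆ interior L := by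
    refine subset_trans (closure_mono fun x hx => ?_) (hf ())
    exact fun h => hx (Complex.ofReal_eq_zero.2 h)
  refine ⟨⟨fun x => ((f () x : ℝ) : ℂ), Complex.ofRealCLM.contDiff.contMDiff.comp (f ()).contMDiff,
    hL.of_isClosed_subset (isClosed_tsupport _) (hsupp.trans interior_subset)⟩,
    hsupp.trans (interior_subset.trans hLU), fun x hx => ?_⟩
  have h1 := f.sum_eq_one hx
  rw [finsum_eq_sum_of_fintype] at h1
  change ((f () x : ℝ) : ℂ) = 1
  rw [← Complex.ofReal_one, ← h1]
  simp

theorem norm_le_norm_coprod_left {X Y : Type*} [NormedAddCommGroup X] [NormedSpace ℝ X]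
    [NormedAddCommGroup Y] [NormedSpace ℝ Y] (α : X →L[ℝ] ℝ) (β : Y →L[ℝ] ℝ) :
    ‖α‖ ≤ ‖α.coprod β‖ := by
  refine α.opNorm_le_bound (norm_nonneg _) fun x => ?_
  have := (α.coprod β).le_opNorm (x, 0)
  simpa using this

theorem norm_le_norm_coprod_right {X Y : Type*} [NormedAddCommGroup X] [NormedSpace ℝ X]
    [NormedAddCommGroup Y] [NormedSpace ℝ Y] (α : X →L[ℝ] ℝ) (β : Y →L[ℝ] ℝ) :
    ‖β‖ ≤ ‖α.coprod β‖ := by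
  refine β.opNorm_le_bound (norm_nonneg _) fun x => ?_
  have := (α.coprod β).le_opNorm (0, x)
  simpa using this

theorem norm_coprod_le {X Y : Type*} [NormedAddCommGroup X] [NormedSpace ℝ X]
    [NormedAddCommGroup Y] [NormedSpace ℝ Y] (α : X →L[ℝ] ℝ) (β : Y →L[ℝ] ℝ) :
    ‖α.coprod β‖ ≤ ‖α‖ + ‖β‖ := by
  refine (α.coprod β).opNorm_le_bound (by positivity) fun v => ?_
  rw [ContinuousLinearMap.coprod_apply, add_mul]
  exact (norm_add_le _ _).trans (add_le_add
    ((α.le_opNorm _).trans (by gcongr; exact norm_fst_le v))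
    ((β.le_opNorm _).trans (by gcongr; exact norm_snd_le v)))

theorem osc_coprod {X Y : Type*} [NormedAddCommGroup X] [NormedSpace ℝ X]
    [NormedAddCommGroup Y] [NormedSpace ℝ Y] (α : X →L[ℝ] ℝ) (β : Y →L[ℝ] ℝ) (y : X × Y) :
    osc (α.coprod β) y = osc α y.1 * osc β y.2 := by
  rw [osc, osc, osc, ← Complex.exp_add, ContinuousLinearMap.coprod_apply]
  push_cast
  ring_nf

/-- The real and the imaginary part as linear maps. -/
noncomputable def reIm : Bool → ℂ →L[ℝ] ℝ
  | true => Complex.reCLM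
  | false => Complex.imCLM

theorem norm_reIm_le (s : Bool) : ‖reIm s‖ ≤ 1 := by
  cases s
  · exact Complex.imCLM_norm.le
  · exact Complex.reCLM_norm.le

/-- The coefficients of the real and the imaginary part. -/
noncomputable def reImUnit : Bool → ℂ
  | true => 1
  | false => Complex.I

universe v

variable {d : ℕ} {M : Type v} [TopologicalSpace M] [ChartedSpace (EuclideanSpace ℝ (Fin d)) M]
  [IsManifold (𝓡 d) ∞ M] [T2Space M] [SigmaCompactSpace M]
  [MeasurableSpace M] [BorelSpace M] {μ : Measure M} [IsLocallyFiniteMeasure μ]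

/-- Nuclear expansion of a distribution with rapidly decaying localized Fourier transform. -/
theorem Distr.DecaysOn.exists_nuclear_expansion (hμ : IsSmoothVolume d μ) {W : Bidistr (d := d) M}
    {p : M × M} {ψ : TestFun ((𝓡 d).prod (𝓡 d)) (M × M)}
    {hψ : tsupport (ψ : M × M → ℂ) ⊆
      (chartAt (ModelProd (EuclideanSpace ℝ (Fin d)) (EuclideanSpace ℝ (Fin d))) p).source}
    (h : W.DecaysOn p ψ hψ univ) :
    ∃ (J : Type) (w : J → ℂ) (a b : Bool → J → Config (d := d) M),
      (∀ s t, IsNuclearFamily w (a s) (b t)) ∧ ∀ f g : TestFun (𝓡 d) M,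
        W (mulTest ψ (tensor f g)) = ∑ s, ∑ t, reImUnit s * reImUnit t *
          ∑' j, w j * (pairing μ f (a s j) * pairing μ g (b t j)) := by
  have : LocallyCompactSpace M := ChartedSpace.locallyCompactSpace (EuclideanSpace ℝ (Fin d)) M
  have hL : IsCompact (tsupport ψ.1) := ψ.2.2.isCompact
  have hL₁ : Prod.fst '' tsupport ψ.1 ⊆ (chartAt (EuclideanSpace ℝ (Fin d)) p.1).source := by
    rintro _ ⟨x, hx, rfl⟩
    exact (hψ hx).1
  have hL₂ : Prod.snd '' tsupport ψ.1 ⊆ (chartAt (EuclideanSpace ℝ (Fin d)) p.2).source := by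
    rintro _ ⟨x, hx, rfl⟩
    exact (hψ hx).2
  -- These cutoffs equal one on the projections of the support of ψ, so f and g may be replaced by
  -- θ₁² f and θ₂² g and expanded separately, each in its own chart.
  obtain ⟨θ₁, hθ₁, hθ₁'⟩ := exists_testFun_eq_one (𝓡 d) (hL.image continuous_fst)
    (chartAt _ p.1).open_source hL₁
  obtain ⟨θ₂, hθ₂, hθ₂'⟩ := exists_testFun_eq_one (𝓡 d) (hL.image continuous_snd)
    (chartAt _ p.2).open_source hL₂
  obtain ⟨J₁, η, n₁, χ₁, hχ₁, hη, hexp₁⟩ := hμ.exists_chart_fourier_expansion p.1 θ₁ hθ₁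
  obtain ⟨J₂, ζ, n₂, χ₂, hχ₂, hζ, hexp₂⟩ := hμ.exists_chart_fourier_expansion p.2 θ₂ hθ₂
  let ξ : J₁ × J₂ → EuclideanSpace ℝ (Fin d) × EuclideanSpace ℝ (Fin d) →L[ℝ] ℝ :=
    fun j => (η j.1).coprod (ζ j.2)
  let w : J₁ × J₂ → ℂ := fun j => W (modulate p ψ hψ (-ξ j))
  let a : Bool → J₁ × J₂ → Config (d := d) M :=
    fun s j => realComp (reIm s) (modulate p.1 χ₁ hχ₁ (η j.1))
  let b : Bool → J₁ × J₂ → Config (d := d) M :=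
    fun s j => realComp (reIm s) (modulate p.2 χ₂ hχ₂ (ζ j.2))
  have hnuc : ∀ s t, IsNuclearFamily w (a s) (b t) := by
    intro s t U hU V hV
    obtain ⟨m₁, C₁, hC₁, H₁⟩ := exists_inv_smul_realComp_modulate_mem hU p.1 χ₁ hχ₁
    obtain ⟨m₂, C₂, hC₂, H₂⟩ := exists_inv_smul_realComp_modulate_mem hV p.2 χ₂ hχ₂
    refine ⟨fun j => C₁ * (1 + ‖η j.1‖) ^ m₁, fun j => C₂ * (1 + ‖ζ j.2‖) ^ m₂,
      fun j => ⟨by positivity, by positivity, H₁ _ (norm_reIm_le s) _, H₂ _ (norm_reIm_le t) _⟩, ?_⟩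
    -- The orders m₁, m₂ compensate the growth of the vectors, and n₁, n₂ make the sum over
    -- frequencies converge.
    obtain ⟨C, hC⟩ := h ((m₁ + n₁) + (m₂ + n₂))
    refine Summable.of_nonneg_of_le (fun j => by positivity) (fun j => ?_)
      (((hη.mul_of_nonneg hζ (fun k => by positivity) fun k => by positivity)).mul_left
        (C * (C₁ * C₂)))
    have h1 : ‖w j‖ * ((1 + ‖η j.1‖) ^ (m₁ + n₁) * (1 + ‖ζ j.2‖) ^ (m₂ + n₂)) ≤ C := by
      refine le_trans ?_ (hC (-ξ j) (mem_univ _))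
      rw [mul_comm, norm_neg, pow_add _ (m₁ + n₁)]
      have h2 : ‖η j.1‖ ≤ ‖ξ j‖ := norm_le_norm_coprod_left (η j.1) (ζ j.2)
      have h3 : ‖ζ j.2‖ ≤ ‖ξ j‖ := norm_le_norm_coprod_right (η j.1) (ζ j.2)
      exact mul_le_mul_of_nonneg_right (mul_le_mul
        (pow_le_pow_left₀ (by positivity) (add_le_add_right h2 1) _)
        (pow_le_pow_left₀ (by positivity) (add_le_add_right h3 1) _)
        (by positivity) (by positivity)) (norm_nonneg _)
    rw [← mul_inv, ← div_eq_mul_inv, le_div_iff₀ (by positivity)]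
    calc _ = ‖w j‖ * ((1 + ‖η j.1‖) ^ (m₁ + n₁) * (1 + ‖ζ j.2‖) ^ (m₂ + n₂)) * (C₁ * C₂) := by
          rw [pow_add, pow_add]; ring
      _ ≤ C * (C₁ * C₂) := by gcongr
  refine ⟨J₁ × J₂, w, a, b, hnuc, fun f g => ?_⟩
  obtain ⟨hcs, bf, hbf, hbfx, hf⟩ := hexp₁ f
  obtain ⟨hds, bg, hbg, hbgx, hg⟩ := hexp₂ g
  set c : J₁ → ℂ := fun k => ∫ x, f.1 x * (modulate p.1 χ₁ hχ₁ (η k)).1 x ∂μ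
  set e : J₂ → ℂ := fun k => ∫ x, g.1 x * (modulate p.2 χ₂ hχ₂ (ζ k)).1 x ∂μ
  have hB : ContDiff ℝ ∞ fun y : EuclideanSpace ℝ (Fin d) × EuclideanSpace ℝ (Fin d) =>
      bf y.1 * bg y.2 := (hbf.comp contDiff_fst).mul (hbg.comp contDiff_snd)
  have hmul : mulTest ψ (tensor f g) = PAQFT.mulChart p ψ hψ hB := by
    refine Subtype.ext (funext fun x => ?_)
    rw [mulChart_apply]
    change ψ.1 x * (f.1 x.1 * g.1 x.2) = _
    by_cases hx : x ∈ tsupport ψ.1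
    · simp only [extChartAt_prod, PartialEquiv.prod_coe]
      rw [hbfx _ (hL₁ (mem_image_of_mem _ hx)), hbgx _ (hL₂ (mem_image_of_mem _ hx)),
        hθ₁' _ (mem_image_of_mem _ hx), hθ₂' _ (mem_image_of_mem _ hx)]
      ring
    · rw [image_eq_zero_of_notMem_tsupport hx, zero_mul, zero_mul]
  have hsum := W.hasSum_mulChart p ψ hψ (c := fun j : J₁ × J₂ => c j.1 * e j.2) (η := ξ)
    (fun n => ?_) hB fun y hy => ?_
  · rw [hmul, ← hsum.tsum_eq]
    -- Functionals are differentiated in real directions only, so the complex oscillating functions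
    -- are split into real and imaginary parts.
    have hre : ∀ (f : TestFun (𝓡 d) M) (A : TestFun (𝓡 d) M), ∫ x, f.1 x * A.1 x ∂μ =
        ∑ s, reImUnit s * pairing μ f (realComp (reIm s) A) := by
      intro f A
      rw [integral_mul_testFun_eq, Fintype.sum_bool]
      simp [reImUnit, reIm]
    have hterm : ∀ j : J₁ × J₂, c j.1 * e j.2 * W (modulate p ψ hψ (-ξ j)) =
        ∑ s, ∑ t, reImUnit s * reImUnit t *
          (w j * (pairing μ f (a s j) * pairing μ g (b t j))) := by
      intro j
      simp only [c, e]
      rw [hre, hre, Finset.sum_mul_sum, Finset.sum_mul]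
      refine Finset.sum_congr rfl fun s _ => ?_
      rw [Finset.sum_mul]
      refine Finset.sum_congr rfl fun t _ => ?_
      simp only [w, a, b]
      ring
    have hs : ∀ s t, Summable fun j => reImUnit s * reImUnit t *
        (w j * (pairing μ f (a s j) * pairing μ g (b t j))) := fun s t =>
      ((hnuc s t).summable (continuous_pairing f) (continuous_pairing g)).mul_left _
    rw [tsum_congr hterm, Summable.tsum_finsetSum fun s _ => summable_sum fun t _ => hs s t]
    refine Finset.sum_congr rfl fun s _ => ?_
    rw [Summable.tsum_finsetSum fun t _ => hs s t]
    exact Finset.sum_congr rfl fun t _ => tsum_mul_left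
  · refine Summable.of_nonneg_of_le (fun j => by positivity) (fun j => ?_)
      ((hcs n).mul_of_nonneg (hds n) (fun k => by positivity) fun k => by positivity)
    rw [norm_mul]
    have h1 : 1 + ‖ξ j‖ ≤ (1 + ‖η j.1‖) * (1 + ‖ζ j.2‖) := by
      have := norm_coprod_le (η j.1) (ζ j.2)
      nlinarith [norm_nonneg (η j.1), norm_nonneg (ζ j.2)]
    calc _ ≤ ‖c j.1‖ * ‖e j.2‖ * ((1 + ‖η j.1‖) * (1 + ‖ζ j.2‖)) ^ n := by gcongr
      _ = _ := by rw [mul_pow]; ring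
  · obtain ⟨x, hx, rfl⟩ := hy
    have hx₁ : x.1 ∈ tsupport θ₁.1 := subset_tsupport _ (by
      rw [Function.mem_support, hθ₁' _ (mem_image_of_mem _ hx)]; exact one_ne_zero)
    have hx₂ : x.2 ∈ tsupport θ₂.1 := subset_tsupport _ (by
      rw [Function.mem_support, hθ₂' _ (mem_image_of_mem _ hx)]; exact one_ne_zero)
    have h1 := hf _ (mem_image_of_mem (extChartAt (𝓡 d) p.1) hx₁)
    have h2 := hg _ (mem_image_of_mem (extChartAt (𝓡 d) p.2) hx₂)
    have hn : ∀ {J : Type} (c : J → ℂ) (η : J → EuclideanSpace ℝ (Fin d) →L[ℝ] ℝ) (y),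
        (∀ n : ℕ, Summable fun k => ‖c k‖ * (1 + ‖η k‖) ^ n) →
        Summable fun k => ‖c k * osc (η k) y‖ := by
      intro J c η y h
      refine (h 0).congr fun k => ?_
      rw [norm_mul, norm_osc, pow_zero]
    have h4 := (hn c η (extChartAt (𝓡 d) p.1 x.1) hcs).mul_norm
      (hn e ζ (extChartAt (𝓡 d) p.2 x.2) hds)
    have h3 := HasSum.mul h1 h2 h4.of_norm
    refine h3.congr_fun fun j => ?_
    simp only [ξ, osc_coprod, extChartAt_prod, PartialEquiv.prod_coe]
    ring

/-- A bidistribution with empty wavefront set has nuclear expansions over compact sets. -/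
theorem exists_nuclear_expansion_of_WF_eq_empty (hμ : IsSmoothVolume d μ)
    {W : Bidistr (d := d) M} (hW : WF W = ∅) {K L : Set M} (hK : IsCompact K) (hL : IsCompact L) :
    ∃ (T : Type v) (_ : Fintype T) (J : T → Type) (w : ∀ t, J t → ℂ)
      (a b : ∀ t, Bool → J t → Config (d := d) M),
      (∀ t s s', IsNuclearFamily (w t) (a t s) (b t s')) ∧ ∀ f g : TestFun (𝓡 d) M,
        (∀ x ∉ K, f.1 x = 0) → (∀ x ∉ L, g.1 x = 0) →
        W (tensor f g) = ∑ t, ∑ s, ∑ s', reImUnit s * reImUnit s' *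
          ∑' j, w t j * (pairing μ f (a t s j) * pairing μ g (b t s' j)) := by
  obtain ⟨t, ψ, hψ, hdec, hsum⟩ := exists_decaying_partition hW (hK.prod hL)
  choose J w a b hnuc hexp using fun p : t => (hdec p).exists_nuclear_expansion hμ
  refine ⟨t, inferInstance, J, w, a, b, hnuc, fun f g hf hg => ?_⟩
  have h1 : tensor f g = ∑ p, mulTest (ψ p) (tensor f g) := by
    refine Subtype.ext (funext fun x => ?_)
    rw [AddSubmonoidClass.coe_finsetSum, Finset.sum_apply]
    change f.1 x.1 * g.1 x.2 = ∑ p, (ψ p).1 x * (f.1 x.1 * g.1 x.2)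
    rw [← Finset.sum_mul]
    by_cases hx : x ∈ K ×ˢ L
    · rw [hsum x hx, one_mul]
    · have : f.1 x.1 * g.1 x.2 = 0 := by
        by_cases hx₁ : x.1 ∈ K
        · rw [hg _ fun hx₂ => hx ⟨hx₁, hx₂⟩, mul_zero]
        · rw [hf _ hx₁, zero_mul]
      rw [this, mul_zero]
  conv_lhs => rw [h1]
  rw [map_sum]
  exact Finset.sum_congr rfl fun p _ => hexp p f g

end NuclearExpansion

/-! ### Smoothness of nuclear sums -/

section NuclearSums

variable {A : Type*} [AddCommGroup A] [Module ℝ A]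

/-- Directional derivatives are homogeneous in the first direction. -/
theorem dirDeriv_cons_smul (F : A → ℂ) (c : ℝ) (a : A) :
    ∀ (n : ℕ) (φ : A) (v : Fin n → A),
      dirDeriv F (n + 1) φ (Fin.cons (c • a) v : Fin (n + 1) → A) =
        c • dirDeriv F (n + 1) φ (Fin.cons a v : Fin (n + 1) → A)
  | 0, φ, v => by
    simp only [dirDeriv]
    exact lineDeriv_smul
  | n + 1, φ, v => by
    -- The first direction belongs to the innermost derivative, so a scalar there passes through the
    -- outer ones. Symmetry of the derivatives is not needed.
    have h : ∀ a : A, dirDeriv F (n + 1 + 1) φ (Fin.cons a v : Fin (n + 2) → A) =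
        lineDeriv ℝ (fun χ => dirDeriv F (n + 1) χ (Fin.cons a (Fin.init v) : Fin (n + 1) → A)) φ
          (v (Fin.last n)) := by
      intro a
      have h1 : (Fin.init (Fin.cons a v : Fin (n + 2) → A) : Fin (n + 1) → A) =
          Fin.cons a (Fin.init v) := by
        funext i
        refine Fin.cases rfl (fun j => rfl) i
      have h2 : (Fin.cons a v : Fin (n + 2) → A) (Fin.last (n + 1)) = v (Fin.last n) := rfl
      rw [dirDeriv, h1, h2]
    rw [h, h]
    simp only [dirDeriv_cons_smul F c a n, lineDeriv]
    exact deriv_const_smul_field c _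

theorem dirDeriv_succ_snoc (F : A → ℂ) (n : ℕ) (φ ψ : A) (v : Fin n → A) :
    dirDeriv F (n + 1) φ (Fin.snoc v ψ : Fin (n + 1) → A) =
      lineDeriv ℝ (fun χ => dirDeriv F n χ v) φ ψ := by
  rw [dirDeriv, Fin.init_snoc, Fin.snoc_last]

variable [TopologicalSpace A]

theorem IsBastianiSmooth.hasDerivAt {F : A → ℂ} (hF : IsBastianiSmooth F) (n : ℕ) (φ ψ : A)
    (v : Fin n → A) (t : ℝ) :
    HasDerivAt (fun s : ℝ => dirDeriv F n (φ + s • ψ) v)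
      (dirDeriv F (n + 1) (φ + t • ψ) (Fin.snoc v ψ : Fin (n + 1) → A)) t := by
  have h1 := ((hF n).1 (φ + t • ψ) v ψ).hasLineDerivAt
  rw [← dirDeriv_succ_snoc, HasLineDerivAt] at h1
  rw [← sub_self t] at h1
  have h2 := h1.comp_sub_const t t
  refine h2.congr_of_eventuallyEq (Eventually.of_forall fun s => ?_)
  simp only
  rw [add_assoc, ← add_smul, add_sub_cancel]

/-- Finite linear combinations of smooth functionals are smooth. -/
theorem IsBastianiSmooth.sum_mul {ι : Type*} [Fintype ι] {F : ι → A → ℂ}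
    (hF : ∀ i, IsBastianiSmooth (F i)) (c : ι → ℂ) :
    IsBastianiSmooth fun φ => ∑ i, c i * F i φ := by
  have h1 : ∀ n φ v ψ, HasLineDerivAt ℝ (fun χ => ∑ i, c i * dirDeriv (F i) n χ v)
      (∑ i, c i * dirDeriv (F i) (n + 1) φ (Fin.snoc v ψ : Fin (n + 1) → A)) φ ψ := by
    intro n φ v ψ
    refine HasDerivAt.fun_sum fun i _ => HasDerivAt.const_mul _ ?_
    have := (hF i).hasDerivAt n φ ψ v 0
    rwa [zero_smul, add_zero] at this
  have h2 : ∀ n φ v, dirDeriv (fun φ => ∑ i, c i * F i φ) n φ v =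
      ∑ i, c i * dirDeriv (F i) n φ v := by
    intro n
    induction n with
    | zero => intro φ v; rfl
    | succ n ih =>
      intro φ v
      rw [dirDeriv]
      simp only [ih]
      rw [(h1 n φ (Fin.init v) (v (Fin.last n))).lineDeriv, Fin.snoc_init_self]
  refine fun n => ⟨fun φ v ψ => ?_, ?_⟩
  · simp only [h2]
    exact (h1 n φ v ψ).lineDifferentiableAt
  · simp only [h2]
    exact continuous_finsetSum _ fun i _ => continuous_const.mul (hF i n).2

/-- Near each point, `F^(n+1)(φ){a, v}` is bounded uniformly for `a` in a neighbourhood of zero. -/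
theorem IsBastianiSmooth.exists_nhds_bound {F : A → ℂ} (hF : IsBastianiSmooth F) (n : ℕ)
    (x₀ : A × (Fin n → A)) :
    ∃ U ∈ 𝓝 (0 : A), ∀ᶠ x in 𝓝 x₀, ∀ (a : A) (r : ℝ), 0 < r → r⁻¹ • a ∈ U →
      ‖dirDeriv F (n + 1) x.1 (Fin.cons a x.2 : Fin (n + 1) → A)‖ ≤ r := by
  -- Joint continuity at a = 0, where the derivative vanishes, gives the bound 1 on a product
  -- neighbourhood; homogeneity in a rescales it to r.
  have hc : Continuous fun y : (A × (Fin n → A)) × A =>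
      dirDeriv F (n + 1) y.1.1 (Fin.cons y.2 y.1.2 : Fin (n + 1) → A) := by
    refine (hF (n + 1)).2.comp (Continuous.prodMk (by fun_prop) ?_)
    refine continuous_pi fun i => ?_
    refine Fin.cases ?_ (fun j => ?_) i
    · exact continuous_snd
    · exact (continuous_apply j).comp (continuous_snd.comp continuous_fst)
  have h0 : dirDeriv F (n + 1) x₀.1 (Fin.cons 0 x₀.2 : Fin (n + 1) → A) = 0 := by
    have := dirDeriv_cons_smul F 0 0 n x₀.1 x₀.2
    rwa [zero_smul, zero_smul] at this
  have h0' := hc.norm.tendsto (x₀, 0)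
  rw [h0, norm_zero] at h0'
  have h1 := h0'.eventually (ge_mem_nhds zero_lt_one)
  obtain ⟨u, hu, U, hU, huU⟩ := mem_nhds_prod_iff.1 h1
  refine ⟨U, hU, ?_⟩
  filter_upwards [hu] with x hx a r hr ha
  have h2 : ‖dirDeriv F (n + 1) x.1 (Fin.cons (r⁻¹ • a) x.2 : Fin (n + 1) → A)‖ ≤ 1 :=
    huU (mk_mem_prod hx ha)
  rwa [dirDeriv_cons_smul, norm_smul, norm_inv, Real.norm_of_nonneg hr.le, inv_mul_le_iff₀ hr,
    mul_one] at h2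

variable {J : Type*} (F G : A → ℂ) (w : J → ℂ) (a b : J → A)

/-- The summand `wⱼ F^(p+1)(φ){aⱼ, v ∘ σ} G^(q+1)(φ){bⱼ, v ∘ τ}`. -/
noncomputable def nuclearSummand {n p q : ℕ} (σ : Fin p → Fin n) (τ : Fin q → Fin n) (j : J)
    (φ : A) (v : Fin n → A) : ℂ :=
  w j * (dirDeriv F (p + 1) φ (Fin.cons (a j) (v ∘ σ) : Fin (p + 1) → A) *
    dirDeriv G (q + 1) φ (Fin.cons (b j) (v ∘ τ) : Fin (q + 1) → A))

/-- Finite sums of series of the form `∑ⱼ wⱼ F^(p+1)(φ){aⱼ, v ∘ σ} G^(q+1)(φ){bⱼ, v ∘ τ}`. -/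
inductive IsNuclearSum (n : ℕ) : (A → (Fin n → A) → ℂ) → Prop
  | term {p q : ℕ} (σ : Fin p → Fin n) (τ : Fin q → Fin n) :
      IsNuclearSum n fun φ v => ∑' j, nuclearSummand F G w a b σ τ j φ v
  | add {Q R : A → (Fin n → A) → ℂ} : IsNuclearSum n Q → IsNuclearSum n R →
      IsNuclearSum n fun φ v => Q φ v + R φ v

variable {F G w a b}

/-- The local bounds on the derivatives of F and G supply the neighbourhoods U and V, and nuclearity
returns a summable majorant for precisely these. -/
theorem exists_summable_bound_nuclearSummand (hF : IsBastianiSmooth F) (hG : IsBastianiSmooth G)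
    (h : IsNuclearFamily w a b) {n p q : ℕ} (σ : Fin p → Fin n) (τ : Fin q → Fin n)
    (x₀ : A × (Fin n → A)) :
    ∃ u : J → ℝ, Summable u ∧
      ∀ᶠ x in 𝓝 x₀, ∀ j, ‖nuclearSummand F G w a b σ τ j x.1 x.2‖ ≤ u j := by
  have hσ : ∀ {p : ℕ} (σ : Fin p → Fin n),
      Continuous fun x : A × (Fin n → A) => ((x.1, x.2 ∘ σ) : A × (Fin p → A)) := fun σ =>
    continuous_fst.prodMk (continuous_pi fun i => (continuous_apply (σ i)).comp continuous_snd)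
  obtain ⟨U, hU, hFU⟩ := hF.exists_nhds_bound p (x₀.1, x₀.2 ∘ σ)
  obtain ⟨V, hV, hGV⟩ := hG.exists_nhds_bound q (x₀.1, x₀.2 ∘ τ)
  obtain ⟨r, s, hrs, hsum⟩ := h U hU V hV
  refine ⟨_, hsum, ?_⟩
  filter_upwards [((hσ σ).tendsto x₀).eventually hFU, ((hσ τ).tendsto x₀).eventually hGV]
    with x hx hx' j
  obtain ⟨hr, hs, hra, hsb⟩ := hrs j
  rw [nuclearSummand, norm_mul, norm_mul]
  gcongr
  · exact hx _ _ hr hra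
  · exact hx' _ _ hs hsb

theorem summable_nuclearSummand (hF : IsBastianiSmooth F) (hG : IsBastianiSmooth G)
    (h : IsNuclearFamily w a b) {n p q : ℕ} (σ : Fin p → Fin n) (τ : Fin q → Fin n)
    (φ : A) (v : Fin n → A) : Summable fun j => nuclearSummand F G w a b σ τ j φ v := by
  obtain ⟨u, hu, hb⟩ := exists_summable_bound_nuclearSummand hF hG h σ τ (φ, v)
  exact Summable.of_norm_bounded hu hb.self_of_nhds

theorem continuous_nuclearSummand (hF : IsBastianiSmooth F) (hG : IsBastianiSmooth G)
    {n p q : ℕ} (σ : Fin p → Fin n) (τ : Fin q → Fin n) (j : J) :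
    Continuous fun x : A × (Fin n → A) => nuclearSummand F G w a b σ τ j x.1 x.2 := by
  have hσ : ∀ {p : ℕ} (σ : Fin p → Fin n) (a : A), Continuous fun x : A × (Fin n → A) =>
      ((x.1, Fin.cons a (x.2 ∘ σ)) : A × (Fin (p + 1) → A)) := by
    intro p σ a
    refine continuous_fst.prodMk (continuous_pi fun i => ?_)
    refine Fin.cases ?_ (fun k => ?_) i
    · exact continuous_const
    · exact (continuous_apply (σ k)).comp continuous_snd
  exact continuous_const.mul (((hF (p + 1)).2.comp (hσ σ (a j))).mul
    ((hG (q + 1)).2.comp (hσ τ (b j))))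

theorem IsNuclearSum.continuous (hF : IsBastianiSmooth F) (hG : IsBastianiSmooth G)
    (h : IsNuclearFamily w a b) {n : ℕ} {Q : A → (Fin n → A) → ℂ}
    (hQ : IsNuclearSum F G w a b n Q) : Continuous fun x : A × (Fin n → A) => Q x.1 x.2 := by
  induction hQ with
  | term σ τ =>
    rw [continuous_iff_continuousAt]
    intro x₀
    obtain ⟨u, hu, hb⟩ := exists_summable_bound_nuclearSummand hF hG h σ τ x₀
    have hc : ContinuousOn (fun x : A × (Fin _ → A) =>
        ∑' j, nuclearSummand F G w a b σ τ j x.1 x.2)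
        {x | ∀ j, ‖nuclearSummand F G w a b σ τ j x.1 x.2‖ ≤ u j} :=
      continuousOn_tsum (fun j => (continuous_nuclearSummand hF hG σ τ j).continuousOn) hu
        fun j x hx => hx j
    exact hc.continuousAt hb
  | add _ _ h1 h2 => exact h1.add h2

/-- By the product rule the new direction, stored under the last index, is appended to the arguments
of one of the two factors. The maps σ and τ keep track of which factor received which direction. -/
theorem hasDerivAt_nuclearSummand (hF : IsBastianiSmooth F) (hG : IsBastianiSmooth G)
    {n p q : ℕ} (σ : Fin p → Fin n) (τ : Fin q → Fin n) (j : J) (φ ψ : A) (v : Fin n → A) (t : ℝ) :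
    HasDerivAt (fun s : ℝ => nuclearSummand F G w a b σ τ j (φ + s • ψ) v)
      (nuclearSummand F G w a b (Fin.snoc (Fin.castSucc ∘ σ) (Fin.last n) : Fin (p + 1) → Fin (n + 1))
          (Fin.castSucc ∘ τ) j (φ + t • ψ) (Fin.snoc v ψ : Fin (n + 1) → A) +
        nuclearSummand F G w a b (Fin.castSucc ∘ σ)
          (Fin.snoc (Fin.castSucc ∘ τ) (Fin.last n) : Fin (q + 1) → Fin (n + 1)) j
          (φ + t • ψ) (Fin.snoc v ψ : Fin (n + 1) → A)) t := by
  have h1 : ∀ {p : ℕ} (σ : Fin p → Fin n),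
      (Fin.snoc v ψ : Fin (n + 1) → A) ∘ (Fin.castSucc ∘ σ) = v ∘ σ := by
    intro p σ
    funext i
    simp
  have h2 : ∀ {p : ℕ} (σ : Fin p → Fin n) (a : A),
      (Fin.cons a ((Fin.snoc v ψ : Fin (n + 1) → A) ∘
        (Fin.snoc (Fin.castSucc ∘ σ) (Fin.last n) : Fin (p + 1) → Fin (n + 1))) : Fin (p + 2) → A) =
      Fin.snoc (Fin.cons a (v ∘ σ) : Fin (p + 1) → A) ψ := by
    intro p σ a
    rw [← Fin.cons_snoc_eq_snoc_cons]
    congr 1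
    funext i
    refine Fin.lastCases ?_ (fun k => ?_) i <;> simp
  have h3 := ((hF.hasDerivAt (p + 1) φ ψ (Fin.cons (a j) (v ∘ σ)) t).mul
    (hG.hasDerivAt (q + 1) φ ψ (Fin.cons (b j) (v ∘ τ)) t)).const_mul (w j)
  refine h3.congr_deriv ?_
  simp only [nuclearSummand, h1, h2]
  ring

/-- On a short interval of the line through φ both derivative series have summable majorants, so
differentiation is termwise. Closure of the class under derivatives gives all orders by induction.
-/
theorem IsNuclearSum.exists_hasLineDerivAt [IsTopologicalAddGroup A] [ContinuousSMul ℝ A]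
    (hF : IsBastianiSmooth F) (hG : IsBastianiSmooth G)
    (h : IsNuclearFamily w a b) {n : ℕ} {Q : A → (Fin n → A) → ℂ}
    (hQ : IsNuclearSum F G w a b n Q) :
    ∃ R, IsNuclearSum F G w a b (n + 1) R ∧ ∀ φ v ψ,
      HasLineDerivAt ℝ (fun χ => Q χ v) (R φ (Fin.snoc v ψ : Fin (n + 1) → A)) φ ψ := by
  induction hQ with
  | @term p q σ τ =>
    let σ' : Fin (p + 1) → Fin (n + 1) := Fin.snoc (Fin.castSucc ∘ σ) (Fin.last n)
    let τ' : Fin (q + 1) → Fin (n + 1) := Fin.snoc (Fin.castSucc ∘ τ) (Fin.last n)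
    refine ⟨_, (IsNuclearSum.term σ' (Fin.castSucc ∘ τ)).add
      (IsNuclearSum.term (Fin.castSucc ∘ σ) τ'), fun φ v ψ => ?_⟩
    let v' : Fin (n + 1) → A := Fin.snoc v ψ
    obtain ⟨u₁, hu₁, hb₁⟩ := exists_summable_bound_nuclearSummand hF hG h σ' (Fin.castSucc ∘ τ)
      (φ, v')
    obtain ⟨u₂, hu₂, hb₂⟩ := exists_summable_bound_nuclearSummand hF hG h (Fin.castSucc ∘ σ) τ'
      (φ, v')
    have hline : Tendsto (fun t : ℝ => ((φ + t • ψ, v') : A × (Fin (n + 1) → A))) (𝓝 0)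
        (𝓝 (φ, v')) := by
      have : Continuous fun t : ℝ => ((φ + t • ψ, v') : A × (Fin (n + 1) → A)) := by fun_prop
      have h0 := this.tendsto 0
      rwa [zero_smul, add_zero] at h0
    obtain ⟨δ, hδ, hball⟩ := Metric.mem_nhds_iff.1 (hline.eventually (hb₁.and hb₂))
    have h1 := hasDerivAt_tsum_of_isPreconnected (hu₁.add hu₂) Metric.isOpen_ball
      (convex_ball (0 : ℝ) δ).isPreconnected
      (fun j t _ => hasDerivAt_nuclearSummand (w := w) (a := a) (b := b) hF hG σ τ j φ ψ v t)
      (fun j t ht => (norm_add_le _ _).trans (add_le_add ((hball ht).1 j) ((hball ht).2 j)))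
      (Metric.mem_ball_self hδ) (summable_nuclearSummand hF hG h σ τ _ v) (Metric.mem_ball_self hδ)
    rw [HasLineDerivAt]
    refine h1.congr_deriv ?_
    rw [Summable.tsum_add (summable_nuclearSummand hF hG h σ' (Fin.castSucc ∘ τ) _ _)
      (summable_nuclearSummand hF hG h (Fin.castSucc ∘ σ) τ' _ _), zero_smul, add_zero]
  | add _ _ h1 h2 =>
    obtain ⟨R₁, hR₁, h1⟩ := h1
    obtain ⟨R₂, hR₂, h2⟩ := h2
    exact ⟨_, hR₁.add hR₂, fun φ v ψ => HasDerivAt.add (h1 φ v ψ) (h2 φ v ψ)⟩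

/-- The functional `∑ⱼ wⱼ F^(1)(φ){aⱼ} G^(1)(φ){bⱼ}` is smooth. -/
theorem IsNuclearFamily.isBastianiSmooth [IsTopologicalAddGroup A] [ContinuousSMul ℝ A]
    (h : IsNuclearFamily w a b) (hF : IsBastianiSmooth F) (hG : IsBastianiSmooth G) :
    IsBastianiSmooth fun φ =>
      ∑' j, w j * (dirDeriv F 1 φ (fun _ => a j) * dirDeriv G 1 φ (fun _ => b j)) := by
  set S : A → ℂ := fun φ =>
    ∑' j, w j * (dirDeriv F 1 φ (fun _ => a j) * dirDeriv G 1 φ (fun _ => b j))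
  have key : ∀ n, ∃ Q, IsNuclearSum F G w a b n Q ∧ ∀ φ v, dirDeriv S n φ v = Q φ v := by
    intro n
    induction n with
    | zero =>
      refine ⟨_, IsNuclearSum.term (Fin.elim0 : Fin 0 → Fin 0) (Fin.elim0 : Fin 0 → Fin 0),
        fun φ v => tsum_congr fun j => ?_⟩
      have h1 : ∀ (c : A) (v : Fin 0 → A), (Fin.cons c v : Fin 1 → A) = fun _ => c := by
        intro c v
        funext i
        exact Fin.cases rfl (fun k => k.elim0) i
      rw [nuclearSummand, h1, h1]
    | succ n ih =>
      obtain ⟨Q, hQ, hSQ⟩ := ih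
      obtain ⟨R, hR, hQR⟩ := hQ.exists_hasLineDerivAt hF hG h
      refine ⟨R, hR, fun φ v => ?_⟩
      rw [dirDeriv]
      simp only [hSQ]
      rw [(hQR φ (Fin.init v) (v (Fin.last n))).lineDeriv, Fin.snoc_init_self]
  intro n
  obtain ⟨Q, hQ, hSQ⟩ := key n
  obtain ⟨R, hR, hQR⟩ := hQ.exists_hasLineDerivAt hF hG h
  simp only [hSQ]
  exact ⟨fun φ v ψ => (hQR φ v ψ).lineDifferentiableAt, hQ.continuous hF hG h⟩

end NuclearSums

/-! ### Smooth brackets from an empty wavefront set -/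

section BracketSmooth

universe v

variable {d : ℕ} {M : Type v} [TopologicalSpace M] [ChartedSpace (EuclideanSpace ℝ (Fin d)) M]
  [IsManifold (𝓡 d) ∞ M] [T2Space M] [SecondCountableTopology M]
  [MeasurableSpace M] [BorelSpace M] {μ : Measure M} [IsLocallyFiniteMeasure μ]

/-- The derivative of a regular functional vanishes off its spacetime support. -/
theorem gradient_eq_zero_of_notMem_spacetimeSupport (hμ : IsSmoothVolume d μ)
    {F : Config (d := d) M → ℂ} (hF : IsRegularFunctional μ F) (φ : Config (d := d) M) {x : M}
    (hx : x ∉ spacetimeSupport F) : (gradient μ F φ).1 x = 0 := by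
  have : LocallyCompactSpace M := ChartedSpace.locallyCompactSpace (EuclideanSpace ℝ (Fin d)) M
  have := hμ.isOpenPosMeasure
  obtain ⟨U, hU, hxU, hFU⟩ := not_not.1 hx
  refine TestFun.eq_zero_of_pairing_eq_zero (μ := μ) hU _ (fun h hh => ?_) x hxU
  rw [pairing_apply, ← hF.isGradient_gradient φ h]
  -- Adding multiples of a function supported in U changes φ only inside U, where F is insensitive.
  have h1 : (fun t : ℝ => F (φ + t • h)) = fun _ => F φ := by
    funext t
    refine hFU _ _ fun y hy => ?_
    change φ y + t * h y = φ y
    rw [image_eq_zero_of_notMem_tsupport fun hy' => hy (hh hy'), mul_zero, add_zero]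
  change deriv (fun t : ℝ => F (φ + t • h)) 0 = 0
  rw [h1, deriv_const]

/-- The gradients are supported in fixed compact sets, so one nuclear expansion of W holds for all
φ. Its pairings with the gradients are first derivatives of F and G in fixed directions. -/
theorem isBastianiSmooth_bracket (hμ : IsSmoothVolume d μ) {W : Bidistr (d := d) M}
    (hW : WF W = ∅) {F G : Config (d := d) M → ℂ} (hF : IsRegularFunctional μ F)
    (hG : IsRegularFunctional μ G) : IsBastianiSmooth (bracket μ W F G) := by
  have : LocallyCompactSpace M := ChartedSpace.locallyCompactSpace (EuclideanSpace ℝ (Fin d)) M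
  obtain ⟨T, _, J, w, a, b, hnuc, hexp⟩ :=
    exists_nuclear_expansion_of_WF_eq_empty hμ hW hF.compact_support hG.compact_support
  have h1 : bracket μ W F G = fun φ => ∑ i : T × Bool × Bool,
      reImUnit i.2.1 * reImUnit i.2.2 * ∑' j, w i.1 j *
        (dirDeriv F 1 φ (fun _ => a i.1 i.2.1 j) * dirDeriv G 1 φ (fun _ => b i.1 i.2.2 j)) := by
    funext φ
    rw [bracket, hexp _ _ (fun x hx => gradient_eq_zero_of_notMem_spacetimeSupport hμ hF φ hx)
      (fun x hx => gradient_eq_zero_of_notMem_spacetimeSupport hμ hG φ hx), Fintype.sum_prod_type]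
    refine Finset.sum_congr rfl fun t _ => ?_
    rw [Fintype.sum_prod_type]
    refine Finset.sum_congr rfl fun s _ => Finset.sum_congr rfl fun s' _ => ?_
    congr 1
    refine tsum_congr fun j => ?_
    rw [hF.isGradient_gradient φ, hG.isGradient_gradient φ]
    rfl
  rw [h1]
  exact IsBastianiSmooth.sum_mul
    (fun i : T × Bool × Bool => (hnuc i.1 i.2.1 i.2.2).isBastianiSmooth hF.smooth hG.smooth) _

end BracketSmooth

end PAQFT

/-! ### The main theorem -/

open PAQFT
theorem mainTheorem4 {d : ℕ} {M : Type*} [TopologicalSpace M]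
    [ChartedSpace (EuclideanSpace ℝ (Fin d)) M] [IsManifold (𝓡 d) ∞ M]
    [T2Space M] [SecondCountableTopology M] [MeasurableSpace M] [BorelSpace M]
    (μ : Measure M) (hμ : IsSmoothVolume d μ) (W : Bidistr (d := d) M) :
    ((∀ F G : Config (d := d) M → ℂ, IsRegularFunctional μ F → IsRegularFunctional μ G →
        IsBastianiSmooth (bracket μ W F G)) ↔ WF W = ∅) ∧
    (WF W ≠ ∅ → ∃ F G : Config (d := d) M → ℂ,
      IsRegularFunctional μ F ∧ IsRegularFunctional μ G ∧ ¬ Continuous (bracket μ W F G) ∧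
      ∀ 𝒱 : Set (Covectors (𝓡 d) M),
        IsMicrocausal 𝒱 F ∧ IsMicrocausal 𝒱 G ∧ ¬ IsMicrocausal 𝒱 (bracket μ W F G)) := by
  have := hμ.isLocallyFiniteMeasure
  -- Order zero of smoothness is continuity of the functional itself, so a discontinuous bracket is
  -- neither smooth nor microcausal.
  have hcont : ∀ {F : Config (d := d) M → ℂ}, IsBastianiSmooth F → Continuous F := fun {F} hF =>
    (hF 0).2.comp (continuous_id.prodMk (continuous_const (y := Fin.elim0)))
  refine ⟨⟨fun h => ?_, fun h F G hF hG => ?_⟩, fun h => ?_⟩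
  · by_contra hW
    obtain ⟨F, G, hF, hG, hFG, _⟩ := exists_discontinuous_bracket hμ W hW
    exact hFG (hcont (h F G hF hG))
  · exact isBastianiSmooth_bracket hμ h hF hG
  · obtain ⟨F, G, hF, hG, hFG, h𝒱⟩ := exists_discontinuous_bracket hμ W h
    exact ⟨F, G, hF, hG, hFG, fun 𝒱 => ⟨(h𝒱 𝒱).1, (h𝒱 𝒱).2, fun hm => hFG (hcont hm.1)⟩⟩
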